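/- Let $N\ge 3$, let $p_S:=\frac{N+2}{N-2}$, and let $f:[0,\infty)\to\mathbb{R}$ satisfy: (A1) $f\in C^1[0,\infty)\cap C^2(0,\infty)$, $f(0)=0$ and $f'(0)=0$; (A2) $f'(u)>0$ and $f''(u)>0$ for all $u>0$; (A3) $g(u):=\log f(u)$ is convex for large $u>0$ and $\lim_{u\to\infty} g''(u)/g'(u)^2=0$; (A4) $u f(u)-(p_S+1)\int_0^u f(s)\,ds\ge 0$ for all $u\ge 0$. Then $F(u):=\int_u^\infty \frac{ds}{f(s)}$ is finite for every $u>0$ and $F$ is a bijection of $(0,\infty)$ onto $(0,\infty)$; let $F^{-1}$ denote its inverse. There is exactly one function $u^*\in C^2(\mathbb{R}^N\setminus\{0\})$ such that $$\Delta u^*+f(u^*)=0\ \text{ and }\ u^*\ge 0\ \text{ in }\mathbb{R}^N\setminus\{0\},\qquad u^*\text{ is radial},\qquad u^*(x)\to\infty\ \text{ as } |x|\to 0 .$$ Moreover: - $u^*\in\mathcal{L}^1_{ul}(\mathbb{R}^N)$, the closure of the space $BUC(\mathbb{R}^N)$ of bounded uniformly continuous functions in the space $L^1_{ul}(\mathbb{R}^N)$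 of all $u\in L^1_{loc}(\mathbb{R}^N)$ with finite norm $\|u\|_{L^1_{ul}}:=\sup_{z\in\mathbb{R}^N}\int_{\{|x-z|<1\}}|u(x)|\,dx$; - $\displaystyle u^*(x)=F^{-1}\!\left[\frac{|x|^2}{2N-4}\,(1+o(1))\right]$ as $|x|\to 0$. -/

import Mathlib

open Set Filter Topology MeasureTheory
open scoped ENNReal BoundedContinuousFunction

/-- The critical Sobolev exponent `(N + 2) / (N - 2)`. -/
noncomputable def sobolevExponent (N : ℕ) : ℝ := ((N : ℝ) + 2) / ((N : ℝ) - 2)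

/-- The standing assumptions on the nonlinearity `f` in dimension `N`.
Only the values of `f` on `[0, ∞)` are constrained. -/
structure IsAdmissibleNonlinearity (N : ℕ) (f : ℝ → ℝ) : Prop where
  contDiffOn_one : ContDiffOn ℝ 1 f (Ici 0)
  contDiffOn_two : ContDiffOn ℝ 2 f (Ioi 0)
  map_zero : f 0 = 0
  /-- the (one-sided) derivative at `0` vanishes -/
  deriv_zero : derivWithin f (Ici 0) 0 = 0
  deriv_pos : ∀ u : ℝ, 0 < u → 0 < deriv f u
  deriv_deriv_pos : ∀ u : ℝ, 0 < u → 0 < deriv (deriv f) u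
  log_convex : ∃ M : ℝ, 0 < M ∧ ConvexOn ℝ (Ici M) (fun u => Real.log (f u))
  tendsto_log : Tendsto
    (fun u => deriv (deriv (fun v => Real.log (f v))) u /
      (deriv (fun v => Real.log (f v)) u) ^ 2) atTop (𝓝 0)
  supercritical : ∀ u : ℝ, 0 ≤ u →
    0 ≤ u * f u - (sobolevExponent N + 1) * ∫ s in (0 : ℝ)..u, f s

/-- A radial singular solution of `Δu + f(u) = 0` in `ℝᴺ \ {0}`, of class `C²` there.
A function on `ℝᴺ \ {0}` is represented by a function on `ℝᴺ` whose value at `0` is irrelevant. -/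
structure IsSingularSolution (N : ℕ) (f : ℝ → ℝ) (u : EuclideanSpace ℝ (Fin N) → ℝ) :
    Prop where
  contDiffOn : ContDiffOn ℝ 2 u {0}ᶜ
  equation : ∀ x : EuclideanSpace ℝ (Fin N), x ≠ 0 → Laplacian.laplacian u x + f (u x) = 0
  nonneg : ∀ x : EuclideanSpace ℝ (Fin N), x ≠ 0 → 0 ≤ u x
  radial : ∀ x y : EuclideanSpace ℝ (Fin N), x ≠ 0 → y ≠ 0 → ‖x‖ = ‖y‖ → u x = u y
  singular : Tendsto u (𝓝[≠] 0) atTop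

/-- The uniformly local `Lᵖ` norm: the supremum over `z` of the `Lᵖ` norm on the ball
`B(z, 1)`, with values in `[0, ∞]`. -/
noncomputable def ulNorm {N : ℕ} (p : ℝ≥0∞) (u : EuclideanSpace ℝ (Fin N) → ℝ) : ℝ≥0∞ :=
  ⨆ z : EuclideanSpace ℝ (Fin N), eLpNorm u p (volume.restrict (Metric.ball z 1))

/-- `u` belongs to the uniformly local space `Lᵖ_ul(ℝᴺ)`. -/
def MemUL {N : ℕ} (p : ℝ≥0∞) (u : EuclideanSpace ℝ (Fin N) → ℝ) : Prop :=
  (∀ K : Set (EuclideanSpace ℝ (Fin N)), IsCompact K → MemLp u p (volume.restrict K)) ∧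
    ulNorm p u < ∞

/-- `u` belongs to the closure of the bounded uniformly continuous functions
in `Lᵖ_ul(ℝᴺ)`. -/
def MemULClosureBUC {N : ℕ} (p : ℝ≥0∞) (u : EuclideanSpace ℝ (Fin N) → ℝ) : Prop :=
  MemUL p u ∧ ∀ ε : ℝ≥0∞, 0 < ε →
    ∃ v : EuclideanSpace ℝ (Fin N) →ᵇ ℝ, UniformContinuous v ∧
      ulNorm p (fun x => u x - v x) < ε

/-- `F(u) = ∫_u^∞ ds / f(s)`. -/
noncomputable def tailIntegral (f : ℝ → ℝ) (u : ℝ) : ℝ := ∫ s in Ioi u, 1 / f s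

/-- The inverse of `F : (0, ∞) → ℝ`. -/
noncomputable def tailIntegralInv (f : ℝ → ℝ) : ℝ → ℝ :=
  Function.invFunOn (tailIntegral f) (Ioi 0)

/-!
A radial solution of `Δu + f(u) = 0` in dimension `N = n + 2` is studied in logarithmic time,
`U(s) = u(e^s)`, where it solves `V = U'`, `V' = -n V - e^{2s} f(U)` and the singularity sits at
`s = -∞` (`IsRadialProfile`). With `F(u) = ∫_u^∞ ds / f(s)` and the variables
`l = log (e^{2s} / (2n F(U)))` and `p = (log F(U))' - 2` this becomes
`l' = -p`, `p' = 2n(e^l - 1) - n p - δ (p + 2)²` (`IsEmdenSystem`), where `δ = 1 - f'(U) F(U)`.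
For an exponential nonlinearity `δ = 0`. The hypotheses on `log f` say that in general `δ ≥ 0` and
`δ → 0` as `U → ∞`, and that `δ` is a small perturbation also in the Lipschitz sense with respect
to `l` (`exists_expDefect_nonneg`, `tendsto_expDefect`, `exists_expDefect_lipschitz`). The
equilibrium `(0, 0)` attracts forwards in `s`, and this gives everything about the singularity.

* Asymptotics. For a singular profile, monotonicity of the flux bounds `l` from above and hence `p`.
  Backwards in time a trajectory off the equilibrium must then make the Lyapunov function
  `emdenLyapunov` grow, which is only possible if `l → -∞`, and this would keep `U` bounded. So
  `(l, p) → (0, 0)` as `s → -∞` (`eventually_emdenDist_lt`), which is the asymptotic formula.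
* Uniqueness. The difference of two trajectories near the equilibrium decays exponentially forwards
  in time (`IsEmdenSystem.sq_sub_le`). Starting from time `-∞` it must vanish; uniqueness for the
  initial value problem does the rest (`eq_of_singular`).
* Existence. Profiles started at the equilibrium at times tending to `-∞` remain close to it up to a
  fixed time and form a Cauchy sequence by the same estimate; the limit is a singular profile
  (`exists_singular_profile`). It is continued to all times, and its positivity follows from the
  Pohozaev identity, which is where supercriticality enters (`neg_deriv_le`,
  `exists_singular_profile_univ`).

Finally `u` grows only logarithmically at the origin and is Lipschitz away from it, so truncating it
at small radii approximates it in `L¹` by bounded uniformly continuous functions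
(`memULClosureBUC_comp_log_norm`).
-/

/-! ### Monotonicity from the sign of the derivative -/

lemma antitoneOn_of_forall_hasDerivAt {D : Set ℝ} (hD : Convex ℝ D) {H H' : ℝ → ℝ}
    (h : ∀ s ∈ D, HasDerivAt H (H' s) s) (h0 : ∀ s ∈ D, H' s ≤ 0) : AntitoneOn H D :=
  antitoneOn_of_hasDerivWithinAt_nonpos hD (fun s hs => (h s hs).continuousAt.continuousWithinAt)
    (fun s hs => (h s (interior_subset hs)).hasDerivWithinAt)
    (fun s hs => h0 s (interior_subset hs))

lemma monotoneOn_of_forall_hasDerivAt {D : Set ℝ} (hD : Convex ℝ D) {H H' : ℝ → ℝ}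
    (h : ∀ s ∈ D, HasDerivAt H (H' s) s) (h0 : ∀ s ∈ D, 0 ≤ H' s) : MonotoneOn H D :=
  monotoneOn_of_hasDerivWithinAt_nonneg hD (fun s hs => (h s hs).continuousAt.continuousWithinAt)
    (fun s hs => (h s (interior_subset hs)).hasDerivWithinAt)
    (fun s hs => h0 s (interior_subset hs))

lemma nonneg_of_antitoneOn_Ioi {H : ℝ → ℝ} {M : ℝ} (h : AntitoneOn H (Ioi M))
    (h0 : Tendsto H atTop (𝓝 0)) {u : ℝ} (hu : M < u) : 0 ≤ H u :=
  le_of_tendsto h0 (by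
    filter_upwards [eventually_ge_atTop u] with v hv using h hu (lt_of_lt_of_le hu hv) hv)

/-! ### The nonlinearity and its tail integral -/

namespace IsAdmissibleNonlinearity

variable {N : ℕ} {f : ℝ → ℝ}

lemma hasDerivAt (hf : IsAdmissibleNonlinearity N f) {u : ℝ} (hu : 0 < u) :
    HasDerivAt f (deriv f u) u :=
  ((hf.contDiffOn_two.contDiffAt (Ioi_mem_nhds hu)).differentiableAt (by norm_num)).hasDerivAt

lemma hasDerivAt_deriv (hf : IsAdmissibleNonlinearity N f) {u : ℝ} (hu : 0 < u) :
    HasDerivAt (deriv f) (deriv (deriv f) u) u := by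
  have h : ContDiffOn ℝ 1 (deriv f) (Ioi 0) := by
    have h2 : ContDiffOn ℝ (1 + 1) f (Ioi 0) := by
      have := hf.contDiffOn_two
      norm_num at this ⊢
      exact this
    exact ((contDiffOn_succ_iff_deriv_of_isOpen isOpen_Ioi).1 h2).2.2
  exact ((h.contDiffAt (Ioi_mem_nhds hu)).differentiableAt (by norm_num)).hasDerivAt

lemma continuousOn (hf : IsAdmissibleNonlinearity N f) : ContinuousOn f (Ici 0) :=
  hf.contDiffOn_one.continuousOn

lemma strictMonoOn (hf : IsAdmissibleNonlinearity N f) : StrictMonoOn f (Ici 0) := by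
  apply strictMonoOn_of_deriv_pos (convex_Ici 0) hf.continuousOn
  intro x hx
  rw [interior_Ici] at hx
  exact hf.deriv_pos x hx

lemma pos (hf : IsAdmissibleNonlinearity N f) {u : ℝ} (hu : 0 < u) : 0 < f u := by
  have := hf.strictMonoOn (mem_Ici.2 le_rfl) (mem_Ici.2 hu.le) hu
  rwa [hf.map_zero] at this

lemma nonneg (hf : IsAdmissibleNonlinearity N f) {u : ℝ} (hu : 0 ≤ u) : 0 ≤ f u := by
  rcases hu.eq_or_lt with rfl | h
  · exact hf.map_zero.ge
  · exact (hf.pos h).le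

lemma monotoneOn_deriv (hf : IsAdmissibleNonlinearity N f) : MonotoneOn (deriv f) (Ioi 0) :=
  monotoneOn_of_forall_hasDerivAt (convex_Ioi 0) (fun _ hs => hf.hasDerivAt_deriv hs)
    (fun s hs => (hf.deriv_deriv_pos s hs).le)

lemma tendsto_atTop (hf : IsAdmissibleNonlinearity N f) : Tendsto f atTop atTop := by
  have h1 : MonotoneOn (fun u => f u - deriv f 1 * u) (Ici 1) := by
    refine monotoneOn_of_forall_hasDerivAt (convex_Ici 1)
      (H' := fun u => deriv f u - deriv f 1 * 1) (fun s hs => ?_) (fun s hs => ?_)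
    · exact (hf.hasDerivAt (lt_of_lt_of_le one_pos hs)).sub ((hasDerivAt_id s).const_mul _)
    · have := hf.monotoneOn_deriv (mem_Ioi.2 one_pos) (mem_Ioi.2 (lt_of_lt_of_le one_pos hs)) hs
      simpa using this
  have h2 : Tendsto (fun u : ℝ => (f 1 - deriv f 1 * 1) + deriv f 1 * u) atTop atTop :=
    tendsto_atTop_add_const_left _ _ (tendsto_id.const_mul_atTop (hf.deriv_pos 1 one_pos))
  refine tendsto_atTop_mono' _ ?_ h2
  filter_upwards [eventually_ge_atTop 1] with u hu
  have := h1 (mem_Ici.2 le_rfl) (mem_Ici.2 hu) hu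
  simp only at this
  linarith

/-- For large arguments the logarithmic derivative `f'/f` is bounded below by a positive
constant, and `f'^2 ≤ f f''`: this is log-convexity. -/
lemma exists_log_convex_bounds (hf : IsAdmissibleNonlinearity N f) :
    ∃ M c : ℝ, 0 < M ∧ 0 < c ∧ ∀ u, M < u →
      c * f u ≤ deriv f u ∧ deriv f u ^ 2 ≤ f u * deriv (deriv f) u := by
  obtain ⟨M, hM, hconv⟩ := hf.log_convex
  have hd : ∀ u, 0 < u → HasDerivAt (fun u => Real.log (f u)) (deriv f u / f u) u :=
    fun u hu => (hf.hasDerivAt hu).log (hf.pos hu).ne'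
  have hd2 : ∀ u, 0 < u → HasDerivAt (fun u => deriv f u / f u)
      ((deriv (deriv f) u * f u - deriv f u * deriv f u) / f u ^ 2) u :=
    fun u hu => (hf.hasDerivAt_deriv hu).div (hf.hasDerivAt hu) (hf.pos hu).ne'
  have hmono : MonotoneOn (fun u => deriv f u / f u) (Ici M) := by
    have := hconv.monotoneOn_deriv
      (fun x hx => (hd x (lt_of_lt_of_le hM hx)).differentiableAt)
    intro a ha b hb hab
    have h := this ha hb hab
    rwa [(hd a (lt_of_lt_of_le hM ha)).deriv, (hd b (lt_of_lt_of_le hM hb)).deriv] at h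
  refine ⟨M, deriv f M / f M, hM, div_pos (hf.deriv_pos M hM) (hf.pos hM), fun u hu => ?_⟩
  have hu0 : 0 < u := hM.trans hu
  constructor
  · rw [← le_div_iff₀ (hf.pos hu0)]
    exact hmono (mem_Ici.2 le_rfl) hu.le hu.le
  · have h1 : 0 ≤ derivWithin (fun u => deriv f u / f u) (Ici M) u :=
      hmono.derivWithin_nonneg
    rw [(hd2 u hu0).hasDerivWithinAt.derivWithin
      (uniqueDiffOn_Ici M u hu.le)] at h1
    have h3 := hf.pos hu0
    rw [le_div_iff₀ (by positivity)] at h1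
    nlinarith

/-- `f f'' / f'^2 → 1` at infinity. -/
lemma tendsto_mul_deriv_deriv (hf : IsAdmissibleNonlinearity N f) :
    Tendsto (fun u => f u * deriv (deriv f) u / deriv f u ^ 2) atTop (𝓝 1) := by
  have hd : ∀ u, 0 < u → deriv (fun v => Real.log (f v)) u = deriv f u / f u :=
    fun u hu => ((hf.hasDerivAt hu).log (hf.pos hu).ne').deriv
  have h : Tendsto (fun u => deriv (deriv (fun v => Real.log (f v))) u /
      (deriv (fun v => Real.log (f v)) u) ^ 2 + 1) atTop (𝓝 (0 + 1)) :=
    hf.tendsto_log.add_const 1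
  rw [zero_add] at h
  refine h.congr' ?_
  filter_upwards [eventually_gt_atTop 0] with u hu
  have h2 : deriv (deriv (fun v => Real.log (f v))) u =
      (deriv (deriv f) u * f u - deriv f u * deriv f u) / f u ^ 2 := by
    have he : deriv (fun v => Real.log (f v)) =ᶠ[𝓝 u] fun v => deriv f v / f v := by
      filter_upwards [Ioi_mem_nhds hu] with v hv using hd v hv
    rw [he.deriv_eq]
    exact ((hf.hasDerivAt_deriv hu).div (hf.hasDerivAt hu) (hf.pos hu).ne').deriv
  rw [h2, hd u hu]
  have h3 := (hf.pos hu).ne'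
  have h4 := (hf.deriv_pos u hu).ne'
  field_simp
  ring

lemma tendsto_deriv_atTop (hf : IsAdmissibleNonlinearity N f) :
    Tendsto (deriv f) atTop atTop := by
  obtain ⟨M, c, hM, hc, h⟩ := hf.exists_log_convex_bounds
  refine tendsto_atTop_mono' _ ?_ (hf.tendsto_atTop.const_mul_atTop hc)
  filter_upwards [eventually_gt_atTop M] with u hu using (h u hu).1

lemma integrableOn_one_div (hf : IsAdmissibleNonlinearity N f) {a : ℝ} (ha : 0 < a) :
    IntegrableOn (fun s => 1 / f s) (Ioi a) volume := by
  obtain ⟨M, c, hM, hc, h⟩ := hf.exists_log_convex_bounds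
  have hcont : ContinuousOn (fun s => 1 / f s) (Ioi 0) :=
    continuousOn_const.div (hf.continuousOn.mono Ioi_subset_Ici_self)
      (fun s hs => (hf.pos hs).ne')
  set b := max a (M + 1) with hb
  have hab : a ≤ b := le_max_left _ _
  have hMb : M < b := lt_of_lt_of_le (lt_add_one M) (le_max_right _ _)
  have htail : IntegrableOn (fun s => 1 / f s) (Ioi b) volume := by
    have hd : ∀ x ∈ Ici b, HasDerivAt (fun u => -(f u)⁻¹) (-(-deriv f x / f x ^ 2)) x :=
      fun x hx => ((hf.hasDerivAt ((hM.trans hMb).trans_le hx)).fun_inv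
        (hf.pos ((hM.trans hMb).trans_le hx)).ne').neg
    have hint : IntegrableOn (fun x => -(-deriv f x / f x ^ 2)) (Ioi b) volume := by
      refine integrableOn_Ioi_deriv_of_nonneg (l := -0)
        (hd b (mem_Ici.2 le_rfl)).continuousAt.continuousWithinAt
        (fun x hx => hd x (mem_Ici.2 (le_of_lt hx))) (fun x hx => ?_) ?_
      · have h0 : 0 < x := (hM.trans hMb).trans hx
        have := hf.deriv_pos x h0
        have := hf.pos h0
        rw [neg_div, neg_neg]
        positivity
      · exact (tendsto_inv_atTop_zero.comp hf.tendsto_atTop).neg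
    refine Integrable.mono' (hint.const_mul c⁻¹) ?_ ?_
    · exact (hcont.mono (fun x hx => (hM.trans hMb).trans hx)).aestronglyMeasurable
        measurableSet_Ioi
    · refine (ae_restrict_iff' measurableSet_Ioi).2 (ae_of_all _ fun x hx => ?_)
      have h0 : 0 < x := (hM.trans hMb).trans hx
      have h1 := hf.pos h0
      have h2 := (h x (hMb.trans hx)).1
      rw [Real.norm_of_nonneg (by positivity), neg_div, neg_neg, inv_mul_eq_div,
        le_div_iff₀ hc, div_mul_eq_mul_div, div_le_div_iff₀ h1 (by positivity)]
      nlinarith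
  have hmid : IntegrableOn (fun s => 1 / f s) (Ioc a b) volume :=
    ((hcont.mono (fun x hx => ha.trans_le hx.1)).integrableOn_Icc).mono_set Ioc_subset_Icc_self
  rw [← Ioc_union_Ioi_eq_Ioi hab]
  exact hmid.union htail

lemma tailIntegral_add (hf : IsAdmissibleNonlinearity N f) {a b : ℝ} (ha : 0 < a) (hb : 0 < b) :
    (∫ s in a..b, 1 / f s) + tailIntegral f b = tailIntegral f a :=
  intervalIntegral.integral_interval_add_Ioi (hf.integrableOn_one_div ha)
    (hf.integrableOn_one_div hb)

lemma hasDerivAt_tailIntegral (hf : IsAdmissibleNonlinearity N f) {u : ℝ} (hu : 0 < u) :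
    HasDerivAt (tailIntegral f) (-(1 / f u)) u := by
  have hcont : ∀ s, 0 < s → ContinuousAt (fun s => 1 / f s) s := fun s hs =>
    continuousAt_const.div (hf.hasDerivAt hs).continuousAt (hf.pos hs).ne'
  have h1 : HasDerivAt (fun v => ∫ s in (1 : ℝ)..v, 1 / f s) (1 / f u) u := by
    refine intervalIntegral.integral_hasDerivAt_right ?_ ?_ (hcont u hu)
    · refine ContinuousOn.intervalIntegrable (fun s hs => (hcont s ?_).continuousWithinAt)
      exact lt_of_lt_of_le (lt_min one_pos hu) hs.1
    · have : ContinuousOn (fun s => 1 / f s) (Ioi 0) :=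
        fun s hs => (hcont s hs).continuousWithinAt
      exact this.stronglyMeasurableAtFilter isOpen_Ioi u hu
  have h2 : HasDerivAt (fun v => tailIntegral f 1 - ∫ s in (1 : ℝ)..v, 1 / f s) (-(1 / f u)) u := by
    simpa using h1.const_sub (tailIntegral f 1)
  refine h2.congr_of_eventuallyEq ?_
  filter_upwards [Ioi_mem_nhds hu] with v hv
  rw [← hf.tailIntegral_add one_pos hv]
  ring

lemma strictAntiOn_tailIntegral (hf : IsAdmissibleNonlinearity N f) :
    StrictAntiOn (tailIntegral f) (Ioi 0) := by
  apply strictAntiOn_of_deriv_neg (convex_Ioi 0)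
    (fun x hx => (hf.hasDerivAt_tailIntegral hx).continuousAt.continuousWithinAt)
  intro x hx
  rw [interior_Ioi] at hx
  rw [(hf.hasDerivAt_tailIntegral hx).deriv]
  have := hf.pos hx
  simpa using this

lemma tendsto_tailIntegral_atTop (hf : IsAdmissibleNonlinearity N f) :
    Tendsto (tailIntegral f) atTop (𝓝 0) := by
  have h := intervalIntegral_tendsto_integral_Ioi 1 (hf.integrableOn_one_div one_pos) tendsto_id
  have h2 : Tendsto (fun v => tailIntegral f 1 - ∫ s in (1 : ℝ)..v, 1 / f s) atTop
      (𝓝 (tailIntegral f 1 - tailIntegral f 1)) := h.const_sub _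
  rw [sub_self] at h2
  refine h2.congr' ?_
  filter_upwards [eventually_gt_atTop 0] with v hv
  rw [← hf.tailIntegral_add one_pos hv]
  ring

lemma tailIntegral_pos (hf : IsAdmissibleNonlinearity N f) {u : ℝ} (hu : 0 < u) :
    0 < tailIntegral f u := by
  have h1 : tailIntegral f (u + 1) < tailIntegral f u :=
    hf.strictAntiOn_tailIntegral hu (mem_Ioi.2 (by linarith)) (by linarith)
  have h2 : 0 ≤ tailIntegral f (u + 1) :=
    nonneg_of_antitoneOn_Ioi hf.strictAntiOn_tailIntegral.antitoneOn
      hf.tendsto_tailIntegral_atTop (by linarith)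
  linarith

/-- Near `0` one has `f s ≤ s` because `f(0) = f'(0) = 0`, so `F` dominates a logarithm. -/
lemma tendsto_tailIntegral_zero (hf : IsAdmissibleNonlinearity N f) :
    Tendsto (tailIntegral f) (𝓝[>] 0) atTop := by
  have hd : HasDerivWithinAt f 0 (Ici 0) 0 := by
    have := (hf.contDiffOn_one.differentiableOn (by norm_num) 0
      (mem_Ici.2 le_rfl)).hasDerivWithinAt
    rwa [hf.deriv_zero] at this
  have h1 : ∀ᶠ s in 𝓝[>] (0 : ℝ), f s ≤ s := by
    have h2 := hd.isLittleO.def (c := 1) one_pos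
    have h3 := nhdsWithin_mono (0 : ℝ) Ioi_subset_Ici_self h2
    filter_upwards [h3, self_mem_nhdsWithin] with s hs hs0
    have hs0 : 0 < s := hs0
    simp [hf.map_zero, abs_of_pos hs0] at hs
    exact (le_abs_self _).trans hs
  obtain ⟨r, hr, hrs⟩ := mem_nhdsGT_iff_exists_Ioc_subset.1 h1
  have hr : 0 < r := hr
  have hanti : AntitoneOn (fun u => tailIntegral f u + Real.log u) (Ioc 0 r) := by
    refine antitoneOn_of_forall_hasDerivAt (convex_Ioc 0 r)
      (H' := fun u => -(1 / f u) + u⁻¹) (fun s hs => ?_) (fun s hs => ?_)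
    · exact (hf.hasDerivAt_tailIntegral hs.1).add (Real.hasDerivAt_log hs.1.ne')
    · have h4 := hf.pos hs.1
      have h5 : s⁻¹ ≤ (f s)⁻¹ := inv_anti₀ h4 (hrs hs)
      rw [one_div]; linarith
  have h6 : Tendsto (fun u => (tailIntegral f r + Real.log r) - Real.log u) (𝓝[>] 0) atTop := by
    have := Real.tendsto_log_nhdsGT_zero
    have h7 := tendsto_neg_atBot_atTop.comp this
    exact tendsto_atTop_add_const_left _ _ h7
  refine tendsto_atTop_mono' _ ?_ h6
  filter_upwards [Ioc_mem_nhdsGT hr] with u hu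
  have := hanti hu ⟨hr, le_rfl⟩ hu.2
  simp only at this
  linarith

lemma continuousOn_tailIntegral (hf : IsAdmissibleNonlinearity N f) :
    ContinuousOn (tailIntegral f) (Ioi 0) :=
  fun _ hx => (hf.hasDerivAt_tailIntegral hx).continuousAt.continuousWithinAt

lemma bijOn_tailIntegral (hf : IsAdmissibleNonlinearity N f) :
    BijOn (tailIntegral f) (Ioi 0) (Ioi 0) := by
  refine ⟨fun u hu => hf.tailIntegral_pos hu, hf.strictAntiOn_tailIntegral.injOn, fun t ht => ?_⟩
  have ht : 0 < t := ht
  obtain ⟨a, ha0, ha⟩ := ((hf.tendsto_tailIntegral_zero.eventually_ge_atTop t).and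
    self_mem_nhdsWithin).exists
  obtain ⟨b, hb0, hb⟩ := ((hf.tendsto_tailIntegral_atTop.eventually_le_const ht).and
    (eventually_gt_atTop a)).exists
  have hb : a < b := hb
  have ha : 0 < a := ha
  obtain ⟨c, hc, hct⟩ := intermediate_value_Icc' hb.le
    (hf.continuousOn_tailIntegral.mono (fun x hx => ha.trans_le hx.1)) ⟨hb0, ha0⟩
  exact ⟨c, ha.trans_le hc.1, hct⟩

end IsAdmissibleNonlinearity

/-- The defect `1 - f'(u) F(u)`. It measures how far `f` is from an exponential, for which it
vanishes. -/
noncomputable def expDefect (f : ℝ → ℝ) (u : ℝ) : ℝ := 1 - deriv f u * tailIntegral f u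

namespace IsAdmissibleNonlinearity

variable {N : ℕ} {f : ℝ → ℝ}

lemma hasDerivAt_inv_deriv (hf : IsAdmissibleNonlinearity N f) {u : ℝ} (hu : 0 < u) :
    HasDerivAt (fun u => (deriv f u)⁻¹) (-deriv (deriv f) u / deriv f u ^ 2) u :=
  (hf.hasDerivAt_deriv hu).fun_inv (hf.deriv_pos u hu).ne'

lemma tendsto_inv_deriv (hf : IsAdmissibleNonlinearity N f) :
    Tendsto (fun u => (deriv f u)⁻¹) atTop (𝓝 0) :=
  tendsto_inv_atTop_zero.comp hf.tendsto_deriv_atTop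

/-- Log-convexity makes `1/f' - F` nonincreasing near infinity, where it tends to `0`. -/
lemma exists_expDefect_nonneg (hf : IsAdmissibleNonlinearity N f) :
    ∃ M : ℝ, 0 < M ∧ ∀ u, M < u → 0 ≤ expDefect f u := by
  obtain ⟨M, c, hM, hc, h⟩ := hf.exists_log_convex_bounds
  refine ⟨M, hM, fun u hu => ?_⟩
  have hanti : AntitoneOn (fun u => (deriv f u)⁻¹ - tailIntegral f u) (Ioi M) := by
    refine antitoneOn_of_forall_hasDerivAt (convex_Ioi M)
      (fun s hs => (hf.hasDerivAt_inv_deriv (hM.trans hs)).sub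
        (hf.hasDerivAt_tailIntegral (hM.trans hs))) (fun s hs => ?_)
    have hs0 : 0 < s := hM.trans hs
    have h1 := hf.pos hs0
    have h2 := hf.deriv_pos s hs0
    have h3 := (h s hs).2
    rw [neg_div, sub_neg_eq_add, neg_add_nonpos_iff, div_le_div_iff₀ h1 (by positivity)]
    linarith
  have h0 := nonneg_of_antitoneOn_Ioi hanti
    (by simpa using hf.tendsto_inv_deriv.sub hf.tendsto_tailIntegral_atTop) hu
  have h2 := hf.deriv_pos u (hM.trans hu)
  have h3 : tailIntegral f u ≤ (deriv f u)⁻¹ := by linarith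
  have h4 := mul_le_mul_of_nonneg_left h3 h2.le
  rw [mul_inv_cancel₀ h2.ne'] at h4
  unfold expDefect
  linarith

lemma tendsto_expDefect (hf : IsAdmissibleNonlinearity N f) :
    Tendsto (expDefect f) atTop (𝓝 0) := by
  rw [Metric.tendsto_nhds]
  intro ε hε
  obtain ⟨M₀, hM₀, hnn⟩ := hf.exists_expDefect_nonneg
  have hlim := hf.tendsto_mul_deriv_deriv.eventually_le_const
    (show (1 : ℝ) < 1 + ε by linarith)
  obtain ⟨M₁, hM₁⟩ := eventually_atTop.1 hlim
  set M := max M₀ M₁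
  have hM : 0 < M := hM₀.trans_le (le_max_left _ _)
  have hanti : AntitoneOn (fun u => (1 + ε) * tailIntegral f u - (deriv f u)⁻¹) (Ioi M) := by
    refine antitoneOn_of_forall_hasDerivAt (convex_Ioi M)
      (fun s hs => ((hf.hasDerivAt_tailIntegral (hM.trans hs)).const_mul (1 + ε)).sub
        (hf.hasDerivAt_inv_deriv (hM.trans hs))) (fun s hs => ?_)
    have hs0 : 0 < s := hM.trans hs
    have h1 := hf.pos hs0
    have h2 := hf.deriv_pos s hs0
    have h3 := hM₁ s ((le_max_right _ _).trans (le_of_lt hs))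
    rw [div_le_iff₀ (by positivity)] at h3
    have h4 : deriv (deriv f) s / deriv f s ^ 2 ≤ (1 + ε) / f s := by
      rw [div_le_div_iff₀ (by positivity) h1]; linarith
    rw [neg_div, sub_neg_eq_add]
    have h5 : (1 + ε) * -(1 / f s) = -((1 + ε) / f s) := by ring
    rw [h5]; linarith
  filter_upwards [eventually_gt_atTop M] with u hu
  have h0 := nonneg_of_antitoneOn_Ioi hanti
    (by simpa using (hf.tendsto_tailIntegral_atTop.const_mul (1 + ε)).sub hf.tendsto_inv_deriv) hu
  have h1 := hnn u ((le_max_left _ _).trans_lt hu)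
  have h2 := hf.deriv_pos u (hM.trans hu)
  rw [Real.dist_eq, sub_zero, abs_of_nonneg h1]
  have h3 : (deriv f u)⁻¹ ≤ (1 + ε) * tailIntegral f u := by linarith
  have h4 := mul_le_mul_of_nonneg_left h3 h2.le
  rw [mul_inv_cancel₀ h2.ne'] at h4
  unfold expDefect
  -- `1 ≤ (1 + ε) f' F` with `f' F > 0` gives `1 - f' F < ε`
  by_contra hcon
  push Not at hcon
  nlinarith

lemma hasDerivAt_expDefect (hf : IsAdmissibleNonlinearity N f) {u : ℝ} (hu : 0 < u) :
    HasDerivAt (expDefect f)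
      (-(deriv (deriv f) u * tailIntegral f u + deriv f u * -(1 / f u))) u :=
  ((hf.hasDerivAt_deriv hu).mul (hf.hasDerivAt_tailIntegral hu)).const_sub 1

lemma hasDerivAt_log_tailIntegral (hf : IsAdmissibleNonlinearity N f) {u : ℝ} (hu : 0 < u) :
    HasDerivAt (fun u => Real.log (tailIntegral f u))
      (-(1 / f u) / tailIntegral f u) u :=
  (hf.hasDerivAt_tailIntegral hu).log (hf.tailIntegral_pos hu).ne'

/-- As a function of `log F`, the defect has a derivative tending to `0` at infinity. -/
lemma exists_expDefect_lipschitz (hf : IsAdmissibleNonlinearity N f) {ε : ℝ} (hε : 0 < ε) :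
    ∃ M : ℝ, 0 < M ∧ ∀ u v, M < u → M < v → |expDefect f u - expDefect f v| ≤
      ε * |Real.log (tailIntegral f u) - Real.log (tailIntegral f v)| := by
  have hlim : Tendsto (fun u => f u * deriv (deriv f) u / deriv f u ^ 2 *
      (1 - expDefect f u) ^ 2 - (1 - expDefect f u)) atTop (𝓝 (1 * (1 - 0) ^ 2 - (1 - 0))) :=
    (hf.tendsto_mul_deriv_deriv.mul ((hf.tendsto_expDefect.const_sub 1).pow 2)).sub
      (hf.tendsto_expDefect.const_sub 1)
  norm_num at hlim
  have hev := (Metric.tendsto_nhds.1 hlim) ε hε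
  obtain ⟨M₁, hM₁⟩ := eventually_atTop.1 hev
  set M := max M₁ 1
  have hM : 0 < M := one_pos.trans_le (le_max_right _ _)
  have hder : ∀ s, M < s → |deriv (deriv f) s * tailIntegral f s + deriv f s * -(1 / f s)|
      ≤ ε * ((1 / f s) / tailIntegral f s) := by
    intro s hs
    have hs0 : 0 < s := hM.trans hs
    have h1 := hf.pos hs0
    have h2 := hf.deriv_pos s hs0
    have h3 := hf.tailIntegral_pos hs0
    have h4 := hM₁ s ((le_max_left _ _).trans hs.le)
    rw [Real.dist_eq, sub_zero] at h4
    have h5 : f s * deriv (deriv f) s / deriv f s ^ 2 *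
      (1 - expDefect f s) ^ 2 - (1 - expDefect f s) = (f s * tailIntegral f s) *
        (deriv (deriv f) s * tailIntegral f s + deriv f s * -(1 / f s)) := by
      unfold expDefect
      field_simp
      ring
    rw [h5, abs_mul, abs_of_pos (by positivity)] at h4
    rw [div_div, mul_one_div, le_div_iff₀ (by positivity)]
    linarith
  have key : ∀ u v, M < u → M < v → u ≤ v → |expDefect f u - expDefect f v| ≤
      ε * |Real.log (tailIntegral f u) - Real.log (tailIntegral f v)| := by
    intro u v hu hv huv
    have hanti : AntitoneOn (fun u => expDefect f u + ε * Real.log (tailIntegral f u)) (Ioi M) :=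
      antitoneOn_of_forall_hasDerivAt (convex_Ioi M)
        (fun s hs => (hf.hasDerivAt_expDefect (hM.trans hs)).add
          ((hf.hasDerivAt_log_tailIntegral (hM.trans hs)).const_mul ε)) (fun s hs => by
          have := (abs_le.1 (hder s hs)).1
          rw [neg_div, mul_neg]; linarith)
    have hmono : MonotoneOn (fun u => expDefect f u - ε * Real.log (tailIntegral f u)) (Ioi M) :=
      monotoneOn_of_forall_hasDerivAt (convex_Ioi M)
        (fun s hs => (hf.hasDerivAt_expDefect (hM.trans hs)).sub
          ((hf.hasDerivAt_log_tailIntegral (hM.trans hs)).const_mul ε)) (fun s hs => by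
          have := (abs_le.1 (hder s hs)).2
          rw [neg_div, mul_neg]; linarith)
    have h1 := hanti hu hv huv
    have h2 := hmono hu hv huv
    simp only at h1 h2
    have h3 : Real.log (tailIntegral f v) ≤ Real.log (tailIntegral f u) :=
      Real.log_le_log (hf.tailIntegral_pos (hM.trans hv))
        (hf.strictAntiOn_tailIntegral.antitoneOn (hM.trans hu) (hM.trans hv) huv)
    rw [abs_of_nonneg (sub_nonneg.2 h3), abs_le]
    constructor <;> linarith
  refine ⟨M, hM, fun u v hu hv => ?_⟩
  rcases le_total u v with h | h
  · exact key u v hu hv h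
  · rw [abs_sub_comm, abs_sub_comm (Real.log _)]
    exact key v u hv hu h

/-- For large arguments the defect is nonnegative, small, and a contraction as a function of
`log F`. -/
lemma exists_expDefect_bounds (hf : IsAdmissibleNonlinearity N f) {d : ℝ} (hd : 0 < d) :
    ∃ M, 0 < M ∧ (∀ u, M < u → 0 ≤ expDefect f u ∧ expDefect f u ≤ d) ∧
      ∀ u v, M < u → M < v → |expDefect f u - expDefect f v| ≤
        1 / 100 * |Real.log (tailIntegral f u) - Real.log (tailIntegral f v)| := by
  obtain ⟨M₁, hM₁, h₁⟩ := hf.exists_expDefect_nonneg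
  obtain ⟨M₂, h₂⟩ := eventually_atTop.1 (hf.tendsto_expDefect.eventually_le_const hd)
  obtain ⟨M₃, _, h₃⟩ := hf.exists_expDefect_lipschitz (show (0 : ℝ) < 1 / 100 by norm_num)
  refine ⟨max M₁ (max M₂ M₃), lt_max_of_lt_left hM₁, fun u hu => ⟨h₁ u ?_, h₂ u ?_⟩,
    fun u v hu hv => h₃ u v ?_ ?_⟩
  · exact (le_max_left _ _).trans_lt hu
  · exact ((le_max_left _ _).trans (le_max_right _ _)).trans hu.le
  · exact ((le_max_right _ _).trans (le_max_right _ _)).trans_lt hu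
  · exact ((le_max_right _ _).trans (le_max_right _ _)).trans_lt hv

/-- `f F` is nonincreasing, hence bounded, near infinity. -/
lemma exists_mul_tailIntegral_le (hf : IsAdmissibleNonlinearity N f) :
    ∃ M C : ℝ, 0 < M ∧ ∀ u, M < u → f u * tailIntegral f u ≤ C := by
  obtain ⟨M, hM, hnn⟩ := hf.exists_expDefect_nonneg
  have hanti : AntitoneOn (fun u => f u * tailIntegral f u) (Ioi M) := by
    refine antitoneOn_of_forall_hasDerivAt (convex_Ioi M)
      (fun s hs => (hf.hasDerivAt (hM.trans hs)).mul (hf.hasDerivAt_tailIntegral (hM.trans hs)))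
      (fun s hs => ?_)
    have := hnn s hs
    have h1 := (hf.pos (hM.trans hs)).ne'
    unfold expDefect at this
    rw [mul_neg, mul_one_div_cancel h1]
    linarith
  exact ⟨M + 1, f (M + 1) * tailIntegral f (M + 1), by linarith, fun u hu =>
    hanti (mem_Ioi.2 (lt_add_one M)) (mem_Ioi.2 (by linarith)) hu.le⟩

lemma exists_lipschitzOnWith (hf : IsAdmissibleNonlinearity N f) (M : ℝ) :
    ∃ K : NNReal, LipschitzOnWith K f (Icc 0 M) :=
  (hf.contDiffOn_one.mono Icc_subset_Ici_self).exists_lipschitzOnWith one_ne_zero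
    (convex_Icc 0 M) isCompact_Icc

end IsAdmissibleNonlinearity

lemma hasDerivAt_mul_exp {H : ℝ → ℝ} {H' c s : ℝ} (h : HasDerivAt H H' s) :
    HasDerivAt (fun s => H s * Real.exp (c * s)) ((H' + c * H s) * Real.exp (c * s)) s := by
  refine (h.mul ((hasDerivAt_id s).const_mul c).exp).congr_deriv ?_
  simp only [id]
  ring

lemma hasDerivAt_exp_two_mul (s : ℝ) :
    HasDerivAt (fun s => Real.exp (2 * s)) (2 * Real.exp (2 * s)) s := by
  refine ((hasDerivAt_id s).const_mul 2).exp.congr_deriv ?_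
  simp only [id]
  ring

/-- Integrating factor: `H' + c H ≤ 0` makes `H e^{cs}` nonincreasing. -/
lemma antitoneOn_mul_exp {D : Set ℝ} (hD : Convex ℝ D) {H H' : ℝ → ℝ} {c : ℝ}
    (h : ∀ s ∈ D, HasDerivAt H (H' s) s) (h0 : ∀ s ∈ D, H' s + c * H s ≤ 0) :
    AntitoneOn (fun s => H s * Real.exp (c * s)) D :=
  antitoneOn_of_forall_hasDerivAt hD (fun s hs => hasDerivAt_mul_exp (h s hs))
    (fun s hs => mul_nonpos_of_nonpos_of_nonneg (h0 s hs) (Real.exp_pos _).le)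

/-! ### Barrier arguments -/

/-- If `H` decreases wherever it exceeds `ε`, then a value above `ε` at `s₁` bounds all
earlier values from below. -/
lemma le_of_forall_lt_imp_deriv_nonpos {H H' : ℝ → ℝ} {s₁ ε : ℝ}
    (h : ∀ s ≤ s₁, HasDerivAt H (H' s) s) (h0 : ∀ s ≤ s₁, ε < H s → H' s ≤ 0)
    (h1 : ε < H s₁) : ∀ s ≤ s₁, H s₁ ≤ H s := by
  intro s hs
  by_contra! hlt
  obtain ⟨c, hc1, hc2⟩ := exists_between (max_lt h1 hlt)
  have hcont : ContinuousOn H (Icc s s₁) := fun x hx => (h x hx.2).continuousAt.continuousWithinAt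
  -- the last time `τ` before `s₁` at which `H` is at most `c`
  have hcl : IsCompact (Icc s s₁ ∩ H ⁻¹' Iic c) :=
    isCompact_Icc.of_isClosed_subset (hcont.preimage_isClosed_of_isClosed isClosed_Icc isClosed_Iic)
      inter_subset_left
  have hne : (Icc s s₁ ∩ H ⁻¹' Iic c).Nonempty :=
    ⟨s, ⟨le_rfl, hs⟩, ((le_max_right _ _).trans hc1.le : H s ≤ c)⟩
  obtain ⟨τ, hτ, hmax⟩ := hcl.exists_isGreatest hne
  have hτc : H τ ≤ c := hτ.2
  have hanti : AntitoneOn H (Icc τ s₁) := by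
    refine antitoneOn_of_hasDerivWithinAt_nonpos (convex_Icc τ s₁)
      (hcont.mono (Icc_subset_Icc_left hτ.1.1)) (f' := H') (fun x hx => ?_) (fun x hx => ?_)
    · rw [interior_Icc] at hx
      exact (h x hx.2.le).hasDerivWithinAt
    · rw [interior_Icc] at hx
      refine h0 x hx.2.le ?_
      have : c < H x := by
        by_contra! hxc
        exact absurd (hmax ⟨⟨hτ.1.1.trans hx.1.le, hx.2.le⟩, hxc⟩) (not_le.2 hx.1)
      exact ((le_max_left _ _).trans_lt hc1).trans this
  have := hanti (left_mem_Icc.2 hτ.1.2) (right_mem_Icc.2 hτ.1.2) hτ.1.2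
  linarith

/-- Continuous induction: a bound that improves itself persists. -/
lemma lt_of_forall_le_imp_lt {G : ℝ → ℝ} {α β r : ℝ} (hG : ContinuousOn G (Icc α β))
    (h0 : G α < r) (h : ∀ s ∈ Icc α β, (∀ t ∈ Icc α s, G t ≤ r) → G s < r) :
    ∀ s ∈ Icc α β, G s < r := by
  intro s hs
  by_contra! hr
  have hcl : IsCompact (Icc α β ∩ G ⁻¹' Ici r) :=
    isCompact_Icc.of_isClosed_subset (hG.preimage_isClosed_of_isClosed isClosed_Icc isClosed_Ici)
      inter_subset_left
  obtain ⟨τ, hτ, hmin⟩ := hcl.exists_isLeast ⟨s, hs, hr⟩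
  have hτr : r ≤ G τ := hτ.2
  have hlt : ∀ t ∈ Ico α τ, G t < r := by
    intro t ht
    by_contra! htr
    exact absurd (hmin ⟨⟨ht.1, ht.2.le.trans hτ.1.2⟩, htr⟩) (not_le.2 ht.2)
  obtain ⟨t, ht, htr⟩ := intermediate_value_Icc hτ.1.1
    (hG.mono (Icc_subset_Icc_right hτ.1.2)) ⟨h0.le, hτr⟩
  have htτ : t = τ := by
    by_contra hne
    exact absurd (hlt t ⟨ht.1, lt_of_le_of_ne ht.2 hne⟩) (by simp [htr])
  subst htτ
  refine absurd (h t hτ.1 fun t' ht' => ?_) (not_lt.2 hτr)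
  rcases ht'.2.eq_or_lt with rfl | hlt'
  · exact htr.le
  · exact (hlt t' ⟨ht'.1, hlt'⟩).le

/-! ### The perturbed Emden system -/

/-- The planar system `l' = -p`, `p' = 2n(e^l - 1) - n p - D (p + 2)²` on the set `I`.
For `D = 0` it is the Emden system of the exponential nonlinearity, with equilibrium `(0, 0)`. -/
structure IsEmdenSystem (n : ℝ) (l p D : ℝ → ℝ) (I : Set ℝ) : Prop where
  hasDerivAt_fst : ∀ s ∈ I, HasDerivAt l (-p s) s
  hasDerivAt_snd : ∀ s ∈ I, HasDerivAt p
    (2 * n * (Real.exp (l s) - 1) - n * p s - D s * (p s + 2) ^ 2) s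

/-- The Lyapunov function of the Emden system: the energy, corrected by a small cross term that
makes its derivative negative definite. -/
noncomputable def emdenLyapunov (n l p : ℝ) : ℝ :=
  p ^ 2 / 2 + 2 * n * (Real.exp l - 1 - l) - (Real.exp l - 1) * p / 6

/-- The squared distance to the equilibrium. -/
noncomputable def emdenDist (l p : ℝ) : ℝ := p ^ 2 + (Real.exp l - 1) ^ 2

lemma sq_le_eight_mul_exp_sub {l : ℝ} (h : Real.exp l ≤ 3) :
    (Real.exp l - 1) ^ 2 ≤ 8 * (Real.exp l - 1 - l) := by
  have h1 := Real.add_one_le_exp (l / 2)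
  have h2 : Real.exp l = Real.exp (l / 2) ^ 2 := by
    rw [← Real.exp_nat_mul]; congr 1; push_cast; ring
  have h3 := Real.exp_pos (l / 2)
  set x := Real.exp (l / 2)
  rw [h2] at h ⊢
  -- `l ≤ 2 (x - 1)` with `x = e^{l/2}`, so the right side is at least `8 (x - 1)²`
  have h4 : x ≤ 9 / 5 := by nlinarith
  have h5 : (x + 1) ^ 2 ≤ 8 := by nlinarith
  have h6 : (x ^ 2 - 1) ^ 2 = (x - 1) ^ 2 * (x + 1) ^ 2 := by ring
  have h7 : (x - 1) ^ 2 * (x + 1) ^ 2 ≤ (x - 1) ^ 2 * 8 :=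
    mul_le_mul_of_nonneg_left h5 (sq_nonneg _)
  nlinarith

lemma exp_sub_le_two_mul_sq {l : ℝ} (h : 1 / 2 ≤ Real.exp l) :
    Real.exp l - 1 - l ≤ 2 * (Real.exp l - 1) ^ 2 := by
  have h1 := Real.add_one_le_exp (-l)
  have h2 : Real.exp l * Real.exp (-l) = 1 := by rw [← Real.exp_add]; simp
  set x := Real.exp l
  set w := Real.exp (-l)
  have hw : w ≤ 2 := by nlinarith
  have h3 : x - 1 - l ≤ x + w - 2 := by linarith
  have h4 : x + w - 2 = (x - 1) ^ 2 * w := by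
    have : (x - 1) ^ 2 * w = x * (x * w) - 2 * (x * w) + w := by ring
    rw [this, h2]; ring
  rw [h4] at h3
  nlinarith [sq_nonneg (x - 1)]

lemma emdenDist_le_lyapunov {n l p : ℝ} (hn : 1 ≤ n) (h : Real.exp l ≤ 3) :
    emdenDist l p ≤ 6 * emdenLyapunov n l p := by
  have h1 := sq_le_eight_mul_exp_sub h
  have h2 : 0 ≤ Real.exp l - 1 - l := by linarith [Real.add_one_le_exp l]
  have h3 : Real.exp l - 1 - l ≤ n * (Real.exp l - 1 - l) := le_mul_of_one_le_left h2 hn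
  unfold emdenDist emdenLyapunov
  nlinarith [sq_nonneg (p - (Real.exp l - 1))]

lemma emdenLyapunov_le_dist {n l p : ℝ} (hn : 1 ≤ n) (h : 1 / 2 ≤ Real.exp l) :
    emdenLyapunov n l p ≤ (4 * n + 1) * emdenDist l p := by
  have h1 := exp_sub_le_two_mul_sq h
  have h3 := mul_le_mul_of_nonneg_left h1 (show 0 ≤ n by linarith)
  unfold emdenDist emdenLyapunov
  nlinarith [sq_nonneg (p + (Real.exp l - 1)), mul_nonneg (show 0 ≤ n by linarith) (sq_nonneg p),
    sq_nonneg p]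

lemma abs_le_of_abs_exp_sub_one_le {l : ℝ} (h : |Real.exp l - 1| ≤ 1 / 100) : |l| ≤ 1 / 2 := by
  obtain ⟨h1, h2⟩ := abs_le.1 h
  have h3 := Real.add_one_le_exp l
  have h4 := Real.add_one_le_exp (-l)
  have h5 : Real.exp l * Real.exp (-l) = 1 := by rw [← Real.exp_add]; simp
  have h6 : Real.exp (-l) ≤ 3 / 2 := by nlinarith [Real.exp_pos (-l)]
  rw [abs_le]
  constructor <;> linarith

lemma abs_le_of_emdenDist_le {l p r : ℝ} (hr : 0 ≤ r) (h : emdenDist l p ≤ r ^ 2) :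
    |Real.exp l - 1| ≤ r ∧ |p| ≤ r := by
  unfold emdenDist at h
  exact ⟨abs_le_of_sq_le_sq (by nlinarith [sq_nonneg p]) hr,
    abs_le_of_sq_le_sq (by nlinarith [sq_nonneg (Real.exp l - 1)]) hr⟩

namespace IsEmdenSystem

variable {n : ℝ} {l p D : ℝ → ℝ} {I : Set ℝ}

lemma mono {J : Set ℝ} (h : IsEmdenSystem n l p D I) (hJ : J ⊆ I) : IsEmdenSystem n l p D J :=
  ⟨fun s hs => h.hasDerivAt_fst s (hJ hs), fun s hs => h.hasDerivAt_snd s (hJ hs)⟩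

lemma hasDerivAt_lyapunov (h : IsEmdenSystem n l p D I) {s : ℝ} (hs : s ∈ I) :
    HasDerivAt (fun s => emdenLyapunov n (l s) (p s))
      (-n * p s ^ 2 - D s * (p s + 2) ^ 2 * p s + Real.exp (l s) * p s ^ 2 / 6
        - n * (Real.exp (l s) - 1) ^ 2 / 3 + n * (Real.exp (l s) - 1) * p s / 6
        + D s * (Real.exp (l s) - 1) * (p s + 2) ^ 2 / 6) s := by
  have hl := h.hasDerivAt_fst s hs
  have hp := h.hasDerivAt_snd s hs
  have he := hl.exp
  have := ((hp.fun_pow 2).div_const 2).add (((he.sub_const 1).sub hl).const_mul (2 * n))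
    |>.sub (((he.sub_const 1).mul hp).div_const 6)
  refine this.congr_deriv ?_
  simp
  ring

lemma lyapunov_deriv_le {n l p D : ℝ} (hn : 1 ≤ n) (hl : Real.exp l ≤ 3) (hp : |p| ≤ 4)
    (hD : 0 ≤ D) :
    -n * p ^ 2 - D * (p + 2) ^ 2 * p + Real.exp l * p ^ 2 / 6
        - n * (Real.exp l - 1) ^ 2 / 3 + n * (Real.exp l - 1) * p / 6
        + D * (Real.exp l - 1) * (p + 2) ^ 2 / 6 ≤ -(n / 4) * emdenDist l p + 156 * D := by
  have hx := Real.exp_pos l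
  unfold emdenDist
  set x := Real.exp l
  obtain ⟨hp1, hp2⟩ := abs_le.1 hp
  have h1 : (p + 2) ^ 2 ≤ 36 := by nlinarith
  have h2 : -p + (x - 1) / 6 ≤ 13 / 3 := by linarith
  have h3 : (p + 2) ^ 2 * (-p + (x - 1) / 6) ≤ 156 := by
    calc (p + 2) ^ 2 * (-p + (x - 1) / 6) ≤ (p + 2) ^ 2 * (13 / 3) :=
          mul_le_mul_of_nonneg_left h2 (sq_nonneg _)
      _ ≤ 156 := by linarith
  have h4 := mul_le_mul_of_nonneg_left h3 hD
  have h5 : x * p ^ 2 ≤ 3 * p ^ 2 := mul_le_mul_of_nonneg_right hl (sq_nonneg _)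
  have h6 : p ^ 2 ≤ n * p ^ 2 := le_mul_of_one_le_left (sq_nonneg _) hn
  have h7 : 0 ≤ n * (p - (x - 1)) ^ 2 := mul_nonneg (by linarith) (sq_nonneg _)
  nlinarith

/-- A trajectory of the Emden system that stays in a bounded region as `s → -∞` and does not
escape to `l = -∞` converges backwards to the equilibrium, provided the perturbation vanishes
at `-∞`: otherwise the Lyapunov function would grow linearly backwards in time. -/
lemma eventually_dist_lt {S : ℝ} (h : IsEmdenSystem n l p D (Iic S)) (hn : 1 ≤ n)
    (hl : ∀ s ≤ S, Real.exp (l s) ≤ 3) (hp : ∀ s ≤ S, |p s| ≤ 4) (hD : ∀ s ≤ S, 0 ≤ D s)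
    (hD0 : Tendsto D atBot (𝓝 0)) (hfr : ∃ᶠ s in atBot, 1 / 2 ≤ Real.exp (l s))
    {ε : ℝ} (hε : 0 < ε) : ∀ᶠ s in atBot, emdenDist (l s) (p s) < ε := by
  wlog hε1 : ε ≤ 1 generalizing ε
  · filter_upwards [this one_pos le_rfl] with s hs using hs.trans (not_le.1 hε1)
  set η := ε / 12 with hη
  have hη0 : 0 < η := by positivity
  have hDev := hD0.eventually_lt_const (show (0 : ℝ) < η / 6240 by positivity)
  obtain ⟨S₁, hS₁⟩ := eventually_atBot.1 hDev
  set S₂ := min S S₁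
  have key : ∀ s ≤ S₂, η < emdenLyapunov n (l s) (p s) →
      -n * p s ^ 2 - D s * (p s + 2) ^ 2 * p s + Real.exp (l s) * p s ^ 2 / 6
        - n * (Real.exp (l s) - 1) ^ 2 / 3 + n * (Real.exp (l s) - 1) * p s / 6
        + D s * (Real.exp (l s) - 1) * (p s + 2) ^ 2 / 6 ≤ -(η / 40) := by
    intro s hs hL
    have hsS := hs.trans (min_le_left _ _)
    have h1 := lyapunov_deriv_le hn (hl s hsS) (hp s hsS) (hD s hsS)
    have h2 := hS₁ s (hs.trans (min_le_right _ _))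
    have h3 : η ≤ (4 * n + 1) * emdenDist (l s) (p s) := by
      rcases le_or_gt (1 / 2) (Real.exp (l s)) with h4 | h4
      · exact hL.le.trans (emdenLyapunov_le_dist hn h4)
      · have : 1 / 4 ≤ emdenDist (l s) (p s) := by
          unfold emdenDist
          nlinarith [sq_nonneg (p s)]
        nlinarith
    have h5 : η ≤ 5 * n * emdenDist (l s) (p s) := by
      have : 0 ≤ emdenDist (l s) (p s) := by unfold emdenDist; positivity
      nlinarith
    linarith
  have hLle : ∀ s ≤ S₂, emdenLyapunov n (l s) (p s) ≤ η := by
    intro s₁ hs₁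
    by_contra! hgt
    have hder : ∀ s ≤ s₁, HasDerivAt (fun s => emdenLyapunov n (l s) (p s)) _ s :=
      fun s hs => h.hasDerivAt_lyapunov
        (mem_Iic.2 ((hs.trans hs₁).trans (min_le_left _ _)))
    have hge := le_of_forall_lt_imp_deriv_nonpos hder
      (fun s hs hs' => (key s (hs.trans hs₁) hs').trans (by linarith)) hgt
    have hanti : AntitoneOn (fun s => emdenLyapunov n (l s) (p s) + η / 40 * s) (Iic s₁) :=
      antitoneOn_of_forall_hasDerivAt (convex_Iic s₁)
        (fun s hs => (hder s hs).add ((hasDerivAt_id s).const_mul (η / 40)))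
        (fun s hs => by
          have := key s (le_trans hs hs₁) (hgt.trans_le (hge s hs))
          linarith)
    -- far in the past the linear growth exceeds the bound valid where `e^l ≥ 1/2`
    have hfar : ∀ᶠ s in atBot, s ≤ s₁ ∧ (4 * n + 1) * 20 - η / 40 * s₁ < -(η / 40 * s) := by
      refine (eventually_le_atBot s₁).and ?_
      have : Tendsto (fun s : ℝ => -(η / 40 * s)) atBot atTop :=
        tendsto_neg_atBot_atTop.comp (tendsto_id.const_mul_atBot (by positivity))
      exact this.eventually_gt_atTop _
    obtain ⟨s, hs2, hs, hbig⟩ := (hfr.and_eventually hfar).exists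
    have h1 := hanti (mem_Iic.2 hs) (mem_Iic.2 le_rfl) hs
    simp only at h1
    have hsS := (hs.trans hs₁).trans (min_le_left _ _)
    have h2 := emdenLyapunov_le_dist (p := p s) hn hs2
    have h3 : emdenDist (l s) (p s) ≤ 20 := by
      unfold emdenDist
      have h4 := hl s hsS
      obtain ⟨h5, h6⟩ := abs_le.1 (hp s hsS)
      nlinarith
    have h4 := mul_le_mul_of_nonneg_left h3 (show 0 ≤ 4 * n + 1 by linarith)
    linarith
  filter_upwards [eventually_le_atBot S₂] with s hs
  have h1 := emdenDist_le_lyapunov (p := p s) hn (hl s (hs.trans (min_le_left _ _)))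
  have h2 := hLle s hs
  linarith

/-- A trajectory started at the equilibrium stays close to it, as long as the perturbation
is small. -/
lemma dist_le_of_start {α β d : ℝ} (h : IsEmdenSystem n l p D (Icc α β)) (hn : 1 ≤ n)
    (hl : l α = 0) (hp : p α = 0) (hD : ∀ s ∈ Icc α β, 0 ≤ D s) (hDd : ∀ s ∈ Icc α β, D s ≤ d)
    (hd : 18720 * d < 1 / 4) :
    ∀ s ∈ Icc α β, emdenDist (l s) (p s) ≤ 18720 * d := by
  have hcont : ContinuousOn (fun s => emdenDist (l s) (p s)) (Icc α β) := by
    intro s hs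
    have h1 := (h.hasDerivAt_fst s hs).continuousAt
    have h2 := (h.hasDerivAt_snd s hs).continuousAt
    unfold emdenDist
    exact ((h2.pow 2).add ((h1.rexp.sub continuousAt_const).pow 2)).continuousWithinAt
  have key : ∀ s ∈ Icc α β, (∀ t ∈ Icc α s, emdenDist (l t) (p t) ≤ 1 / 4) →
      emdenDist (l s) (p s) ≤ 18720 * d := by
    intro s hs hle
    have hsub : Icc α s ⊆ Icc α β := Icc_subset_Icc_right hs.2
    have hb : ∀ t ∈ Icc α s, Real.exp (l t) ≤ 3 ∧ 1 / 2 ≤ Real.exp (l t) ∧ |p t| ≤ 4 := by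
      intro t ht
      have h1 := hle t ht
      unfold emdenDist at h1
      refine ⟨by nlinarith [sq_nonneg (p t)], by nlinarith [sq_nonneg (p t)], abs_le.2 ⟨?_, ?_⟩⟩ <;>
        nlinarith [sq_nonneg (Real.exp (l t) - 1)]
    have hanti : AntitoneOn (fun t => (emdenLyapunov n (l t) (p t) - 3120 * d) *
        Real.exp (1 / 20 * t)) (Icc α s) := by
      refine antitoneOn_mul_exp (convex_Icc α s)
        (fun t ht => (h.hasDerivAt_lyapunov (hsub ht)).sub_const (3120 * d)) (fun t ht => ?_)
      obtain ⟨h1, h2, h3⟩ := hb t ht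
      have h4 := lyapunov_deriv_le hn h1 h3 (hD t (hsub ht))
      have h5 := hDd t (hsub ht)
      have h6 := emdenLyapunov_le_dist (p := p t) hn h2
      have h7 : 0 ≤ emdenDist (l t) (p t) := by unfold emdenDist; positivity
      have h8 : emdenLyapunov n (l t) (p t) ≤ 5 * n * emdenDist (l t) (p t) := by nlinarith
      linarith
    have h0 := hanti (left_mem_Icc.2 hs.1) (right_mem_Icc.2 hs.1) hs.1
    have hL0 : emdenLyapunov n (l α) (p α) = 0 := by simp [emdenLyapunov, hl, hp]
    have hd0 : 0 ≤ d := (hD s hs).trans (hDd s hs)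
    simp only [hL0] at h0
    have h1 : (emdenLyapunov n (l s) (p s) - 3120 * d) * Real.exp (1 / 20 * s) ≤ 0 :=
      h0.trans (mul_nonpos_of_nonpos_of_nonneg (by linarith) (Real.exp_pos _).le)
    have h2 : emdenLyapunov n (l s) (p s) ≤ 3120 * d := by
      by_contra! h3
      exact absurd h1 (not_le.2 (mul_pos (by linarith) (Real.exp_pos _)))
    have h3 := emdenDist_le_lyapunov (p := p s) hn (hb s (right_mem_Icc.2 hs.1)).1
    linarith
  intro s hs
  have hlt := lt_of_forall_le_imp_lt hcont (r := 1 / 4) (by simp [emdenDist, hl, hp])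
    (fun t ht hle => (key t ht hle).trans_lt hd)
  exact key s hs fun t ht => (hlt t ⟨ht.1, ht.2.trans hs.2⟩).le

/-- Two trajectories near the equilibrium approach each other exponentially fast. -/
lemma sq_sub_le {l₁ p₁ D₁ l₂ p₂ D₂ : ℝ → ℝ} (hI : Convex ℝ I) (hn : 1 ≤ n)
    (h₁ : IsEmdenSystem n l₁ p₁ D₁ I) (h₂ : IsEmdenSystem n l₂ p₂ D₂ I)
    (hl₁ : ∀ s ∈ I, |Real.exp (l₁ s) - 1| ≤ 1 / 100)
    (hl₂ : ∀ s ∈ I, |Real.exp (l₂ s) - 1| ≤ 1 / 100)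
    (hp₁ : ∀ s ∈ I, |p₁ s| ≤ 1 / 100) (hp₂ : ∀ s ∈ I, |p₂ s| ≤ 1 / 100)
    (hD₁ : ∀ s ∈ I, |D₁ s| ≤ 1 / 100)
    (hD : ∀ s ∈ I, |D₁ s - D₂ s| ≤ 1 / 100 * |l₁ s - l₂ s|)
    {α s : ℝ} (hα : α ∈ I) (hs : s ∈ I) (hαs : α ≤ s) :
    (l₁ s - l₂ s) ^ 2 + (p₁ s - p₂ s) ^ 2 ≤
      6 * n * Real.exp (-((s - α) / 6)) * ((l₁ α - l₂ α) ^ 2 + (p₁ α - p₂ α) ^ 2) := by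
  set Q : ℝ → ℝ := fun s => (p₁ s - p₂ s) ^ 2 + 2 * n * (l₁ s - l₂ s) ^ 2 -
    (l₁ s - l₂ s) * (p₁ s - p₂ s) / 2 with hQ
  have hQder : ∀ s ∈ I, HasDerivAt Q
      (2 * (p₁ s - p₂ s) * ((2 * n * (Real.exp (l₁ s) - 1) - n * p₁ s - D₁ s * (p₁ s + 2) ^ 2)
          - (2 * n * (Real.exp (l₂ s) - 1) - n * p₂ s - D₂ s * (p₂ s + 2) ^ 2))
        - 4 * n * (l₁ s - l₂ s) * (p₁ s - p₂ s) + (p₁ s - p₂ s) ^ 2 / 2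
        - (l₁ s - l₂ s) / 2 *
          ((2 * n * (Real.exp (l₁ s) - 1) - n * p₁ s - D₁ s * (p₁ s + 2) ^ 2)
          - (2 * n * (Real.exp (l₂ s) - 1) - n * p₂ s - D₂ s * (p₂ s + 2) ^ 2))) s := by
    intro s hs
    have hz := (h₁.hasDerivAt_fst s hs).sub (h₂.hasDerivAt_fst s hs)
    have hq := (h₁.hasDerivAt_snd s hs).sub (h₂.hasDerivAt_snd s hs)
    refine (((hq.fun_pow 2).add ((hz.fun_pow 2).const_mul (2 * n))).sub
      ((hz.mul hq).div_const 2)).congr_deriv ?_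
    simp
    ring
  have hQle : ∀ s ∈ I, Q s ≤ 3 * n * ((l₁ s - l₂ s) ^ 2 + (p₁ s - p₂ s) ^ 2) := by
    intro s _
    simp only [hQ]
    nlinarith [sq_nonneg ((l₁ s - l₂ s) + (p₁ s - p₂ s)), sq_nonneg (l₁ s - l₂ s),
      sq_nonneg (p₁ s - p₂ s)]
  have hQge : ∀ s ∈ I, (l₁ s - l₂ s) ^ 2 + (p₁ s - p₂ s) ^ 2 ≤ 2 * Q s := by
    intro s _
    simp only [hQ]
    nlinarith [sq_nonneg ((l₁ s - l₂ s) - (p₁ s - p₂ s)), sq_nonneg (l₁ s - l₂ s),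
      sq_nonneg (p₁ s - p₂ s)]
  have hanti : AntitoneOn (fun s => Q s * Real.exp (1 / 6 * s)) I := by
    refine antitoneOn_mul_exp hI hQder (fun s hs => ?_)
    have hq := hQle s hs
    -- linearization of the exponential
    have hE : |Real.exp (l₁ s) - Real.exp (l₂ s) - (l₁ s - l₂ s)| ≤ 1 / 100 * |l₁ s - l₂ s| := by
      have e1 := Real.add_one_le_exp (l₁ s - l₂ s)
      have e2 := Real.add_one_le_exp (l₂ s - l₁ s)
      have e3 : Real.exp (l₁ s) = Real.exp (l₂ s) * Real.exp (l₁ s - l₂ s) := by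
        rw [← Real.exp_add]; ring_nf
      have e4 : Real.exp (l₂ s) = Real.exp (l₁ s) * Real.exp (l₂ s - l₁ s) := by
        rw [← Real.exp_add]; ring_nf
      have e5 : Real.exp (l₂ s) * (l₁ s - l₂ s) ≤ Real.exp (l₁ s) - Real.exp (l₂ s) := by
        nlinarith [Real.exp_pos (l₂ s)]
      have e6 : Real.exp (l₁ s) - Real.exp (l₂ s) ≤ Real.exp (l₁ s) * (l₁ s - l₂ s) := by
        nlinarith [Real.exp_pos (l₁ s)]
      have a1 : |(Real.exp (l₁ s) - 1) * (l₁ s - l₂ s)| ≤ 1 / 100 * |l₁ s - l₂ s| := by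
        rw [abs_mul]; exact mul_le_mul_of_nonneg_right (hl₁ s hs) (abs_nonneg _)
      have a2 : |(Real.exp (l₂ s) - 1) * (l₁ s - l₂ s)| ≤ 1 / 100 * |l₁ s - l₂ s| := by
        rw [abs_mul]; exact mul_le_mul_of_nonneg_right (hl₂ s hs) (abs_nonneg _)
      rw [abs_le]
      have b1 := (abs_le.1 a2).1
      have b2 := (abs_le.1 a1).2
      constructor <;> linarith
    obtain ⟨hp1, hp1'⟩ := abs_le.1 (hp₁ s hs)
    obtain ⟨hp2, hp2'⟩ := abs_le.1 (hp₂ s hs)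
    have hDD : |D₁ s * (p₁ s + 2) ^ 2 - D₂ s * (p₂ s + 2) ^ 2| ≤
        6 / 100 * |p₁ s - p₂ s| + 9 / 100 * |l₁ s - l₂ s| := by
      have e1 : D₁ s * (p₁ s + 2) ^ 2 - D₂ s * (p₂ s + 2) ^ 2 =
          D₁ s * (p₁ s + p₂ s + 4) * (p₁ s - p₂ s) + (D₁ s - D₂ s) * (p₂ s + 2) ^ 2 := by ring
      rw [e1]
      refine (abs_add_le _ _).trans (add_le_add ?_ ?_)
      · rw [abs_mul, abs_mul]
        refine mul_le_mul_of_nonneg_right ?_ (abs_nonneg _)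
        have : |p₁ s + p₂ s + 4| ≤ 6 := by rw [abs_le]; constructor <;> linarith
        calc |D₁ s| * |p₁ s + p₂ s + 4| ≤ 1 / 100 * 6 :=
              mul_le_mul (hD₁ s hs) this (abs_nonneg _) (by norm_num)
          _ = 6 / 100 := by norm_num
      · rw [abs_mul, abs_of_nonneg (sq_nonneg (p₂ s + 2))]
        have : (p₂ s + 2) ^ 2 ≤ 9 := by nlinarith
        calc |D₁ s - D₂ s| * (p₂ s + 2) ^ 2 ≤ (1 / 100 * |l₁ s - l₂ s|) * 9 :=
              mul_le_mul (hD s hs) this (sq_nonneg _) (by positivity)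
          _ = 9 / 100 * |l₁ s - l₂ s| := by ring
    set z := l₁ s - l₂ s with hz
    set q := p₁ s - p₂ s with hqd
    set E := Real.exp (l₁ s) - Real.exp (l₂ s) - z with hEd
    set R := D₁ s * (p₁ s + 2) ^ 2 - D₂ s * (p₂ s + 2) ^ 2 with hR
    have hrhs : (2 * n * (Real.exp (l₁ s) - 1) - n * p₁ s - D₁ s * (p₁ s + 2) ^ 2)
          - (2 * n * (Real.exp (l₂ s) - 1) - n * p₂ s - D₂ s * (p₂ s + 2) ^ 2)
        = 2 * n * z - n * q + (2 * n * E - R) := by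
      simp only [hEd, hR, hqd]; ring
    rw [hrhs]
    have herr : |2 * n * E - R| ≤ n * (11 / 100 * |z| + 6 / 100 * |q|) := by
      refine (abs_sub _ _).trans ?_
      rw [abs_mul, abs_of_nonneg (show 0 ≤ 2 * n by linarith)]
      have e1 := mul_le_mul_of_nonneg_left hE (show 0 ≤ 2 * n by linarith)
      have e2 : |z| ≤ n * |z| := le_mul_of_one_le_left (abs_nonneg _) hn
      have e3 : |q| ≤ n * |q| := le_mul_of_one_le_left (abs_nonneg _) hn
      linarith
    have hprod : (2 * n * E - R) * (2 * q - z / 2) ≤ n / 4 * (z ^ 2 + q ^ 2) := by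
      have e1 : |2 * q - z / 2| ≤ 2 * |q| + |z| / 2 := by
        refine (abs_sub _ _).trans ?_
        rw [abs_mul, abs_div, abs_two]
      have e2 := mul_le_mul herr e1 (abs_nonneg _)
        (mul_nonneg (by linarith) (by positivity))
      rw [← abs_mul] at e2
      refine (le_abs_self _).trans (e2.trans ?_)
      have e3 : (11 / 100 * |z| + 6 / 100 * |q|) * (2 * |q| + |z| / 2) ≤
          1 / 4 * (z ^ 2 + q ^ 2) := by
        rw [← sq_abs z, ← sq_abs q]
        nlinarith [sq_nonneg (|z| - |q|), sq_nonneg (|z|), sq_nonneg (|q|)]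
      have e4 := mul_le_mul_of_nonneg_left e3 (show 0 ≤ n by linarith)
      linarith
    have e6 : q ^ 2 ≤ n * q ^ 2 := le_mul_of_one_le_left (sq_nonneg _) hn
    have e7 : 0 ≤ n * (z - q) ^ 2 := mul_nonneg (by linarith) (sq_nonneg _)
    nlinarith
  have h0 := hanti hα hs hαs
  simp only at h0
  have h1 : Q s ≤ Q α * Real.exp (-((s - α) / 6)) := by
    have : Real.exp (-((s - α) / 6)) = Real.exp (1 / 6 * α) / Real.exp (1 / 6 * s) := by
      rw [← Real.exp_sub]; ring_nf
    rw [this, mul_div_assoc', le_div_iff₀ (Real.exp_pos _)]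
    exact h0
  have h2 := mul_le_mul_of_nonneg_right (hQle α hα) (Real.exp_pos (-((s - α) / 6))).le
  have h3 := hQge s hs
  nlinarith

end IsEmdenSystem

/-- If `H e^{cs}` is nonincreasing and `H` is bounded above near `-∞`, then `H ≤ 0`. -/
lemma nonpos_of_antitoneOn_mul_exp {H : ℝ → ℝ} {c B S : ℝ} (hc : 0 < c)
    (h : AntitoneOn (fun s => H s * Real.exp (c * s)) (Iic S)) (hB : ∀ s ≤ S, H s ≤ B)
    {s : ℝ} (hs : s ≤ S) : H s ≤ 0 := by
  by_contra! hpos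
  have hlim : Tendsto (fun t : ℝ => B * Real.exp (c * t)) atBot (𝓝 (B * 0)) :=
    (Real.tendsto_exp_atBot.comp (tendsto_id.const_mul_atBot hc)).const_mul B
  rw [mul_zero] at hlim
  have hev := hlim.eventually_lt_const (mul_pos hpos (Real.exp_pos (c * s)))
  obtain ⟨t, ht, hts⟩ := (hev.and (eventually_le_atBot s)).exists
  have h1 := h (mem_Iic.2 (hts.trans hs)) (mem_Iic.2 hs) hts
  have h2 := mul_le_mul_of_nonneg_right (hB t (hts.trans hs)) (Real.exp_pos (c * t)).le
  simp only at h1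
  linarith

namespace IsEmdenSystem

variable {n S : ℝ} {l p D : ℝ → ℝ}

/-- The a priori bound on `l` bounds `p`: otherwise `l` would grow linearly backwards. -/
lemma snd_le (h : IsEmdenSystem n l p D (Iic S)) (hn : 1 ≤ n)
    (hl : ∀ s ≤ S, Real.exp (l s) ≤ (n + 2) / n) (hD : ∀ s ≤ S, 0 ≤ D s) :
    ∀ s ≤ S, p s ≤ 4 / n := by
  have hn0 : 0 < n := by linarith
  intro s₀ hs₀
  by_contra! hgt
  have hanti : AntitoneOn (fun s => (p s - 4 / n) * Real.exp (n * s)) (Iic S) := by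
    refine antitoneOn_mul_exp (convex_Iic S)
      (fun s hs => (h.hasDerivAt_snd s hs).sub_const (4 / n)) (fun s hs => ?_)
    have h1 := hl s hs
    rw [le_div_iff₀ hn0] at h1
    have h2 : 0 ≤ D s * (p s + 2) ^ 2 := mul_nonneg (hD s hs) (sq_nonneg _)
    have h3 : n * (4 / n) = 4 := by field_simp
    nlinarith
  have hge : ∀ s ≤ s₀, p s₀ ≤ p s := by
    intro s hs
    have h1 := hanti (mem_Iic.2 (hs.trans hs₀)) (mem_Iic.2 hs₀) hs
    have h2 : Real.exp (n * s) ≤ Real.exp (n * s₀) :=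
      Real.exp_le_exp.2 (mul_le_mul_of_nonneg_left hs hn0.le)
    simp only at h1
    by_contra! hlt
    have h3 : (p s - 4 / n) * Real.exp (n * s) < (p s₀ - 4 / n) * Real.exp (n * s) :=
      mul_lt_mul_of_pos_right (by linarith) (Real.exp_pos _)
    have h4 := mul_le_mul_of_nonneg_left h2 (show 0 ≤ p s₀ - 4 / n by linarith)
    linarith
  have hp0 : 0 < p s₀ := lt_trans (by positivity) hgt
  have hanti2 : AntitoneOn (fun s => l s + p s₀ * s) (Iic s₀) :=
    antitoneOn_of_forall_hasDerivAt (convex_Iic s₀)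
      (fun s hs => (h.hasDerivAt_fst s (mem_Iic.2 (le_trans hs hs₀))).add
        ((hasDerivAt_id s).const_mul (p s₀)))
      (fun s hs => by have := hge s hs; linarith)
  have hlim : Tendsto (fun s : ℝ => -(p s₀ * s)) atBot atTop :=
    tendsto_neg_atBot_atTop.comp (tendsto_id.const_mul_atBot hp0)
  obtain ⟨s, hs1, hs⟩ := ((hlim.eventually_gt_atTop
    ((n + 2) / n - (l s₀ + p s₀ * s₀))).and (eventually_le_atBot s₀)).exists
  have h1 := hanti2 (mem_Iic.2 hs) (mem_Iic.2 le_rfl) hs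
  simp only at h1
  have h2 := hl s (hs.trans hs₀)
  have h3 := Real.add_one_le_exp (l s)
  linarith

/-- A trajectory along which `2s - l(s) → -∞` as `s → -∞` (for a radial profile: `F(u) → 0`)
does not escape to `l = -∞`: there it would follow the unstable direction, along which
`2s - l(s)` stays bounded. -/
lemma frequently_half_le_exp (h : IsEmdenSystem n l p D (Iic S)) (hn : 1 ≤ n)
    (hD : ∀ s ≤ S, 0 ≤ D s) (hp : ∀ s ≤ S, p s ≤ 4 / n)
    (hlim : Tendsto (fun s => 2 * s - l s) atBot atBot) :
    ∃ᶠ s in atBot, 1 / 2 ≤ Real.exp (l s) := by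
  have hn0 : 0 < n := by linarith
  by_contra hcon
  rw [not_frequently] at hcon
  obtain ⟨S', hS'⟩ := eventually_atBot.1 (hcon.and (eventually_le_atBot S))
  have hE : ∀ s ≤ S', Real.exp (l s) ≤ 1 / 2 := fun s hs => (not_le.1 (hS' s hs).1).le
  have hS : ∀ s ≤ S', s ≤ S := fun s hs => (hS' s hs).2
  have h1 : ∀ s ≤ S', p s + 1 ≤ 0 := by
    intro s hs
    refine nonpos_of_antitoneOn_mul_exp (H := fun s => p s + 1) (B := 4 / n + 1) hn0
      (antitoneOn_mul_exp (convex_Iic S')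
        (fun s hs => (h.hasDerivAt_snd s (hS s hs)).add_const 1) (fun s hs => ?_))
      (fun s hs => by have := hp s (hS s hs); linarith) hs
    have h2 : 0 ≤ D s * (p s + 2) ^ 2 := mul_nonneg (hD s (hS s hs)) (sq_nonneg _)
    have h3 := hE s hs
    nlinarith
  have hmono : MonotoneOn (fun s => l s - s) (Iic S') :=
    monotoneOn_of_forall_hasDerivAt (convex_Iic S')
      (fun s hs => (h.hasDerivAt_fst s (hS s hs)).sub (hasDerivAt_id s))
      (fun s hs => by have := h1 s hs; linarith)
  set K := Real.exp (l S' - S')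
  have hK : ∀ s ≤ S', Real.exp (l s) ≤ K * Real.exp s := by
    intro s hs
    have := hmono (mem_Iic.2 hs) (mem_Iic.2 le_rfl) hs
    simp only at this
    rw [← Real.exp_add]
    exact Real.exp_le_exp.2 (by linarith)
  have h2 : ∀ s ≤ S', p s + 2 - 2 * n * K * Real.exp s ≤ 0 := by
    intro s hs
    refine nonpos_of_antitoneOn_mul_exp (H := fun s => p s + 2 - 2 * n * K * Real.exp s)
      (B := 1) hn0 (antitoneOn_mul_exp (convex_Iic S')
        (fun s hs => ((h.hasDerivAt_snd s (hS s hs)).add_const 2).sub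
          ((Real.hasDerivAt_exp s).const_mul (2 * n * K))) (fun s hs => ?_))
      (fun s hs => ?_) hs
    · have h2 : 0 ≤ D s * (p s + 2) ^ 2 := mul_nonneg (hD s (hS s hs)) (sq_nonneg _)
      have h3 := mul_le_mul_of_nonneg_left (hK s hs) (show 0 ≤ 2 * n by linarith)
      have h4 : 0 ≤ n * (2 * n * K * Real.exp s) := by positivity
      nlinarith
    · have h3 := h1 s hs
      have h4 : 0 ≤ 2 * n * K * Real.exp s := by positivity
      linarith
  have hanti : AntitoneOn (fun s => 2 * s - l s - 2 * n * K * Real.exp s) (Iic S') :=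
    antitoneOn_of_forall_hasDerivAt (convex_Iic S')
      (fun s hs => (((hasDerivAt_id s).const_mul 2).sub (h.hasDerivAt_fst s (hS s hs))).sub
        ((Real.hasDerivAt_exp s).const_mul (2 * n * K)))
      (fun s hs => by have := h2 s hs; linarith)
  obtain ⟨s, hs1, hs⟩ := ((hlim.eventually_lt_atBot
    (2 * S' - l S' - 2 * n * K * Real.exp S')).and (eventually_le_atBot S')).exists
  have h3 := hanti (mem_Iic.2 hs) (mem_Iic.2 le_rfl) hs
  simp only at h3
  have h4 : 0 ≤ 2 * n * K * Real.exp s := by positivity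
  linarith

end IsEmdenSystem

/-! ### Radial profiles in logarithmic time -/

/-- `U(s) = u(e^s)` for a radial solution `u` of `Δu + f(u) = 0` in dimension `n + 2`, with
`V = U'`. The singularity is at `s = -∞`. -/
structure IsRadialProfile (n : ℝ) (f U V : ℝ → ℝ) (I : Set ℝ) : Prop where
  hasDerivAt : ∀ s ∈ I, HasDerivAt U (V s) s
  hasDerivAt_deriv : ∀ s ∈ I, HasDerivAt V (-n * V s - Real.exp (2 * s) * f (U s)) s

/-- The first Emden variable: `e^{2s} / (2n F(U))` is the exponential of it. -/
noncomputable def emdenShift (n : ℝ) (f U : ℝ → ℝ) (s : ℝ) : ℝ :=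
  2 * s - Real.log (tailIntegral f (U s)) - Real.log (2 * n)

/-- The second Emden variable: the derivative of `log F(U)`, minus its equilibrium value `2`. -/
noncomputable def emdenSlope (f U V : ℝ → ℝ) (s : ℝ) : ℝ :=
  -V s / (f (U s) * tailIntegral f (U s)) - 2

namespace IsRadialProfile

variable {N : ℕ} {n S : ℝ} {f U V : ℝ → ℝ} {I : Set ℝ}

lemma mono {J : Set ℝ} (h : IsRadialProfile n f U V I) (hJ : J ⊆ I) : IsRadialProfile n f U V J :=
  ⟨fun s hs => h.hasDerivAt s (hJ hs), fun s hs => h.hasDerivAt_deriv s (hJ hs)⟩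

lemma exp_emdenShift (hf : IsAdmissibleNonlinearity N f) (hn : 0 < n) {s : ℝ} (hU : 0 < U s) :
    Real.exp (emdenShift n f U s) = Real.exp (2 * s) / (2 * n * tailIntegral f (U s)) := by
  unfold emdenShift
  rw [Real.exp_sub, Real.exp_sub, Real.exp_log (hf.tailIntegral_pos hU),
    Real.exp_log (by positivity), div_div]
  ring

lemma isEmdenSystem (h : IsRadialProfile n f U V I) (hf : IsAdmissibleNonlinearity N f)
    (hn : 0 < n) (hU : ∀ s ∈ I, 0 < U s) :
    IsEmdenSystem n (emdenShift n f U) (emdenSlope f U V) (fun s => expDefect f (U s)) I := by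
  constructor
  · intro s hs
    have hF := (hf.hasDerivAt_log_tailIntegral (hU s hs)).comp s (h.hasDerivAt s hs)
    refine ((((hasDerivAt_id s).const_mul 2).sub hF).sub_const _).congr_deriv ?_
    have h1 := (hf.pos (hU s hs)).ne'
    have h2 := (hf.tailIntegral_pos (hU s hs)).ne'
    unfold emdenSlope
    field_simp
    ring
  · intro s hs
    have hUs := hU s hs
    have h1 := (hf.pos hUs).ne'
    have h2 := (hf.tailIntegral_pos hUs).ne'
    have hG := ((hf.hasDerivAt hUs).comp s (h.hasDerivAt s hs)).mul
      ((hf.hasDerivAt_tailIntegral hUs).comp s (h.hasDerivAt s hs))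
    have hy := ((h.hasDerivAt_deriv s hs).neg.div hG (mul_ne_zero h1 h2)).sub_const 2
    refine hy.congr_deriv ?_
    rw [exp_emdenShift hf hn hUs]
    unfold emdenSlope expDefect
    simp only [Function.comp_apply, Pi.mul_apply, Pi.neg_apply]
    field_simp
    ring

/-- A profile with a singularity at `-∞` is strictly decreasing. -/
lemma deriv_neg (h : IsRadialProfile n f U V (Iic S)) (hf : IsAdmissibleNonlinearity N f)
    (hU : ∀ s ≤ S, 0 ≤ U s) (hsing : Tendsto U atBot atTop) : ∀ s ≤ S, V s < 0 := by
  have hanti : AntitoneOn (fun s => V s * Real.exp (n * s)) (Iic S) := by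
    refine antitoneOn_mul_exp (convex_Iic S) h.hasDerivAt_deriv (fun s hs => ?_)
    have := mul_nonneg (Real.exp_pos (2 * s)).le (hf.nonneg (hU s hs))
    linarith
  intro s₀ hs₀
  by_contra! hge
  have hV : ∀ s ≤ s₀, 0 ≤ V s := by
    intro s hs
    have h1 := hanti (mem_Iic.2 (hs.trans hs₀)) (mem_Iic.2 hs₀) hs
    simp only at h1
    have h2 := mul_nonneg hge (Real.exp_pos (n * s₀)).le
    exact nonneg_of_mul_nonneg_left (h2.trans h1) (Real.exp_pos _)
  have hmono : MonotoneOn U (Iic s₀) :=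
    monotoneOn_of_forall_hasDerivAt (convex_Iic s₀)
      (fun s hs => h.hasDerivAt s (mem_Iic.2 (le_trans hs hs₀))) hV
  obtain ⟨s, hs1, hs⟩ := ((hsing.eventually_gt_atTop (U s₀)).and
    (eventually_le_atBot s₀)).exists
  exact absurd (hmono (mem_Iic.2 hs) (mem_Iic.2 le_rfl) hs) (not_le.2 hs1)

/-- The flux `-e^{ns} V = ∫ e^{(n+2)σ} f(U(σ)) dσ` over `(-∞, s]` is at least its value for `f(U)`
frozen at the time `s`. -/
lemma exp_mul_le (h : IsRadialProfile n f U V (Iic S)) (hf : IsAdmissibleNonlinearity N f)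
    (hn : 0 < n) (hU : ∀ s ≤ S, 0 < U s) (hsing : Tendsto U atBot atTop) :
    ∀ s ≤ S, Real.exp (2 * s) * f (U s) ≤ -(n + 2) * V s := by
  have hV := h.deriv_neg hf (fun s hs => (hU s hs).le) hsing
  have hanti : AntitoneOn (fun s => (V s + Real.exp (2 * s) * f (U s) / (n + 2)) *
      Real.exp (n * s)) (Iic S) := by
    refine antitoneOn_mul_exp (convex_Iic S) (fun s hs => (h.hasDerivAt_deriv s hs).add
      (((hasDerivAt_exp_two_mul s).mul
          ((hf.hasDerivAt (hU s hs)).comp s (h.hasDerivAt s hs))).div_const (n + 2)))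
      (fun s hs => ?_)
    have h1 : 0 ≤ -(Real.exp (2 * s) * (deriv f (U s) * V s) / (n + 2)) := by
      rw [neg_nonneg]
      refine div_nonpos_of_nonpos_of_nonneg ?_ (by linarith)
      exact mul_nonpos_of_nonneg_of_nonpos (Real.exp_pos _).le
        (mul_nonpos_of_nonneg_of_nonpos (hf.deriv_pos _ (hU s hs)).le (hV s hs).le)
    have h2 : -n * V s - Real.exp (2 * s) * f (U s) +
        (2 * Real.exp (2 * s) * f (U s) + Real.exp (2 * s) * (deriv f (U s) * V s)) / (n + 2) +
        n * (V s + Real.exp (2 * s) * f (U s) / (n + 2)) =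
        Real.exp (2 * s) * (deriv f (U s) * V s) / (n + 2) := by
      field_simp
      ring
    simp only [Function.comp_apply]
    rw [h2]
    linarith
  intro s₀ hs₀
  by_contra! hlt
  set ε := (V s₀ + Real.exp (2 * s₀) * f (U s₀) / (n + 2)) * Real.exp (n * s₀) with hε
  have hε0 : 0 < ε := by
    refine mul_pos ?_ (Real.exp_pos _)
    have : -V s₀ < Real.exp (2 * s₀) * f (U s₀) / (n + 2) := by
      rw [lt_div_iff₀ (by linarith)]; linarith
    linarith
  -- the flux then has derivative at least `(n + 2) ε` on `(-∞, s₀]`, and so becomes negative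
  have hanti2 : AntitoneOn (fun s => V s * Real.exp (n * s) + (n + 2) * ε * s) (Iic s₀) := by
    refine antitoneOn_of_forall_hasDerivAt (convex_Iic s₀)
      (fun s hs => (hasDerivAt_mul_exp (c := n)
        (h.hasDerivAt_deriv s (mem_Iic.2 (le_trans hs hs₀)))).add
        ((hasDerivAt_id s).const_mul ((n + 2) * ε))) (fun s hs => ?_)
    have h1 : ε ≤ (V s + Real.exp (2 * s) * f (U s) / (n + 2)) * Real.exp (n * s) :=
      hanti (mem_Iic.2 (le_trans hs hs₀)) (mem_Iic.2 hs₀) hs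
    have h2 : V s * Real.exp (n * s) ≤ 0 :=
      mul_nonpos_of_nonpos_of_nonneg (hV s (le_trans hs hs₀)).le (Real.exp_pos _).le
    have h3 : (n + 2) * ε ≤ Real.exp (2 * s) * f (U s) * Real.exp (n * s) := by
      have h4 : ε ≤ Real.exp (2 * s) * f (U s) / (n + 2) * Real.exp (n * s) := by linarith
      rw [div_mul_eq_mul_div, le_div_iff₀ (by linarith)] at h4
      linarith
    linarith
  have hlim : Tendsto (fun s : ℝ => -((n + 2) * ε * s)) atBot atTop :=
    tendsto_neg_atBot_atTop.comp (tendsto_id.const_mul_atBot (by positivity))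
  obtain ⟨s, hs1, hs⟩ := ((hlim.eventually_gt_atTop
    (-(V s₀ * Real.exp (n * s₀) + (n + 2) * ε * s₀))).and (eventually_le_atBot s₀)).exists
  have h1 := hanti2 (mem_Iic.2 hs) (mem_Iic.2 le_rfl) hs
  simp only at h1
  have h2 : V s * Real.exp (n * s) ≤ 0 :=
      mul_nonpos_of_nonpos_of_nonneg (hV s (hs.trans hs₀)).le (Real.exp_pos _).le
  linarith

lemma exp_le_tailIntegral (h : IsRadialProfile n f U V (Iic S))
    (hf : IsAdmissibleNonlinearity N f)
    (hn : 0 < n) (hU : ∀ s ≤ S, 0 < U s) (hsing : Tendsto U atBot atTop) :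
    ∀ s ≤ S, Real.exp (2 * s) ≤ 2 * (n + 2) * tailIntegral f (U s) := by
  have hle := h.exp_mul_le hf hn hU hsing
  have hmono : MonotoneOn (fun s => 2 * (n + 2) * tailIntegral f (U s) - Real.exp (2 * s))
      (Iic S) := by
    refine monotoneOn_of_forall_hasDerivAt (convex_Iic S)
      (fun s hs => (((hf.hasDerivAt_tailIntegral (hU s hs)).comp s
        (h.hasDerivAt s hs)).const_mul (2 * (n + 2))).sub (hasDerivAt_exp_two_mul s))
      (fun s hs => ?_)
    have h1 := hf.pos (hU s hs)
    have h2 : Real.exp (2 * s) ≤ -(n + 2) * V s / f (U s) := by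
      rw [le_div_iff₀ h1]; exact hle s hs
    have h3 : 2 * (n + 2) * (-(1 / f (U s)) * V s) = 2 * (-(n + 2) * V s / f (U s)) := by
      ring
    rw [h3]; linarith
  have hlim : Tendsto (fun s => 2 * (n + 2) * tailIntegral f (U s) - Real.exp (2 * s)) atBot
      (𝓝 (2 * (n + 2) * 0 - 0)) :=
    ((hf.tendsto_tailIntegral_atTop.comp hsing).const_mul _).sub
      (Real.tendsto_exp_atBot.comp (tendsto_id.const_mul_atBot two_pos))
  rw [mul_zero, sub_zero] at hlim
  intro s hs
  have : 0 ≤ 2 * (n + 2) * tailIntegral f (U s) - Real.exp (2 * s) :=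
    le_of_tendsto hlim (by
      filter_upwards [eventually_le_atBot s] with t ht
      exact hmono (mem_Iic.2 (ht.trans hs)) (mem_Iic.2 hs) ht)
  linarith

/-- In Emden variables every singular profile converges to the equilibrium as `s → -∞`. -/
theorem eventually_emdenDist_lt (h : IsRadialProfile n f U V (Iic S))
    (hf : IsAdmissibleNonlinearity N f) (hn : 1 ≤ n) (hsing : Tendsto U atBot atTop)
    {ε : ℝ} (hε : 0 < ε) :
    ∀ᶠ s in atBot, emdenDist (emdenShift n f U s) (emdenSlope f U V s) < ε := by
  have hn0 : 0 < n := by linarith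
  obtain ⟨M, hM, hδ⟩ := hf.exists_expDefect_nonneg
  obtain ⟨T, hT⟩ := eventually_atBot.1 ((hsing.eventually_gt_atTop M).and (eventually_le_atBot S))
  have h' : IsRadialProfile n f U V (Iic T) := h.mono (fun s hs => (hT s hs).2)
  have hU : ∀ s ≤ T, 0 < U s := fun s hs => hM.trans (hT s hs).1
  have hsys := h'.isEmdenSystem hf hn0 hU
  have hle := h'.exp_le_tailIntegral hf hn0 hU hsing
  have hl : ∀ s ≤ T, Real.exp (emdenShift n f U s) ≤ (n + 2) / n := by
    intro s hs
    have hF := hf.tailIntegral_pos (hU s hs)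
    rw [exp_emdenShift hf hn0 (hU s hs), div_le_div_iff₀ (by positivity) hn0]
    have := mul_le_mul_of_nonneg_right (hle s hs) hn0.le
    linarith
  have hD : ∀ s ≤ T, 0 ≤ expDefect f (U s) := fun s hs => hδ _ (hT s hs).1
  have hp := hsys.snd_le hn hl hD
  have hp' : ∀ s ≤ T, -2 ≤ emdenSlope f U V s := by
    intro s hs
    have h1 := h'.deriv_neg hf (fun s hs => (hU s hs).le) hsing s hs
    have h2 := mul_pos (hf.pos (hU s hs)) (hf.tailIntegral_pos (hU s hs))
    have h3 := div_pos (neg_pos.2 h1) h2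
    unfold emdenSlope
    linarith
  have hn4 : 4 / n ≤ 4 := by rw [div_le_iff₀ hn0]; linarith
  have hn3 : (n + 2) / n ≤ 3 := by rw [div_le_iff₀ hn0]; linarith
  refine hsys.eventually_dist_lt hn (fun s hs => (hl s hs).trans hn3)
    (fun s hs => abs_le.2 ⟨by linarith [hp' s hs], (hp s hs).trans hn4⟩) hD
    (hf.tendsto_expDefect.comp hsing) (hsys.frequently_half_le_exp hn hD hp ?_) hε
  have hF : Tendsto (fun s => Real.log (tailIntegral f (U s)) + Real.log (2 * n)) atBot atBot := by
    refine tendsto_atBot_add_const_right _ _ (Real.tendsto_log_nhdsGT_zero.comp ?_)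
    refine tendsto_nhdsWithin_iff.2 ⟨hf.tendsto_tailIntegral_atTop.comp hsing, ?_⟩
    filter_upwards [eventually_le_atBot T] with s hs using hf.tailIntegral_pos (hU s hs)
  refine hF.congr (fun s => ?_)
  unfold emdenShift
  ring

/-- Two singular profiles coincide near `-∞`. -/
theorem eventually_eq {S₁ S₂ : ℝ} {U₁ V₁ U₂ V₂ : ℝ → ℝ} (h₁ : IsRadialProfile n f U₁ V₁ (Iic S₁))
    (h₂ : IsRadialProfile n f U₂ V₂ (Iic S₂)) (hf : IsAdmissibleNonlinearity N f) (hn : 1 ≤ n)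
    (hsing₁ : Tendsto U₁ atBot atTop) (hsing₂ : Tendsto U₂ atBot atTop) :
    ∀ᶠ s in atBot, U₁ s = U₂ s ∧ V₁ s = V₂ s := by
  have hn0 : 0 < n := by linarith
  obtain ⟨M, hM, hδ, hδδ⟩ := hf.exists_expDefect_bounds (show (0 : ℝ) < 1 / 100 by norm_num)
  obtain ⟨T, hT⟩ := eventually_atBot.1 ((((hsing₁.eventually_gt_atTop M).and
    (eventually_le_atBot S₁)).and ((hsing₂.eventually_gt_atTop M).and
    (eventually_le_atBot S₂))).and
    ((h₁.eventually_emdenDist_lt hf hn hsing₁ (show (0 : ℝ) < (1 / 100) ^ 2 by norm_num)).and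
    (h₂.eventually_emdenDist_lt hf hn hsing₂ (show (0 : ℝ) < (1 / 100) ^ 2 by norm_num))))
  have hU₁ : ∀ s ≤ T, 0 < U₁ s := fun s hs => hM.trans (hT s hs).1.1.1
  have hU₂ : ∀ s ≤ T, 0 < U₂ s := fun s hs => hM.trans (hT s hs).1.2.1
  have hd₁ : ∀ s ≤ T, _ ∧ _ := fun s hs =>
    abs_le_of_emdenDist_le (show (0 : ℝ) ≤ 1 / 100 by norm_num) (hT s hs).2.1.le
  have hd₂ : ∀ s ≤ T, _ ∧ _ := fun s hs =>
    abs_le_of_emdenDist_le (show (0 : ℝ) ≤ 1 / 100 by norm_num) (hT s hs).2.2.le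
  have hs₁ := (h₁.mono (fun s hs => (hT s hs).1.1.2)).isEmdenSystem hf hn0 hU₁
  have hs₂ := (h₂.mono (fun s hs => (hT s hs).1.2.2)).isEmdenSystem hf hn0 hU₂
  have hsub : ∀ s, emdenShift n f U₁ s - emdenShift n f U₂ s =
      -(Real.log (tailIntegral f (U₁ s)) - Real.log (tailIntegral f (U₂ s))) := by
    intro s; unfold emdenShift; ring
  have hle := fun α s (hα : α ∈ Iic T) (hs : s ∈ Iic T) hαs =>
    IsEmdenSystem.sq_sub_le (convex_Iic T) hn hs₁ hs₂
    (fun s hs => (hd₁ s hs).1) (fun s hs => (hd₂ s hs).1) (fun s hs => (hd₁ s hs).2)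
    (fun s hs => (hd₂ s hs).2)
    (fun s hs => by
      have := hδ _ (hT s hs).1.1.1
      rw [abs_of_nonneg this.1]; exact this.2)
    (fun s hs => by
      rw [hsub, abs_neg]
      exact hδδ _ _ (hT s hs).1.1.1 (hT s hs).1.2.1) (α := α) (s := s) hα hs hαs
  filter_upwards [eventually_le_atBot T] with s hs
  have hlim : Tendsto (fun α : ℝ => 6 * n * Real.exp (-((s - α) / 6)) * 5) atBot
      (𝓝 (6 * n * 0 * 5)) := by
    refine ((Real.tendsto_exp_atBot.comp ?_).const_mul _).mul_const _
    have : Tendsto (fun α : ℝ => 1 / 6 * α + -(s / 6)) atBot atBot :=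
      tendsto_atBot_add_const_right _ _ (tendsto_id.const_mul_atBot (by norm_num))
    exact this.congr (fun α => by ring)
  have hzero : (emdenShift n f U₁ s - emdenShift n f U₂ s) ^ 2 +
      (emdenSlope f U₁ V₁ s - emdenSlope f U₂ V₂ s) ^ 2 ≤ 6 * n * 0 * 5 := by
    refine ge_of_tendsto hlim ?_
    filter_upwards [eventually_le_atBot s] with α hα
    refine (hle α s (hα.trans hs) hs hα).trans ?_
    refine mul_le_mul_of_nonneg_left ?_ (by positivity)
    have a1 := abs_le.1 (abs_le_of_abs_exp_sub_one_le (hd₁ α (hα.trans hs)).1)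
    have a2 := abs_le.1 (abs_le_of_abs_exp_sub_one_le (hd₂ α (hα.trans hs)).1)
    have a3 := abs_le.1 (hd₁ α (hα.trans hs)).2
    have a4 := abs_le.1 (hd₂ α (hα.trans hs)).2
    nlinarith [a1.1, a1.2, a2.1, a2.2, a3.1, a3.2, a4.1, a4.2]
  have hz : emdenShift n f U₁ s - emdenShift n f U₂ s = 0 := by
    nlinarith [sq_nonneg (emdenShift n f U₁ s - emdenShift n f U₂ s),
      sq_nonneg (emdenSlope f U₁ V₁ s - emdenSlope f U₂ V₂ s)]
  have hq : emdenSlope f U₁ V₁ s - emdenSlope f U₂ V₂ s = 0 := by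
    nlinarith [sq_nonneg (emdenShift n f U₁ s - emdenShift n f U₂ s),
      sq_nonneg (emdenSlope f U₁ V₁ s - emdenSlope f U₂ V₂ s)]
  have hF : tailIntegral f (U₁ s) = tailIntegral f (U₂ s) := by
    refine Real.log_injOn_pos (hf.tailIntegral_pos (hU₁ s hs)) (hf.tailIntegral_pos (hU₂ s hs)) ?_
    have := hsub s
    linarith
  have hUU : U₁ s = U₂ s := hf.strictAntiOn_tailIntegral.injOn (hU₁ s hs) (hU₂ s hs) hF
  refine ⟨hUU, ?_⟩
  unfold emdenSlope at hq
  rw [hUU] at hq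
  have h3 := (hf.pos (hU₂ s hs)).ne'
  have h4 := (hf.tailIntegral_pos (hU₂ s hs)).ne'
  field_simp at hq
  linarith

end IsRadialProfile

/-! ### Global solutions of initial value problems -/

/-- A vector field that is bounded and Lipschitz in space, uniformly over bounded times, has
global integral curves. -/
theorem exists_forall_hasDerivAt_of_lipschitz {E : Type*} [NormedAddCommGroup E]
    [NormedSpace ℝ E] [CompleteSpace E] {φ : ℝ → E → E} {t₀ : ℝ}
    (hcont : ∀ x, Continuous fun t => φ t x)
    (hK : ∀ k : ℕ, ∃ K : NNReal, ∀ t ∈ Icc (t₀ - k) (t₀ + k), LipschitzWith K (φ t))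
    (hL : ∀ k : ℕ, ∃ L : NNReal, ∀ t ∈ Icc (t₀ - k) (t₀ + k), ∀ x, ‖φ t x‖ ≤ L) (x₀ : E) :
    ∃ α : ℝ → E, α t₀ = x₀ ∧ ∀ t, HasDerivAt α (φ t (α t)) t := by
  choose K hK using hK
  choose L hL using hL
  have hsol : ∀ k : ℕ, ∃ α : ℝ → E, α t₀ = x₀ ∧ ∀ t ∈ Icc (t₀ - k) (t₀ + k),
      HasDerivWithinAt α (φ t (α t)) (Icc (t₀ - k) (t₀ + k)) t := by
    intro k
    have hmem : t₀ ∈ Icc (t₀ - k) (t₀ + k) := by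
      constructor <;> linarith [(Nat.cast_nonneg k : (0 : ℝ) ≤ k)]
    have hPL : IsPicardLindelof φ (⟨t₀, hmem⟩ : Icc (t₀ - k) (t₀ + k)) x₀ (L k * k) 0
        (L k) (K k) := by
      refine ⟨fun t ht => (hK k t ht).lipschitzOnWith, fun x _ => (hcont x).continuousOn,
        fun t ht x _ => hL k t ht x, ?_⟩
      simp
    exact hPL.exists_eq_forall_mem_Icc_hasDerivWithinAt₀
  choose α hα0 hα using hsol
  have hα' : ∀ k : ℕ, ∀ t ∈ Ioo (t₀ - k) (t₀ + k), HasDerivAt (α k) (φ t (α k t)) t :=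
    fun k t ht => (hα k t (Ioo_subset_Icc_self ht)).hasDerivAt (Icc_mem_nhds ht.1 ht.2)
  have heq : ∀ j k : ℕ, 0 < j → j ≤ k → EqOn (α j) (α k) (Icc (t₀ - j) (t₀ + j)) := by
    intro j k hj hjk
    have hj' : (0 : ℝ) < j := Nat.cast_pos.2 hj
    have hjk' : (j : ℝ) ≤ k := Nat.cast_le.2 hjk
    have hsub : Icc (t₀ - j) (t₀ + j) ⊆ Icc (t₀ - k) (t₀ + k) :=
      Icc_subset_Icc (by linarith) (by linarith)
    have hsub' : Ioo (t₀ - j) (t₀ + j) ⊆ Ioo (t₀ - k) (t₀ + k) :=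
      Ioo_subset_Ioo (by linarith) (by linarith)
    refine ODE_solution_unique_of_mem_Icc (v := φ) (s := fun _ => univ) (K := K j) (t₀ := t₀)
      (fun t ht => (hK j t (Ioo_subset_Icc_self ht)).lipschitzOnWith) ?_
      (fun t ht => (hα j t ht).continuousWithinAt) (hα' j) (fun _ _ => mem_univ _)
      (fun t ht => ((hα k t (hsub ht)).continuousWithinAt).mono hsub)
      (fun t ht => hα' k t (hsub' ht)) (fun _ _ => mem_univ _) ?_
    · constructor <;> linarith
    · rw [hα0, hα0]
  set idx : ℝ → ℕ := fun t => ⌈|t - t₀|⌉₊ + 1 with hidx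
  have hmem : ∀ t, t ∈ Ioo (t₀ - (idx t : ℝ)) (t₀ + idx t) := by
    intro t
    have h1 : |t - t₀| < idx t := by
      have := Nat.le_ceil |t - t₀|
      simp only [hidx]; push_cast; linarith
    obtain ⟨h2, h3⟩ := abs_lt.1 h1
    constructor <;> linarith
  refine ⟨fun t => α (idx t) t, hα0 _, fun t => ?_⟩
  set k := idx t + 1 with hk
  have hloc : (fun t => α (idx t) t) =ᶠ[𝓝 t] α k := by
    filter_upwards [Metric.ball_mem_nhds t one_pos] with t' ht'
    refine heq (idx t') k (Nat.succ_pos _) ?_ (Ioo_subset_Icc_self (hmem t'))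
    have h1 : |t' - t₀| ≤ |t - t₀| + 1 := by
      have : |t' - t| < 1 := ht'
      calc |t' - t₀| = |(t' - t) + (t - t₀)| := by ring_nf
        _ ≤ |t' - t| + |t - t₀| := abs_add_le _ _
        _ ≤ _ := by linarith
    have h2 : ⌈|t' - t₀|⌉₊ ≤ ⌈|t - t₀|⌉₊ + 1 := by
      refine Nat.ceil_le.2 (h1.trans ?_)
      push_cast
      linarith [Nat.le_ceil |t - t₀|]
    simp only [hk, hidx]
    omega
  have hval : α (idx t) t = α k t := hloc.eq_of_nhds
  simp only [hval]
  refine (hα' k t ?_).congr_of_eventuallyEq hloc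
  have := hmem t
  simp only [hk]
  push_cast
  constructor <;> linarith [this.1, this.2]

/-- The radial equation with a bounded, globally Lipschitz nonlinearity has global solutions.
The variable `U + e^{-ns} W / n`, where `W = e^{ns} V`, makes the vector field bounded. -/
theorem exists_isRadialProfile_univ {n : ℝ} (hn : 0 < n) {g : ℝ → ℝ} {C : ℝ} {K : NNReal}
    (hgK : LipschitzWith K g) (hgC : ∀ u, |g u| ≤ C) (s₀ u₀ v₀ : ℝ) :
    ∃ U V, U s₀ = u₀ ∧ V s₀ = v₀ ∧ IsRadialProfile n g U V univ := by
  set φ : ℝ → ℝ × ℝ → ℝ × ℝ := fun s x =>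
    (-(Real.exp (2 * s) / n) * g (x.1 - Real.exp (-(n * s)) / n * x.2),
      -Real.exp ((n + 2) * s) * g (x.1 - Real.exp (-(n * s)) / n * x.2)) with hφ
  have hgcont : Continuous g := hgK.continuous
  have hC : 0 ≤ C := (abs_nonneg _).trans (hgC 0)
  have hbound : ∀ k : ℕ, ∃ B : ℝ, 0 ≤ B ∧ ∀ s ∈ Icc (s₀ - k) (s₀ + k),
      Real.exp (2 * s) / n ≤ B ∧ Real.exp ((n + 2) * s) ≤ B ∧ Real.exp (-(n * s)) / n ≤ B := by
    intro k
    obtain ⟨B₁, hB₁⟩ := (isCompact_Icc (a := s₀ - k) (b := s₀ + k)).bddAbove_image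
      (f := fun s => Real.exp (2 * s) / n + Real.exp ((n + 2) * s) + Real.exp (-(n * s)) / n)
      (by fun_prop)
    refine ⟨|B₁|, abs_nonneg _, fun s hs => ?_⟩
    have h1 := (hB₁ (mem_image_of_mem _ hs)).trans (le_abs_self _)
    have h2 : 0 < Real.exp (2 * s) / n := by positivity
    have h3 := Real.exp_pos ((n + 2) * s)
    have h4 : 0 < Real.exp (-(n * s)) / n := by positivity
    refine ⟨?_, ?_, ?_⟩ <;> linarith
  obtain ⟨α, hα0, hα⟩ := exists_forall_hasDerivAt_of_lipschitz (φ := φ) (t₀ := s₀)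
    (fun x => by simp only [hφ]; fun_prop) (fun k => by
      obtain ⟨B, hB0, hB⟩ := hbound k
      refine ⟨(B * (K * (1 + B))).toNNReal, fun s hs => LipschitzWith.of_dist_le_mul fun x y => ?_⟩
      obtain ⟨h1, h2, h3⟩ := hB s hs
      have hg : |g (x.1 - Real.exp (-(n * s)) / n * x.2) -
          g (y.1 - Real.exp (-(n * s)) / n * y.2)| ≤ K * (1 + B) * dist x y := by
        have h4 := hgK.dist_le_mul (x.1 - Real.exp (-(n * s)) / n * x.2)
          (y.1 - Real.exp (-(n * s)) / n * y.2)
        rw [Real.dist_eq, Real.dist_eq] at h4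
        refine h4.trans ?_
        rw [mul_assoc]
        refine mul_le_mul_of_nonneg_left ?_ K.2
        have h5 : |x.1 - y.1| ≤ dist x y := by
          rw [← Real.dist_eq]; exact le_max_left _ _
        have h6 : |x.2 - y.2| ≤ dist x y := by
          rw [← Real.dist_eq]; exact le_max_right _ _
        have h7 : x.1 - Real.exp (-(n * s)) / n * x.2 - (y.1 - Real.exp (-(n * s)) / n * y.2) =
          (x.1 - y.1) - Real.exp (-(n * s)) / n * (x.2 - y.2) := by ring
        rw [h7]
        refine (abs_sub _ _).trans ?_
        rw [abs_mul, abs_of_pos (show 0 < Real.exp (-(n * s)) / n by positivity), add_mul, one_mul]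
        exact add_le_add h5 (mul_le_mul h3 h6 (abs_nonneg _) hB0)
      rw [Real.coe_toNNReal _ (by positivity), Prod.dist_eq, max_le_iff, Real.dist_eq, Real.dist_eq]
      simp only [hφ]
      rw [← mul_sub, ← mul_sub, abs_mul, abs_mul, abs_neg, abs_neg, abs_of_pos (Real.exp_pos _),
        abs_of_pos (show 0 < Real.exp (2 * s) / n by positivity), mul_assoc B]
      exact ⟨mul_le_mul h1 hg (abs_nonneg _) hB0, mul_le_mul h2 hg (abs_nonneg _) hB0⟩)
    (fun k => by
      obtain ⟨B, hB0, hB⟩ := hbound k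
      refine ⟨(B * C).toNNReal, fun s hs x => ?_⟩
      obtain ⟨h1, h2, h3⟩ := hB s hs
      rw [Real.coe_toNNReal _ (by positivity), Prod.norm_def, max_le_iff,
          Real.norm_eq_abs, Real.norm_eq_abs]
      simp only [hφ]
      rw [abs_mul, abs_mul, abs_neg, abs_neg, abs_of_pos (Real.exp_pos _),
        abs_of_pos (show 0 < Real.exp (2 * s) / n by positivity)]
      exact ⟨mul_le_mul h1 (hgC _) (abs_nonneg _) hB0, mul_le_mul h2 (hgC _) (abs_nonneg _) hB0⟩)
    (u₀ + v₀ / n, Real.exp (n * s₀) * v₀)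
  have hexp : ∀ s : ℝ, HasDerivAt (fun s => Real.exp (-(n * s))) (-n * Real.exp (-(n * s))) s := by
    intro s
    refine ((hasDerivAt_id s).const_mul n).neg.exp.congr_deriv ?_
    simp; ring
  have hX : ∀ s, HasDerivAt (fun s => (α s).1) (φ s (α s)).1 s := fun s =>
    (hasFDerivAt_fst (𝕜 := ℝ) (p := α s)).comp_hasDerivAt s (hα s)
  have hW : ∀ s, HasDerivAt (fun s => (α s).2) (φ s (α s)).2 s := fun s =>
    (hasFDerivAt_snd (𝕜 := ℝ) (p := α s)).comp_hasDerivAt s (hα s)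
  have hee : ∀ s, Real.exp (-(n * s)) * Real.exp ((n + 2) * s) = Real.exp (2 * s) := by
    intro s; rw [← Real.exp_add]; ring_nf
  refine ⟨fun s => (α s).1 - Real.exp (-(n * s)) / n * (α s).2,
    fun s => Real.exp (-(n * s)) * (α s).2, ?_, ?_, fun s _ => ?_, fun s _ => ?_⟩
  · have : Real.exp (-(n * s₀)) * Real.exp (n * s₀) = 1 := by rw [← Real.exp_add]; simp
    simp only [hα0]
    have h2 : Real.exp (-(n * s₀)) / n * (Real.exp (n * s₀) * v₀) =
      (Real.exp (-(n * s₀)) * Real.exp (n * s₀)) * v₀ / n := by ring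
    rw [h2, this]; ring
  · have : Real.exp (-(n * s₀)) * Real.exp (n * s₀) = 1 := by rw [← Real.exp_add]; simp
    simp only [hα0]
    rw [← mul_assoc, this, one_mul]
  · refine ((hX s).sub (((hexp s).div_const n).mul (hW s))).congr_deriv ?_
    simp only [hφ]
    rw [← hee s]
    field_simp
    ring
  · refine ((hexp s).mul (hW s)).congr_deriv ?_
    simp only [hφ]
    rw [← hee s]
    ring

namespace IsAdmissibleNonlinearity

variable {N : ℕ} {f : ℝ → ℝ}

/-- Initial value problems for decreasing profiles are solvable for all later times, for the
extension of `f` by `0` to negative arguments. -/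
theorem exists_isRadialProfile_Ici (hf : IsAdmissibleNonlinearity N f) {n : ℝ} (hn : 0 < n)
    {s₀ u₀ v₀ : ℝ} (hu : 0 ≤ u₀) (hv : v₀ ≤ 0) :
    ∃ U V, U s₀ = u₀ ∧ V s₀ = v₀ ∧ IsRadialProfile n (fun u => f (max u 0)) U V (Ici s₀) ∧
      ∀ s, s₀ ≤ s → V s ≤ 0 := by
  obtain ⟨K, hK⟩ := hf.exists_lipschitzOnWith u₀
  set g : ℝ → ℝ := fun u => f (projIcc 0 u₀ hu u) with hg
  have hgK : LipschitzWith K g := by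
    have h1 : LipschitzWith (K * 1) (Set.domRestrict (Icc 0 u₀) f ∘ projIcc 0 u₀ hu) :=
      hK.to_restrict.comp (LipschitzWith.projIcc hu)
    rwa [mul_one] at h1
  have hmem : ∀ u, (projIcc 0 u₀ hu u : ℝ) ∈ Icc 0 u₀ := fun u => (projIcc 0 u₀ hu u).2
  have hgC : ∀ u, |g u| ≤ f u₀ := by
    intro u
    rw [abs_of_nonneg (hf.nonneg (hmem u).1)]
    exact hf.strictMonoOn.monotoneOn (hmem u).1 hu (hmem u).2
  obtain ⟨U, V, hU0, hV0, h⟩ := exists_isRadialProfile_univ hn hgK hgC s₀ u₀ v₀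
  have hanti : AntitoneOn (fun s => V s * Real.exp (n * s)) univ := by
    refine antitoneOn_mul_exp convex_univ h.hasDerivAt_deriv (fun s _ => ?_)
    have := mul_nonneg (Real.exp_pos (2 * s)).le (hf.nonneg (hmem (U s)).1)
    simp only [hg]
    linarith
  have hV : ∀ s, s₀ ≤ s → V s ≤ 0 := by
    intro s hs
    have h1 := hanti (mem_univ s₀) (mem_univ s) hs
    simp only [hV0] at h1
    have h2 := mul_nonpos_of_nonpos_of_nonneg hv (Real.exp_pos (n * s₀)).le
    exact nonpos_of_mul_nonpos_left (h1.trans h2) (Real.exp_pos _)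
  have hUanti : AntitoneOn U (Ici s₀) :=
    antitoneOn_of_forall_hasDerivAt (convex_Ici s₀) (fun s _ => h.hasDerivAt s (mem_univ s)) hV
  refine ⟨U, V, hU0, hV0, ⟨fun s _ => h.hasDerivAt s (mem_univ s), fun s hs => ?_⟩, hV⟩
  have h1 := h.hasDerivAt_deriv s (mem_univ s)
  have h2 : U s ≤ u₀ := hU0 ▸ hUanti (mem_Ici.2 le_rfl) hs hs
  have h3 : g (U s) = f (max (U s) 0) := by
    simp only [hg, coe_projIcc, min_eq_right h2, max_comm]
  rwa [h3] at h1

end IsAdmissibleNonlinearity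

/-! ### Existence of a singular profile -/

/-- If `A k → A` and `A k' = B k → B` pointwise on `(-∞, S)` with `B k` bounded and `B`
continuous, then `A' = B`. Each time interval only has to be covered for large `k`. -/
lemma hasDerivAt_of_tendsto_of_bounded {A B : ℕ → ℝ → ℝ} {A₀ B₀ : ℝ → ℝ} {S C : ℝ}
    (h : ∀ a < S, ∀ᶠ k in atTop, ∀ s ∈ Ico a S, HasDerivAt (A k) (B k s) s ∧
      ContinuousAt (B k) s ∧ |B k s| ≤ C)
    (hA : ∀ s < S, Tendsto (fun k => A k s) atTop (𝓝 (A₀ s)))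
    (hB : ∀ s < S, Tendsto (fun k => B k s) atTop (𝓝 (B₀ s)))
    (hcont : ContinuousOn B₀ (Iio S)) : ∀ s < S, HasDerivAt A₀ (B₀ s) s := by
  have key : ∀ a b, a < S → b < S → a ≤ b → A₀ b = A₀ a + ∫ t in a..b, B₀ t := by
    intro a b ha hb hab
    have hsub : uIcc a b ⊆ Ico a S := by
      rw [uIcc_of_le hab]
      exact fun t ht => ⟨ht.1, ht.2.trans_lt hb⟩
    have h1 : Tendsto (fun k => ∫ t in a..b, B k t) atTop (𝓝 (∫ t in a..b, B₀ t)) := by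
      refine intervalIntegral.tendsto_integral_filter_of_dominated_convergence (fun _ => C) ?_ ?_
        intervalIntegrable_const ?_
      · filter_upwards [h a ha] with k hk
        have : ContinuousOn (B k) (uIcc a b) :=
          fun t ht => (hk t (hsub ht)).2.1.continuousWithinAt
        exact this.intervalIntegrable.def'.aestronglyMeasurable
      · filter_upwards [h a ha] with k hk
        exact ae_of_all _ fun t ht => (hk t (hsub (uIoc_subset_uIcc ht))).2.2
      · exact ae_of_all _ fun t ht => hB t (hsub (uIoc_subset_uIcc ht)).2
    have h2 : Tendsto (fun k => A k b - A k a) atTop (𝓝 (∫ t in a..b, B₀ t)) := by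
      refine h1.congr' ?_
      filter_upwards [h a ha] with k hk
      have : ContinuousOn (B k) (uIcc a b) :=
          fun t ht => (hk t (hsub ht)).2.1.continuousWithinAt
      exact intervalIntegral.integral_eq_sub_of_hasDerivAt
        (fun t ht => (hk t (hsub ht)).1) this.intervalIntegrable
    have h3 := tendsto_nhds_unique h2 ((hA b hb).sub (hA a ha))
    linarith
  intro s hs
  have h1 : HasDerivAt (fun t => ∫ x in (s - 1)..t, B₀ x) (B₀ s) s := by
    refine intervalIntegral.integral_hasDerivAt_right ?_
      (hcont.stronglyMeasurableAtFilter isOpen_Iio s hs) (hcont.continuousAt (Iio_mem_nhds hs))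
    refine (hcont.mono ?_).intervalIntegrable
    rw [uIcc_of_le (by linarith)]
    exact fun t ht => ht.2.trans_lt hs
  refine (h1.const_add (A₀ (s - 1))).congr_of_eventuallyEq ?_
  filter_upwards [Ioo_mem_nhds (show s - 1 < s by linarith) hs] with t ht
  exact key (s - 1) t (by linarith) ht.2 ht.1.le

/-- Pointwise limits of functions with uniformly bounded derivatives are continuous. -/
lemma continuousOn_of_tendsto_of_bounded_deriv {A B : ℕ → ℝ → ℝ} {A₀ : ℝ → ℝ} {S C : ℝ}
    (h : ∀ a < S, ∀ᶠ k in atTop, ∀ s ∈ Ico a S, HasDerivAt (A k) (B k s) s ∧ |B k s| ≤ C)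
    (hA : ∀ s < S, Tendsto (fun k => A k s) atTop (𝓝 (A₀ s))) : ContinuousOn A₀ (Iio S) := by
  have key : ∀ a ∈ Iio S, ∀ b ∈ Iio S, |A₀ a - A₀ b| ≤ C * |a - b| := by
    intro a ha b hb
    refine le_of_tendsto ((hA a ha).sub (hA b hb)).abs ?_
    filter_upwards [h (min a b) (min_lt_of_left_lt ha)] with k hk
    exact (convex_Ico (min a b) S).norm_image_sub_le_of_norm_hasDerivWithin_le
      (fun t ht => (hk t ht).1.hasDerivWithinAt) (fun t ht => (hk t ht).2)
      ⟨min_le_right _ _, hb⟩ ⟨min_le_left _ _, ha⟩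
  have hC : 0 ≤ C := by
    have h1 := key (S - 1) (by simp) (S - 2) (by simp)
    have h2 : |S - 1 - (S - 2)| = 1 := by norm_num
    rw [h2, mul_one] at h1
    exact (abs_nonneg _).trans h1
  have hlip : LipschitzOnWith C.toNNReal A₀ (Iio S) :=
    LipschitzOnWith.of_dist_le_mul fun a ha b hb => by
      rw [Real.coe_toNNReal _ hC]; exact key a ha b hb
  exact hlip.continuousOn

namespace IsAdmissibleNonlinearity

variable {N : ℕ} {f : ℝ → ℝ}

lemma tendsto_of_tendsto_tailIntegral (hf : IsAdmissibleNonlinearity N f) {ι : Type*}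
    {F : Filter ι} {a : ι → ℝ} {u : ℝ} (hu : 0 < u) (ha : ∀ᶠ i in F, 0 < a i)
    (h : Tendsto (fun i => tailIntegral f (a i)) F (𝓝 (tailIntegral f u))) :
    Tendsto a F (𝓝 u) := by
  rw [tendsto_order]
  constructor
  · intro b hb
    rcases le_or_gt b 0 with hb0 | hb0
    · filter_upwards [ha] with i hi using hb0.trans_lt hi
    · filter_upwards [ha, h.eventually_lt_const (hf.strictAntiOn_tailIntegral hb0 hu hb)]
        with i hi hlt
      exact (hf.strictAntiOn_tailIntegral.lt_iff_gt hi hb0).1 hlt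
  · intro b hb
    filter_upwards [ha, h.eventually_const_lt (hf.strictAntiOn_tailIntegral hu (hu.trans hb) hb)]
      with i hi hlt
    exact (hf.strictAntiOn_tailIntegral.lt_iff_gt (hu.trans hb) hi).1 hlt

/-- Approximate singular profiles: started at the equilibrium of the Emden system at a very
negative time `σ`, a profile stays close to it up to a time `S` independent of `σ`. -/
lemma exists_approximate_profile (hf : IsAdmissibleNonlinearity N f) {n : ℝ} (hn : 1 ≤ n)
    {M S : ℝ} (hM : 0 < M)
    (hδ : ∀ u, M < u → 0 ≤ expDefect f u ∧ expDefect f u ≤ 1 / 10 ^ 9)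
    (hS : Real.exp (2 * S) ≤ n * tailIntegral f (M + 1)) {σ : ℝ} (hσ : σ ≤ S) :
    ∃ U V, IsRadialProfile n f U V (Icc σ S) ∧ ∀ s ∈ Icc σ S, M + 1 ≤ U s ∧
      emdenDist (emdenShift n f U s) (emdenSlope f U V s) ≤ (1 / 100) ^ 2 := by
  have hn0 : 0 < n := by linarith
  have hFM := hf.tailIntegral_pos (show 0 < M + 1 by linarith)
  obtain ⟨u₀, hu₀, hFu₀⟩ := hf.bijOn_tailIntegral.surjOn
    (show Real.exp (2 * σ) / (2 * n) ∈ Ioi 0 from mem_Ioi.2 (by positivity))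
  have hu₀ : 0 < u₀ := hu₀
  have hσS : Real.exp (2 * σ) ≤ Real.exp (2 * S) := Real.exp_le_exp.2 (by linarith)
  have hu₀M : M + 1 ≤ u₀ := by
    refine (hf.strictAntiOn_tailIntegral.le_iff_ge hu₀ (show (0 : ℝ) < M + 1 by linarith)).1 ?_
    rw [hFu₀, div_le_iff₀ (by positivity)]
    nlinarith
  have hf0 := hf.pos hu₀
  have hF0 := hf.tailIntegral_pos hu₀
  obtain ⟨U, V, hU0, hV0, h, hV⟩ := hf.exists_isRadialProfile_Ici hn0 (s₀ := σ) hu₀.le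
    (show -2 * (f u₀ * tailIntegral f u₀) ≤ 0 by
      have := mul_pos hf0 hF0; linarith)
  have hanti : AntitoneOn U (Ici σ) :=
    antitoneOn_of_forall_hasDerivAt (convex_Ici σ) h.hasDerivAt hV
  have hprof : ∀ τ, (∀ s ∈ Icc σ τ, M + 1 ≤ U s) → IsRadialProfile n f U V (Icc σ τ) := by
    intro τ hτ
    refine ⟨fun s hs => h.hasDerivAt s hs.1, fun s hs => ?_⟩
    have := h.hasDerivAt_deriv s hs.1
    have hpos : 0 ≤ U s := by linarith [hτ s hs]
    rwa [max_eq_left hpos] at this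
  have htrap : ∀ τ, (∀ s ∈ Icc σ τ, M + 1 ≤ U s) → ∀ s ∈ Icc σ τ,
      emdenDist (emdenShift n f U s) (emdenSlope f U V s) ≤ (1 / 100) ^ 2 := by
    intro τ hτ s hs
    have hpos : ∀ s ∈ Icc σ τ, 0 < U s := fun s hs => by linarith [hτ s hs]
    have hsys := (hprof τ hτ).isEmdenSystem hf hn0 hpos
    refine (hsys.dist_le_of_start (d := 1 / 10 ^ 9) hn ?_ ?_
      (fun t ht => (hδ _ (by linarith [hτ t ht])).1)
      (fun t ht => (hδ _ (by linarith [hτ t ht])).2) (by norm_num) s hs).trans (by norm_num)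
    · unfold emdenShift
      rw [hU0, hFu₀, Real.log_div (Real.exp_pos _).ne' (by positivity), Real.log_exp]
      ring
    · unfold emdenSlope
      rw [hU0, hV0]
      field_simp
      ring
  have hge : ∀ s ∈ Icc σ S, M + 1 ≤ U s := by
    intro s hs
    by_contra! hlt
    obtain ⟨τ, hτ, hUτ⟩ := intermediate_value_Icc' hs.1
      (fun t ht => (h.hasDerivAt t ht.1).continuousAt.continuousWithinAt)
      ⟨hlt.le, hU0.symm ▸ hu₀M⟩
    have hle : ∀ t ∈ Icc σ τ, M + 1 ≤ U t := fun t ht =>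
      hUτ.symm.le.trans (hanti ht.1 hτ.1 ht.2)
    have h1 := htrap τ hle τ (right_mem_Icc.2 hτ.1)
    have h2 := (abs_le_of_emdenDist_le (by norm_num) h1).1
    rw [IsRadialProfile.exp_emdenShift hf hn0 (by rw [hUτ]; linarith), hUτ] at h2
    have h3 := (abs_le.1 h2).1
    have h4 : 99 / 100 ≤ Real.exp (2 * τ) / (2 * n * tailIntegral f (M + 1)) := by linarith
    rw [le_div_iff₀ (by positivity)] at h4
    have h5 : Real.exp (2 * τ) ≤ Real.exp (2 * S) :=
      Real.exp_le_exp.2 (by linarith [hτ.2, hs.2])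
    have h6 : 0 < n * tailIntegral f (M + 1) := by positivity
    nlinarith
  exact ⟨U, V, hprof S hge, fun s hs => ⟨hge s hs, htrap S hge s hs⟩⟩

/-- Existence of a singular profile, as the limit of the approximate ones: these form a Cauchy
sequence because trajectories of the Emden system attract each other. -/
theorem exists_singular_profile (hf : IsAdmissibleNonlinearity N f) {n : ℝ} (hn : 1 ≤ n) :
    ∃ S U V, IsRadialProfile n f U V (Iio S) ∧ (∀ s < S, 0 < U s) ∧ Tendsto U atBot atTop := by
  have hn0 : 0 < n := by linarith
  obtain ⟨M₁, hM₁, hδ, hδδ⟩ :=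
    hf.exists_expDefect_bounds (show (0 : ℝ) < 1 / 10 ^ 9 by norm_num)
  obtain ⟨M₂, C, hM₂, hC⟩ := hf.exists_mul_tailIntegral_le
  set M := max M₁ M₂ with hMdef
  have hM : 0 < M := hM₁.trans_le (le_max_left _ _)
  have hFM := hf.tailIntegral_pos (show 0 < M + 1 by linarith)
  set S := Real.log (n * tailIntegral f (M + 1)) / 2 with hSdef
  have hS : Real.exp (2 * S) ≤ n * tailIntegral f (M + 1) := by
    rw [hSdef, mul_div_cancel₀ _ (two_ne_zero), Real.exp_log (by positivity)]
  have happ : ∀ k : ℕ, ∃ U V, IsRadialProfile n f U V (Icc (S - k) S) ∧ ∀ s ∈ Icc (S - k) S,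
      M + 1 ≤ U s ∧ emdenDist (emdenShift n f U s) (emdenSlope f U V s) ≤ (1 / 100) ^ 2 :=
    fun k => hf.exists_approximate_profile hn hM
      (fun u hu => hδ u ((le_max_left _ _).trans_lt hu)) hS (by
        linarith [(Nat.cast_nonneg k : (0 : ℝ) ≤ k)])
  choose U V hprof hUV using happ
  have hUpos : ∀ k : ℕ, ∀ s ∈ Icc (S - (k : ℝ)) S, 0 < U k s := fun k s hs => by
    linarith [(hUV k s hs).1]
  have hUM : ∀ k : ℕ, ∀ s ∈ Icc (S - (k : ℝ)) S, M < U k s := fun k s hs => by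
    linarith [(hUV k s hs).1]
  have hsys := fun k => (hprof k).isEmdenSystem hf hn0 (hUpos k)
  have hd : ∀ k : ℕ, ∀ s ∈ Icc (S - (k : ℝ)) S, _ ∧ _ := fun k s hs =>
    abs_le_of_emdenDist_le (show (0 : ℝ) ≤ 1 / 100 by norm_num) (hUV k s hs).2
  have hshift : ∀ k : ℕ, ∀ s ∈ Icc (S - (k : ℝ)) S, |emdenShift n f (U k) s| ≤ 1 / 2 :=
    fun k s hs =>
    abs_le_of_abs_exp_sub_one_le (hd k s hs).1
  have hmem : ∀ s ≤ S, ∀ᶠ k : ℕ in atTop, s ∈ Icc (S - (k : ℝ)) S := by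
    intro s hs
    filter_upwards [eventually_ge_atTop ⌈S - s⌉₊] with k hk
    exact ⟨by linarith [Nat.ceil_le.1 hk], hs⟩
  -- the difference of two approximations, at the start of the shorter one and later
  have hdiff : ∀ j k m : ℕ, j ≤ k → j ≤ m → ∀ s ∈ Icc (S - (j : ℝ)) S,
      (emdenShift n f (U k) s - emdenShift n f (U m) s) ^ 2 +
        (emdenSlope f (U k) (V k) s - emdenSlope f (U m) (V m) s) ^ 2 ≤
      6 * n * Real.exp (-((s - (S - j)) / 6)) * 5 := by
    intro j k m hjk hjm s hs
    have hjk' : (j : ℝ) ≤ k := Nat.cast_le.2 hjk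
    have hjm' : (j : ℝ) ≤ m := Nat.cast_le.2 hjm
    have hk : Icc (S - (j : ℝ)) S ⊆ Icc (S - (k : ℝ)) S := Icc_subset_Icc_left (by linarith)
    have hm : Icc (S - (j : ℝ)) S ⊆ Icc (S - (m : ℝ)) S := Icc_subset_Icc_left (by linarith)
    have hj : S - (j : ℝ) ∈ Icc (S - (j : ℝ)) S :=
      left_mem_Icc.2 (by linarith [(Nat.cast_nonneg j : (0 : ℝ) ≤ j)])
    have h1 := IsEmdenSystem.sq_sub_le (convex_Icc (S - (j : ℝ)) S) hn ((hsys k).mono hk)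
      ((hsys m).mono hm) (fun t ht => (hd k t (hk ht)).1) (fun t ht => (hd m t (hm ht)).1)
      (fun t ht => (hd k t (hk ht)).2) (fun t ht => (hd m t (hm ht)).2)
      (fun t ht => by
        have := hδ _ ((le_max_left _ _).trans_lt (hUM k t (hk ht)))
        rw [abs_of_nonneg this.1]
        exact this.2.trans (by norm_num))
      (fun t ht => by
        have h2 : emdenShift n f (U k) t - emdenShift n f (U m) t =
            -(Real.log (tailIntegral f (U k t)) - Real.log (tailIntegral f (U m t))) := by
          unfold emdenShift; ring
        rw [h2, abs_neg]
        exact hδδ _ _ ((le_max_left _ _).trans_lt (hUM k t (hk ht)))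
          ((le_max_left _ _).trans_lt (hUM m t (hm ht)))) hj hs hs.1
    refine h1.trans (mul_le_mul_of_nonneg_left ?_ (by positivity))
    have a1 := abs_le.1 (hshift k _ (hk hj))
    have a2 := abs_le.1 (hshift m _ (hm hj))
    have a3 := abs_le.1 (hd k _ (hk hj)).2
    have a4 := abs_le.1 (hd m _ (hm hj)).2
    nlinarith [a1.1, a1.2, a2.1, a2.2, a3.1, a3.2, a4.1, a4.2]
  have hsmall : ∀ s, ∀ ε > 0, ∀ᶠ j : ℕ in atTop,
      6 * n * Real.exp (-((s - (S - j)) / 6)) * 5 < ε := by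
    intro s ε hε
    have h1 : Tendsto (fun j : ℕ => 6 * n * Real.exp (-((s - (S - (j : ℝ))) / 6)) * 5) atTop
        (𝓝 (6 * n * 0 * 5)) := by
      refine ((Real.tendsto_exp_atBot.comp ?_).const_mul _).mul_const _
      have h2 : Tendsto (fun j : ℕ => -((s - S) / 6) + -(1 / 6 * (j : ℝ))) atTop atBot :=
        tendsto_atBot_add_const_left _ _ (tendsto_neg_atTop_atBot.comp
          (tendsto_natCast_atTop_atTop.const_mul_atTop (by norm_num)))
      exact h2.congr (fun j => by ring)
    refine h1.eventually_lt_const ?_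
    simpa using hε
  have hcauchy : ∀ s ≤ S, ∀ ε > 0, ∃ j : ℕ, ∀ k ≥ j, ∀ m ≥ j,
      (emdenShift n f (U k) s - emdenShift n f (U m) s) ^ 2 +
        (emdenSlope f (U k) (V k) s - emdenSlope f (U m) (V m) s) ^ 2 < ε ^ 2 := by
    intro s hs ε hε
    obtain ⟨j, hj1, hj2⟩ := ((hsmall s (ε ^ 2) (by positivity)).and (hmem s hs)).exists
    exact ⟨j, fun k hk m hm => (hdiff j k m hk hm s hj2).trans_lt hj1⟩
  have hlim₁ : ∀ s, ∃ x, s ≤ S → Tendsto (fun k => emdenShift n f (U k) s) atTop (𝓝 x) := by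
    intro s
    by_cases hs : s ≤ S
    · have : CauchySeq (fun k => emdenShift n f (U k) s) := by
        refine Metric.cauchySeq_iff.2 fun ε hε => ?_
        obtain ⟨j, hj⟩ := hcauchy s hs ε hε
        exact ⟨j, fun k hk m hm => abs_lt_of_sq_lt_sq
          ((le_add_of_nonneg_right (sq_nonneg _)).trans_lt (hj k hk m hm)) hε.le⟩
      obtain ⟨x, hx⟩ := cauchySeq_tendsto_of_complete this
      exact ⟨x, fun _ => hx⟩
    · exact ⟨0, fun h => absurd h hs⟩
  have hlim₂ : ∀ s, ∃ x, s ≤ S →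
      Tendsto (fun k => emdenSlope f (U k) (V k) s) atTop (𝓝 x) := by
    intro s
    by_cases hs : s ≤ S
    · have : CauchySeq (fun k => emdenSlope f (U k) (V k) s) := by
        refine Metric.cauchySeq_iff.2 fun ε hε => ?_
        obtain ⟨j, hj⟩ := hcauchy s hs ε hε
        exact ⟨j, fun k hk m hm => abs_lt_of_sq_lt_sq
          ((le_add_of_nonneg_left (sq_nonneg _)).trans_lt (hj k hk m hm)) hε.le⟩
      obtain ⟨x, hx⟩ := cauchySeq_tendsto_of_complete this
      exact ⟨x, fun _ => hx⟩
    · exact ⟨0, fun h => absurd h hs⟩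
  choose l hl using hlim₁
  choose p hp using hlim₂
  have hFeq : ∀ k : ℕ, ∀ s ∈ Icc (S - (k : ℝ)) S, tailIntegral f (U k s) =
      Real.exp (2 * s - emdenShift n f (U k) s) / (2 * n) := by
    intro k s hs
    have h1 := hf.tailIntegral_pos (hUpos k s hs)
    rw [Real.exp_sub, IsRadialProfile.exp_emdenShift hf hn0 (hUpos k s hs)]
    have := Real.exp_pos (2 * s)
    field_simp
  have hU₀ : ∀ s, ∃ x, 0 < x ∧ tailIntegral f x = Real.exp (2 * s - l s) / (2 * n) := fun s =>
    hf.bijOn_tailIntegral.surjOn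
      (show Real.exp (2 * s - l s) / (2 * n) ∈ Ioi 0 from mem_Ioi.2 (by positivity))
  choose U₀ hU₀pos hU₀ using hU₀
  have hUlim : ∀ s ≤ S, Tendsto (fun k => U k s) atTop (𝓝 (U₀ s)) := by
    intro s hs
    refine hf.tendsto_of_tendsto_tailIntegral (hU₀pos s) ?_ ?_
    · filter_upwards [hmem s hs] with k hk using hUpos k s hk
    · rw [hU₀]
      have h1 : Tendsto (fun k => Real.exp (2 * s - emdenShift n f (U k) s) / (2 * n)) atTop
          (𝓝 (Real.exp (2 * s - l s) / (2 * n))) :=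
        ((Real.continuous_exp.tendsto _).comp ((hl s hs).const_sub _)).div_const _
      refine h1.congr' ?_
      filter_upwards [hmem s hs] with k hk using (hFeq k s hk).symm
  set G : ℝ → ℝ := fun u => f u * tailIntegral f u with hG
  have hVeq : ∀ k : ℕ, ∀ s ∈ Icc (S - (k : ℝ)) S,
      V k s = -(emdenSlope f (U k) (V k) s + 2) * G (U k s) := by
    intro k s hs
    have h1 := (hf.tailIntegral_pos (hUpos k s hs)).ne'
    have h2 := (hf.pos (hUpos k s hs)).ne'
    simp only [hG]
    unfold emdenSlope
    field_simp
    ring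
  have hGcont : ∀ u, 0 < u → ContinuousAt G u := fun u hu =>
    (hf.hasDerivAt hu).continuousAt.mul (hf.hasDerivAt_tailIntegral hu).continuousAt
  set V₀ : ℝ → ℝ := fun s => -(p s + 2) * G (U₀ s) with hV₀
  have hVlim : ∀ s ≤ S, Tendsto (fun k => V k s) atTop (𝓝 (V₀ s)) := by
    intro s hs
    have h1 : Tendsto (fun k => -(emdenSlope f (U k) (V k) s + 2) * G (U k s)) atTop
        (𝓝 (V₀ s)) :=
      ((hp s hs).add_const 2).neg.mul ((hGcont _ (hU₀pos s)).tendsto.comp (hUlim s hs))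
    refine h1.congr' ?_
    filter_upwards [hmem s hs] with k hk using (hVeq k s hk).symm
  -- bounds that hold uniformly along the approximations
  have hGbd : ∀ k : ℕ, ∀ s ∈ Icc (S - (k : ℝ)) S, 0 < G (U k s) ∧ G (U k s) ≤ C := fun k s hs =>
    ⟨mul_pos (hf.pos (hUpos k s hs)) (hf.tailIntegral_pos (hUpos k s hs)),
      hC _ ((le_max_right _ _).trans_lt (hUM k s hs))⟩
  have hVbd : ∀ k : ℕ, ∀ s ∈ Icc (S - (k : ℝ)) S, |V k s| ≤ 3 * C := by
    intro k s hs
    obtain ⟨h1, h2⟩ := hGbd k s hs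
    obtain ⟨h3, h4⟩ := abs_le.1 (hd k s hs).2
    rw [hVeq k s hs, abs_mul, abs_of_pos h1, abs_neg]
    refine mul_le_mul ?_ h2 h1.le (by norm_num)
    rw [abs_le]
    constructor <;> linarith
  have hV'bd : ∀ k : ℕ, ∀ s ∈ Icc (S - (k : ℝ)) S,
      |-n * V k s - Real.exp (2 * s) * f (U k s)| ≤ n * (3 * C) + 3 * n * C := by
    intro k s hs
    obtain ⟨h1, h2⟩ := hGbd k s hs
    have h3 := (abs_le.1 (hd k s hs).1).2
    have h4 := hf.tailIntegral_pos (hUpos k s hs)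
    have h5 := hf.pos (hUpos k s hs)
    rw [IsRadialProfile.exp_emdenShift hf hn0 (hUpos k s hs)] at h3
    have h6 : Real.exp (2 * s) / (2 * n * tailIntegral f (U k s)) ≤ 3 / 2 := by linarith
    rw [div_le_iff₀ (by positivity)] at h6
    have h7 := mul_le_mul_of_nonneg_right h6 h5.le
    have h8 := mul_le_mul_of_nonneg_left h2 (show 0 ≤ 3 * n by linarith)
    simp only [hG] at h8
    refine (abs_sub _ _).trans (add_le_add ?_ ?_)
    · rw [abs_mul, abs_neg, abs_of_pos hn0]
      exact mul_le_mul_of_nonneg_left (hVbd k s hs) hn0.le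
    · rw [abs_of_pos (by positivity)]
      linarith
  have hcover : ∀ a < S, ∀ᶠ k : ℕ in atTop, Ico a S ⊆ Icc (S - (k : ℝ)) S := by
    intro a ha
    filter_upwards [hmem a ha.le] with k hk
    exact fun t ht => ⟨hk.1.trans ht.1, ht.2.le⟩
  have hUc : ContinuousOn U₀ (Iio S) := by
    refine continuousOn_of_tendsto_of_bounded_deriv (A := U) (B := V) (C := 3 * C)
      (fun a ha => ?_) (fun s hs => hUlim s hs.le)
    filter_upwards [hcover a ha] with k hk s hs
    exact ⟨(hprof k).hasDerivAt s (hk hs), hVbd k s (hk hs)⟩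
  have hVc : ContinuousOn V₀ (Iio S) := by
    refine continuousOn_of_tendsto_of_bounded_deriv (A := V)
      (B := fun k s => -n * V k s - Real.exp (2 * s) * f (U k s)) (C := n * (3 * C) + 3 * n * C)
      (fun a ha => ?_) (fun s hs => hVlim s hs.le)
    filter_upwards [hcover a ha] with k hk s hs
    exact ⟨(hprof k).hasDerivAt_deriv s (hk hs), hV'bd k s (hk hs)⟩
  have hfcont : ∀ u, 0 < u → ContinuousAt f u := fun u hu => (hf.hasDerivAt hu).continuousAt
  refine ⟨S, U₀, V₀, ⟨?_, ?_⟩, fun s _ => hU₀pos s, ?_⟩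
  · refine hasDerivAt_of_tendsto_of_bounded (A := U) (B := V) (C := 3 * C)
      (fun a ha => ?_) (fun s hs => hUlim s hs.le) (fun s hs => hVlim s hs.le) hVc
    filter_upwards [hcover a ha] with k hk s hs
    exact ⟨(hprof k).hasDerivAt s (hk hs), ((hprof k).hasDerivAt_deriv s (hk hs)).continuousAt,
      hVbd k s (hk hs)⟩
  · refine hasDerivAt_of_tendsto_of_bounded (A := V)
      (B := fun k s => -n * V k s - Real.exp (2 * s) * f (U k s)) (C := n * (3 * C) + 3 * n * C)
      (fun a ha => ?_) (fun s hs => hVlim s hs.le) (fun s hs => ?_) ?_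
    · filter_upwards [hcover a ha] with k hk s hs
      refine ⟨(hprof k).hasDerivAt_deriv s (hk hs), ?_, hV'bd k s (hk hs)⟩
      have h1 := ((hprof k).hasDerivAt_deriv s (hk hs)).continuousAt
      have h2 := (hfcont _ (hUpos k s (hk hs))).comp
        ((hprof k).hasDerivAt s (hk hs)).continuousAt
      exact (continuousAt_const.mul h1).sub
        ((Real.continuous_exp.comp (continuous_const.mul continuous_id)).continuousAt.mul h2)
    · exact ((hVlim s hs.le).const_mul (-n)).sub
        (((hfcont _ (hU₀pos s)).tendsto.comp (hUlim s hs.le)).const_mul _)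
    · intro s hs
      have h2 : ContinuousWithinAt (fun s => f (U₀ s)) (Iio S) s :=
        (hfcont _ (hU₀pos s)).comp_continuousWithinAt (hUc s hs)
      exact (continuousWithinAt_const.mul (hVc s hs)).sub
        ((Real.continuous_exp.comp (continuous_const.mul continuous_id)).continuousWithinAt.mul h2)
  · have hl2 : ∀ s ≤ S, |l s| ≤ 1 / 2 := fun s hs =>
      le_of_tendsto (hl s hs).abs (by
        filter_upwards [hmem s hs] with k hk using hshift k s hk)
    refine Filter.tendsto_atTop.2 fun b => ?_
    have hb : (0 : ℝ) < max b 1 := lt_max_of_lt_right one_pos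
    have hlim : Tendsto (fun s : ℝ => Real.exp (2 * s + 1 / 2) / (2 * n)) atBot
        (𝓝 (0 / (2 * n))) :=
      (Real.tendsto_exp_atBot.comp (tendsto_atBot_add_const_right _ _
        (tendsto_id.const_mul_atBot two_pos))).div_const _
    rw [zero_div] at hlim
    filter_upwards [hlim.eventually_le_const (hf.tailIntegral_pos hb), eventually_le_atBot S]
      with s hs1 hs2
    refine (le_max_left b 1).trans
      ((hf.strictAntiOn_tailIntegral.le_iff_ge (hU₀pos s) hb).1 (le_trans ?_ hs1))
    rw [hU₀]
    have := (abs_le.1 (hl2 s hs2)).1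
    exact div_le_div_of_nonneg_right (Real.exp_le_exp.2 (by linarith)) (by positivity)

end IsAdmissibleNonlinearity

/-! ### Global positivity and uniqueness -/

lemma hasDerivAt_ite_le {a b : ℝ → ℝ} {T c : ℝ} (hT : a T = b T) (ha : HasDerivAt a c T)
    (hb : HasDerivAt b c T) : HasDerivAt (fun s => if s ≤ T then a s else b s) c T := by
  have h1 : HasDerivWithinAt (fun s => if s ≤ T then a s else b s) c (Iic T) T :=
    ha.hasDerivWithinAt.congr (fun s hs => if_pos hs) (if_pos le_rfl)
  have h2 : HasDerivWithinAt (fun s => if s ≤ T then a s else b s) c (Ici T) T := by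
    refine hb.hasDerivWithinAt.congr (fun s hs => ?_) (by simp [hT])
    rcases (show T ≤ s from hs).eq_or_lt with rfl | h
    · simp [hT]
    · exact if_neg (not_le.2 h)
  have h3 := h1.union h2
  rwa [Iic_union_Ici, hasDerivWithinAt_univ] at h3

namespace IsRadialProfile

variable {N : ℕ} {n S : ℝ} {f U V : ℝ → ℝ} {I : Set ℝ}

/-- The logarithmic derivative `V` of a singular profile is bounded near the singularity, so
that `U` grows at most linearly as `s → -∞`. -/
lemma exists_bounds (h : IsRadialProfile n f U V (Iic S)) (hf : IsAdmissibleNonlinearity N f)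
    (hn : 1 ≤ n) (hsing : Tendsto U atBot atTop) :
    ∃ T C, T ≤ S ∧ 0 ≤ C ∧ ∀ s ≤ T, |V s| ≤ C ∧ 0 < U s ∧ U s ≤ U T + C * (T - s) := by
  obtain ⟨M, C, hM, hC⟩ := hf.exists_mul_tailIntegral_le
  obtain ⟨T, hT⟩ := eventually_atBot.1 (((hsing.eventually_gt_atTop M).and
    (eventually_le_atBot S)).and (h.eventually_emdenDist_lt hf hn hsing
      (show (0 : ℝ) < 1 ^ 2 by norm_num)))
  have hpos : ∀ s ≤ T, 0 < U s := fun s hs => hM.trans (hT s hs).1.1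
  have hV : ∀ s ≤ T, |V s| ≤ 3 * C := by
    intro s hs
    have h1 := mul_pos (hf.pos (hpos s hs)) (hf.tailIntegral_pos (hpos s hs))
    have h2 := hC _ (hT s hs).1.1
    obtain ⟨h3, h4⟩ := abs_le.1 (abs_le_of_emdenDist_le zero_le_one (hT s hs).2.le).2
    have h5 : V s = -(emdenSlope f U V s + 2) * (f (U s) * tailIntegral f (U s)) := by
      have e1 := (hf.pos (hpos s hs)).ne'
      have e2 := (hf.tailIntegral_pos (hpos s hs)).ne'
      unfold emdenSlope
      field_simp
      ring
    rw [h5, abs_mul, abs_of_pos h1, abs_neg]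
    refine mul_le_mul ?_ h2 h1.le (by norm_num)
    rw [abs_le]
    constructor <;> linarith
  refine ⟨T, 3 * C, (hT T le_rfl).1.2, (abs_nonneg _).trans (hV T le_rfl), fun s hs =>
    ⟨hV s hs, hpos s hs, ?_⟩⟩
  have h1 := (convex_Iic T).norm_image_sub_le_of_norm_hasDerivWithin_le
    (fun t ht => (h.hasDerivAt t (hT t ht).1.2).hasDerivWithinAt) (fun t ht => hV t ht)
    (mem_Iic.2 le_rfl) (mem_Iic.2 hs)
  rw [Real.norm_eq_abs, Real.norm_eq_abs, abs_of_nonpos (show s - T ≤ 0 by linarith)] at h1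
  have := le_abs_self (U s - U T)
  linarith

/-- **Pohozaev identity**. For supercritical `f` the Pohozaev functional
`e^{ns} (V² / 2 + n U V / 2) + e^{(n+2)s} ∫₀^U f` is nonincreasing. It vanishes at the
singularity, so it is nonpositive, which bounds the logarithmic slope. -/
theorem neg_deriv_le (h : IsRadialProfile n f U V (Iic S)) (hf : IsAdmissibleNonlinearity N f)
    (hN : (N : ℝ) = n + 2) (hn : 1 ≤ n) (hU : ∀ s ≤ S, 0 < U s)
    (hsing : Tendsto U atBot atTop) : ∀ s ≤ S, -V s ≤ n * U s := by
  have hn0 : 0 < n := by linarith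
  have hVneg := h.deriv_neg hf (fun s hs => (hU s hs).le) hsing
  set Φ : ℝ → ℝ := fun u => ∫ t in (0 : ℝ)..u, f t with hΦ
  have hΦd : ∀ u, 0 < u → HasDerivAt Φ (f u) u := by
    intro u hu
    refine intervalIntegral.integral_hasDerivAt_right ?_ ?_ (hf.hasDerivAt hu).continuousAt
    · refine (hf.continuousOn.mono ?_).intervalIntegrable
      rw [uIcc_of_le hu.le]
      exact fun t ht => ht.1
    · exact (hf.continuousOn.mono Ioi_subset_Ici_self).stronglyMeasurableAtFilter isOpen_Ioi u hu
  have hΦ0 : ∀ u, 0 ≤ u → 0 ≤ Φ u := fun u hu =>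
    intervalIntegral.integral_nonneg hu fun t ht => hf.nonneg ht.1
  have hsup : ∀ u, 0 ≤ u → (n + 2) * Φ u ≤ n / 2 * (u * f u) := by
    intro u hu
    have h1 := hf.supercritical u hu
    have h2 : sobolevExponent N + 1 = 2 * (n + 2) / n := by
      unfold sobolevExponent
      rw [hN, show n + 2 - 2 = n by ring]
      field_simp
      ring
    rw [h2] at h1
    have h3 : 2 * (n + 2) / n * Φ u ≤ u * f u := by linarith
    rw [div_mul_eq_mul_div, div_le_iff₀ hn0] at h3
    linarith
  set H : ℝ → ℝ := fun s => V s ^ 2 / 2 + n / 2 * (U s * V s) + Real.exp (2 * s) * Φ (U s) with hH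
  have hanti : AntitoneOn (fun s => H s * Real.exp (n * s)) (Iic S) := by
    refine antitoneOn_mul_exp (convex_Iic S) (fun s hs =>
      ((((h.hasDerivAt_deriv s hs).fun_pow 2).div_const 2).add
        (((h.hasDerivAt s hs).mul (h.hasDerivAt_deriv s hs)).const_mul (n / 2))).add
        ((hasDerivAt_exp_two_mul s).mul ((hΦd _ (hU s hs)).comp s (h.hasDerivAt s hs))))
      (fun s hs => ?_)
    have h1 := mul_le_mul_of_nonneg_left (hsup (U s) (hU s hs).le) (Real.exp_pos (2 * s)).le
    simp only [hH]
    norm_num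
    nlinarith
  obtain ⟨T, C, hTS, hC0, hT⟩ := h.exists_bounds hf hn hsing
  have hle := h.exp_mul_le hf hn0 hU hsing
  have hbound : ∀ s ≤ T, H s ≤ C ^ 2 / 2 + (n + 2) * C * (U T + C * (T - s)) := by
    intro s hs
    obtain ⟨h1, h2, h3⟩ := hT s hs
    have e1 : V s ^ 2 ≤ C ^ 2 := sq_le_sq' (by linarith [(abs_le.1 h1).1]) (abs_le.1 h1).2
    have e2 : U s * V s ≤ 0 :=
      mul_nonpos_of_nonneg_of_nonpos h2.le (hVneg s (hs.trans hTS)).le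
    have e3 : Φ (U s) ≤ U s * f (U s) := by
      have := hsup (U s) h2.le
      have h5 := hΦ0 (U s) h2.le
      have h6 : 0 ≤ U s * f (U s) := mul_nonneg h2.le (hf.pos h2).le
      by_contra! hlt
      nlinarith
    have e4 : Real.exp (2 * s) * Φ (U s) ≤ (n + 2) * C * (U T + C * (T - s)) := by
      have e5 := hle s (hs.trans hTS)
      have e6 : -(n + 2) * V s ≤ (n + 2) * C := by
        have := (abs_le.1 h1).1
        nlinarith
      calc Real.exp (2 * s) * Φ (U s) ≤ Real.exp (2 * s) * (U s * f (U s)) :=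
            mul_le_mul_of_nonneg_left e3 (Real.exp_pos _).le
        _ = Real.exp (2 * s) * f (U s) * U s := by ring
        _ ≤ (n + 2) * C * U s := mul_le_mul_of_nonneg_right (e5.trans e6) h2.le
        _ ≤ _ := mul_le_mul_of_nonneg_left h3 (by positivity)
    have e7 : n / 2 * (U s * V s) ≤ 0 := mul_nonpos_of_nonneg_of_nonpos (by linarith) e2
    simp only [hH]
    linarith
  have hlim : Tendsto (fun s => (C ^ 2 / 2 + (n + 2) * C * (U T + C * (T - s))) *
      Real.exp (n * s)) atBot (𝓝 0) := by
    have h1 : Tendsto (fun s : ℝ => Real.exp (n * s)) atBot (𝓝 0) :=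
      Real.tendsto_exp_atBot.comp (tendsto_id.const_mul_atBot hn0)
    have h2 : Tendsto (fun s : ℝ => s * Real.exp (n * s)) atBot (𝓝 0) := by
      have h3 : Tendsto (fun t : ℝ => -(t ^ 1 * Real.exp (-n * t))) atTop (𝓝 (-0)) :=
        ((isLittleO_pow_exp_pos_mul_atTop 1 hn0).tendsto_div_nhds_zero.congr
          (fun t => by rw [neg_mul, Real.exp_neg, div_eq_mul_inv])).neg
      rw [neg_zero] at h3
      exact (h3.comp tendsto_neg_atBot_atTop).congr (fun s => by simp)
    have h4 := (h1.const_mul (C ^ 2 / 2 + (n + 2) * C * (U T + C * T))).sub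
      (h2.const_mul ((n + 2) * C * C))
    rw [mul_zero, mul_zero, sub_zero] at h4
    exact h4.congr (fun s => by ring)
  intro s hs
  have h1 : H s * Real.exp (n * s) ≤ 0 := by
    refine ge_of_tendsto hlim ?_
    filter_upwards [eventually_le_atBot s, eventually_le_atBot T] with t ht htT
    exact (hanti (mem_Iic.2 (ht.trans hs)) (mem_Iic.2 hs) ht).trans
      (mul_le_mul_of_nonneg_right (hbound t htT) (Real.exp_pos _).le)
  have h2 : H s ≤ 0 := nonpos_of_mul_nonpos_left h1 (Real.exp_pos _)
  have h3 := mul_nonneg (Real.exp_pos (2 * s)).le (hΦ0 _ (hU s hs).le)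
  have h4 := hVneg s hs
  simp only [hH] at h2
  by_contra! hlt
  nlinarith

/-- Singular profiles on the whole line are unique. -/
theorem eq_of_singular {U₁ V₁ U₂ V₂ : ℝ → ℝ} (h₁ : IsRadialProfile n f U₁ V₁ univ)
    (h₂ : IsRadialProfile n f U₂ V₂ univ) (hf : IsAdmissibleNonlinearity N f) (hn : 1 ≤ n)
    (hU₁ : ∀ s, 0 ≤ U₁ s) (hU₂ : ∀ s, 0 ≤ U₂ s)
    (hsing₁ : Tendsto U₁ atBot atTop) (hsing₂ : Tendsto U₂ atBot atTop) : U₁ = U₂ := by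
  have h₁' := fun S => h₁.mono (subset_univ (Iic S))
  have h₂' := fun S => h₂.mono (subset_univ (Iic S))
  obtain ⟨T, hT⟩ := eventually_atBot.1 ((h₁' 0).eventually_eq (h₂' 0) hf hn hsing₁ hsing₂)
  have hanti₁ : Antitone U₁ := antitone_of_hasDerivAt_nonpos (fun s => h₁.hasDerivAt s (mem_univ s))
    (fun s => ((h₁' s).deriv_neg hf (fun t _ => hU₁ t) hsing₁ s le_rfl).le)
  have hanti₂ : Antitone U₂ := antitone_of_hasDerivAt_nonpos (fun s => h₂.hasDerivAt s (mem_univ s))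
    (fun s => ((h₂' s).deriv_neg hf (fun t _ => hU₂ t) hsing₂ s le_rfl).le)
  funext s
  set b := max s T + 1 with hb
  have hsb : s ≤ b := by linarith [le_max_left s T]
  have hTb : T < b := by linarith [le_max_right s T]
  rcases le_or_gt s (T - 1) with hs | hs
  · exact (hT s (by linarith)).1
  obtain ⟨K, hK⟩ := hf.exists_lipschitzOnWith (U₁ (T - 1))
  set φ : ℝ → ℝ × ℝ → ℝ × ℝ := fun t x => (x.2, -n * x.2 - Real.exp (2 * t) * f x.1) with hφ
  set L : ℝ := 1 + n + Real.exp (2 * b) * K with hL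
  have hL0 : 0 ≤ L := by positivity
  have hlip : ∀ t ∈ Ioo (T - 1) b, LipschitzOnWith L.toNNReal (φ t)
      (Prod.fst ⁻¹' Icc 0 (U₁ (T - 1))) := by
    intro t ht
    refine LipschitzOnWith.of_dist_le_mul fun x hx y hy => ?_
    rw [Real.coe_toNNReal _ hL0, Prod.dist_eq, max_le_iff]
    have d1 : |x.1 - y.1| ≤ dist x y := by rw [← Real.dist_eq]; exact le_max_left _ _
    have d2 : |x.2 - y.2| ≤ dist x y := by rw [← Real.dist_eq]; exact le_max_right _ _
    have d3 : |f x.1 - f y.1| ≤ K * |x.1 - y.1| := by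
      have := hK.dist_le_mul x.1 hx y.1 hy
      rwa [Real.dist_eq, Real.dist_eq] at this
    have d0 : 0 ≤ dist x y := dist_nonneg
    have d4 : |f x.1 - f y.1| ≤ K * dist x y := d3.trans (mul_le_mul_of_nonneg_left d1 K.2)
    have d5 : Real.exp (2 * t) ≤ Real.exp (2 * b) := Real.exp_le_exp.2 (by linarith [ht.2])
    have d6 : Real.exp (2 * t) * |f x.1 - f y.1| ≤ Real.exp (2 * b) * (K * dist x y) :=
      mul_le_mul d5 d4 (abs_nonneg _) (Real.exp_pos _).le
    have d7 : 0 ≤ Real.exp (2 * b) * (K * dist x y) :=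
      mul_nonneg (Real.exp_pos _).le (mul_nonneg K.2 d0)
    have d8 : n * |x.2 - y.2| ≤ n * dist x y := mul_le_mul_of_nonneg_left d2 (by linarith)
    have d9 : 0 ≤ n * dist x y := mul_nonneg (by linarith) d0
    have hLd : L * dist x y = dist x y + n * dist x y + Real.exp (2 * b) * (K * dist x y) := by
      rw [hL]; ring
    rw [Real.dist_eq, Real.dist_eq, hLd]
    simp only [hφ]
    constructor
    · linarith
    · have e1 : -n * x.2 - Real.exp (2 * t) * f x.1 - (-n * y.2 - Real.exp (2 * t) * f y.1) =
        -n * (x.2 - y.2) - Real.exp (2 * t) * (f x.1 - f y.1) := by ring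
      rw [e1]
      refine (abs_sub _ _).trans ?_
      rw [abs_mul, abs_mul, abs_neg, abs_of_pos (show 0 < n by linarith),
        abs_of_pos (Real.exp_pos _)]
      linarith
  have hder : ∀ {U V : ℝ → ℝ}, IsRadialProfile n f U V univ → ∀ t,
      HasDerivAt (fun t => (U t, V t)) (φ t (U t, V t)) t := fun h t =>
    (h.hasDerivAt t (mem_univ t)).prodMk (h.hasDerivAt_deriv t (mem_univ t))
  have heq := ODE_solution_unique_of_mem_Icc hlip (t₀ := T) ⟨by linarith, hTb⟩
    (fun t _ => (hder h₁ t).continuousAt.continuousWithinAt) (fun t _ => hder h₁ t)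
    (fun t ht => ⟨hU₁ t, hanti₁ ht.1.le⟩)
    (fun t _ => (hder h₂ t).continuousAt.continuousWithinAt) (fun t _ => hder h₂ t)
    (fun t ht => ⟨hU₂ t, (hanti₂ ht.1.le).trans (hT (T - 1) (by linarith)).1.ge⟩)
    (by rw [(hT T le_rfl).1, (hT T le_rfl).2])
  exact congrArg Prod.fst (heq ⟨hs.le, hsb⟩)

end IsRadialProfile

/-- Existence of a positive singular profile on the whole line. -/
theorem IsAdmissibleNonlinearity.exists_singular_profile_univ {N : ℕ} {f : ℝ → ℝ} {n : ℝ}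
    (hf : IsAdmissibleNonlinearity N f) (hN : (N : ℝ) = n + 2) (hn : 1 ≤ n) :
    ∃ U V, IsRadialProfile n f U V univ ∧ (∀ s, 0 < U s) ∧ Tendsto U atBot atTop := by
  have hn0 : 0 < n := by linarith
  obtain ⟨S, U₁, V₁, h₁, hpos₁, hsing₁⟩ := hf.exists_singular_profile hn
  set T := S - 1 with hT
  have hTS : T < S := by linarith
  have h₁T : IsRadialProfile n f U₁ V₁ (Iic T) := h₁.mono (fun s hs => lt_of_le_of_lt hs hTS)
  have hVneg := h₁T.deriv_neg hf (fun s hs => (hpos₁ s (hs.trans_lt hTS)).le) hsing₁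
  obtain ⟨U₂, V₂, hU₂, hV₂, h₂, _⟩ := hf.exists_isRadialProfile_Ici hn0 (s₀ := T)
    (hpos₁ T hTS).le (hVneg T le_rfl).le
  set U : ℝ → ℝ := fun s => if s ≤ T then U₁ s else U₂ s with hUdef
  set V : ℝ → ℝ := fun s => if s ≤ T then V₁ s else V₂ s with hVdef
  have hUle : ∀ s ≤ T, U s = U₁ s := fun s hs => if_pos hs
  have hVle : ∀ s ≤ T, V s = V₁ s := fun s hs => if_pos hs
  have hle : ∀ s, s < T → (∀ᶠ t in 𝓝 s, t ≤ T) := fun s hs => by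
    filter_upwards [Iio_mem_nhds hs] with t ht using le_of_lt ht
  have hgt : ∀ s, T < s → (∀ᶠ t in 𝓝 s, ¬ t ≤ T) := fun s hs => by
    filter_upwards [Ioi_mem_nhds hs] with t ht using not_le.2 ht
  have hglue : IsRadialProfile n (fun u => f (max u 0)) U V univ := by
    have h₁max : ∀ s ≤ T, f (max (U₁ s) 0) = f (U₁ s) := fun s hs => by
      rw [max_eq_left (hpos₁ s (hs.trans_lt hTS)).le]
    constructor
    · intro s _
      rcases lt_trichotomy s T with hs | rfl | hs
      · rw [hVle s hs.le]
        refine (h₁T.hasDerivAt s hs.le).congr_of_eventuallyEq ?_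
        filter_upwards [hle s hs] with t ht using if_pos ht
      · rw [hVle _ le_rfl]
        exact hasDerivAt_ite_le hU₂.symm (h₁T.hasDerivAt _ (mem_Iic.2 le_rfl))
          (hV₂ ▸ h₂.hasDerivAt _ (mem_Ici.2 le_rfl))
      · have : V s = V₂ s := if_neg (not_le.2 hs)
        rw [this]
        refine (h₂.hasDerivAt s hs.le).congr_of_eventuallyEq ?_
        filter_upwards [hgt s hs] with t ht using if_neg ht
    · intro s _
      rcases lt_trichotomy s T with hs | rfl | hs
      · rw [hVle s hs.le, hUle s hs.le, h₁max s hs.le]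
        refine (h₁T.hasDerivAt_deriv s hs.le).congr_of_eventuallyEq ?_
        filter_upwards [hle s hs] with t ht using if_pos ht
      · rw [hVle _ le_rfl, hUle _ le_rfl, h₁max _ le_rfl]
        have e2 := h₂.hasDerivAt_deriv _ (mem_Ici.2 le_rfl)
        rw [hV₂, hU₂, h₁max _ le_rfl] at e2
        exact hasDerivAt_ite_le hV₂.symm (h₁T.hasDerivAt_deriv _ (mem_Iic.2 le_rfl)) e2
      · have e1 : V s = V₂ s := if_neg (not_le.2 hs)
        have e2 : U s = U₂ s := if_neg (not_le.2 hs)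
        rw [e1, e2]
        refine (h₂.hasDerivAt_deriv s hs.le).congr_of_eventuallyEq ?_
        filter_upwards [hgt s hs] with t ht using if_neg ht
  have hsing : Tendsto U atBot atTop := hsing₁.congr' (by
    filter_upwards [eventually_le_atBot T] with s hs using (hUle s hs).symm)
  have hVanti : AntitoneOn (fun s => V s * Real.exp (n * s)) univ := by
    refine antitoneOn_mul_exp convex_univ hglue.hasDerivAt_deriv (fun s _ => ?_)
    have := mul_nonneg (Real.exp_pos (2 * s)).le (hf.nonneg (le_max_right (U s) 0))
    linarith
  have hV : ∀ s, V s < 0 := by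
    intro s
    rcases le_or_gt s T with hs | hs
    · rw [hVle s hs]; exact hVneg s hs
    · have e1 := hVanti (mem_univ T) (mem_univ s) hs.le
      have e2 := mul_neg_of_neg_of_pos (hVneg T le_rfl) (Real.exp_pos (n * T))
      simp only [hVle T le_rfl] at e1
      by_contra! hge
      have := mul_nonneg hge (Real.exp_pos (n * s)).le
      linarith
  have hanti : StrictAnti U := strictAnti_of_hasDerivAt_neg
    (fun s => hglue.hasDerivAt s (mem_univ s)) hV
  have hcontU : Continuous U :=
    continuous_iff_continuousAt.2 fun s => (hglue.hasDerivAt s (mem_univ s)).continuousAt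
  have hprof : ∀ I : Set ℝ, (∀ s ∈ I, 0 ≤ U s) → IsRadialProfile n f U V I := by
    intro I hI
    refine ⟨fun s _ => hglue.hasDerivAt s (mem_univ s), fun s hs => ?_⟩
    have := hglue.hasDerivAt_deriv s (mem_univ s)
    rwa [max_eq_left (hI s hs)] at this
  have hpos : ∀ s, 0 < U s := by
    intro s₁
    by_contra! hle₁
    have hTs : T ≤ s₁ := by
      by_contra! hlt
      rw [hUle s₁ hlt.le] at hle₁
      exact absurd (hpos₁ s₁ (hlt.trans hTS)) (not_lt.2 hle₁)
    obtain ⟨s₀, _, hs₀⟩ := intermediate_value_Icc' hTs hcontU.continuousOn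
      ⟨hle₁, (hUle T le_rfl).symm ▸ (hpos₁ T hTS).le⟩
    -- at a first zero `s₀` the slope bound `-V ≤ n U` would force `V = 0`
    have hbd : ∀ s < s₀, -V s ≤ n * U s := by
      intro s hs
      have hU : ∀ t ≤ s, 0 < U t := fun t ht => hs₀ ▸ hanti (ht.trans_lt hs)
      exact (hprof (Iic s) (fun t ht => (hU t ht).le)).neg_deriv_le hf hN hn hU hsing s le_rfl
    have hVc : ContinuousAt V s₀ := (hglue.hasDerivAt_deriv s₀ (mem_univ s₀)).continuousAt
    have e1 : -V s₀ ≤ n * U s₀ := by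
      refine le_of_tendsto_of_tendsto
        (hVc.neg.tendsto.mono_left (nhdsWithin_le_nhds (s := Iio s₀)))
        ((hcontU.continuousAt.const_mul n).tendsto.mono_left nhdsWithin_le_nhds) ?_
      filter_upwards [self_mem_nhdsWithin] with s hs using hbd s hs
    rw [hs₀, mul_zero] at e1
    linarith [hV s₀]
  exact ⟨U, V, hprof univ (fun s _ => (hpos s).le), hpos, hsing⟩

/-! ### Radial functions and the Laplacian -/

section Radial

variable {N : ℕ}

lemma hasFDerivAt_comp_log_norm {U : ℝ → ℝ} {c : ℝ} {x : EuclideanSpace ℝ (Fin N)} (hx : x ≠ 0)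
    (hU : HasDerivAt U c (Real.log ‖x‖)) :
    HasFDerivAt (fun y : EuclideanSpace ℝ (Fin N) => U (Real.log ‖y‖))
      ((c / ‖x‖ ^ 2) • innerSL ℝ x) x := by
  have hx0 : 0 < ‖x‖ := norm_pos_iff.2 hx
  have h1 : HasFDerivAt (fun y : EuclideanSpace ℝ (Fin N) => Real.log (‖y‖ ^ 2) / 2)
      ((1 / ‖x‖ ^ 2) • innerSL ℝ x) x := by
    have h2 := (((hasStrictFDerivAt_norm_sq x).hasFDerivAt.log (by positivity)).mul_const (1 / 2))
    refine (h2.congr_of_eventuallyEq (Eventually.of_forall fun y => by ring)).congr_fderiv ?_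
    ext m
    simp
    ring
  have h3 : (fun y : EuclideanSpace ℝ (Fin N) => Real.log (‖y‖ ^ 2) / 2) =
      fun y => Real.log ‖y‖ := by
    funext y
    rw [Real.log_pow]
    push_cast
    ring
  rw [h3] at h1
  refine (hU.comp_hasFDerivAt x h1).congr_fderiv ?_
  ext m
  simp
  ring

/-- The Laplacian of a radial function in logarithmic polar coordinates. -/
theorem laplacian_comp_log_norm {U V V' : ℝ → ℝ} (hU : ∀ s, HasDerivAt U (V s) s)
    (hV : ∀ s, HasDerivAt V (V' s) s) {x : EuclideanSpace ℝ (Fin N)} (hx : x ≠ 0) :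
    Laplacian.laplacian (fun y : EuclideanSpace ℝ (Fin N) => U (Real.log ‖y‖)) x =
      (V' (Real.log ‖x‖) + ((N : ℝ) - 2) * V (Real.log ‖x‖)) / ‖x‖ ^ 2 := by
  have hx0 : 0 < ‖x‖ := norm_pos_iff.2 hx
  set u : EuclideanSpace ℝ (Fin N) → ℝ := fun y => U (Real.log ‖y‖) with hu
  -- `V(s) e^{-2s}` at `s = log ‖y‖` is the factor in front of `⟪y, ·⟫` in the first derivative
  have hfd : fderiv ℝ u =ᶠ[𝓝 x]
      fun y => (V (Real.log ‖y‖) * Real.exp (-2 * Real.log ‖y‖)) • innerSL ℝ y := by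
    filter_upwards [isOpen_ne.mem_nhds hx] with y hy
    rw [(hasFDerivAt_comp_log_norm hy (hU _)).fderiv]
    have : Real.exp (-2 * Real.log ‖y‖) = (‖y‖ ^ 2)⁻¹ := by
      rw [neg_mul, Real.exp_neg, mul_comm, Real.exp_mul, Real.exp_log (norm_pos_iff.2 hy)]
      norm_num
    rw [this, div_eq_mul_inv]
  have hc : HasFDerivAt (fun y : EuclideanSpace ℝ (Fin N) =>
      V (Real.log ‖y‖) * Real.exp (-2 * Real.log ‖y‖)) _ x :=
    hasFDerivAt_comp_log_norm (U := fun s => V s * Real.exp (-2 * s)) hx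
      (hasDerivAt_mul_exp (hV _))
  have hsnd := (hc.smul (innerSL ℝ (E := EuclideanSpace ℝ (Fin N))).hasFDerivAt
    ).congr_of_eventuallyEq
    hfd
  have hexp : Real.exp (-2 * Real.log ‖x‖) = (‖x‖ ^ 2)⁻¹ := by
    rw [neg_mul, Real.exp_neg, mul_comm, Real.exp_mul, Real.exp_log hx0]
    norm_num
  rw [InnerProductSpace.laplacian_eq_iteratedFDeriv_orthonormalBasis u
    (EuclideanSpace.basisFun (Fin N) ℝ)]
  have hterm : ∀ i : Fin N, iteratedFDeriv ℝ 2 u x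
      ![EuclideanSpace.basisFun (Fin N) ℝ i, EuclideanSpace.basisFun (Fin N) ℝ i] =
      V (Real.log ‖x‖) * (‖x‖ ^ 2)⁻¹ + (V' (Real.log ‖x‖) - 2 * V (Real.log ‖x‖)) *
        (‖x‖ ^ 2)⁻¹ / ‖x‖ ^ 2 * x i ^ 2 := by
    intro i
    rw [iteratedFDeriv_two_apply, hsnd.fderiv, hexp]
    change V (Real.log ‖x‖) * (‖x‖ ^ 2)⁻¹ * inner ℝ (EuclideanSpace.basisFun (Fin N) ℝ i)
      (EuclideanSpace.basisFun (Fin N) ℝ i) + ((V' (Real.log ‖x‖) + -2 * V (Real.log ‖x‖)) *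
        (‖x‖ ^ 2)⁻¹ / ‖x‖ ^ 2 * inner ℝ x (EuclideanSpace.basisFun (Fin N) ℝ i)) *
        inner ℝ x (EuclideanSpace.basisFun (Fin N) ℝ i) = _
    rw [EuclideanSpace.basisFun_apply, EuclideanSpace.inner_single_right,
      EuclideanSpace.inner_single_right]
    simp
    ring
  simp only [hterm]
  rw [Finset.sum_add_distrib, Finset.sum_const, ← Finset.mul_sum,
    ← EuclideanSpace.real_norm_sq_eq, Finset.card_univ, Fintype.card_fin, nsmul_eq_mul]
  field_simp
  ring

/-- A positive profile defined on the whole line and singular at `-∞` gives a singular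
solution. -/
theorem IsRadialProfile.isSingularSolution {f U V : ℝ → ℝ}
    (h : IsRadialProfile ((N : ℝ) - 2) f U V univ) (hf : IsAdmissibleNonlinearity N f)
    (hU : ∀ s, 0 < U s) (hsing : Tendsto U atBot atTop) :
    IsSingularSolution N f (fun x => U (Real.log ‖x‖)) := by
  have hUd : ∀ s, HasDerivAt U (V s) s := fun s => h.hasDerivAt s (mem_univ s)
  have hVd : ∀ s, HasDerivAt V (-((N : ℝ) - 2) * V s - Real.exp (2 * s) * f (U s)) s :=
    fun s => h.hasDerivAt_deriv s (mem_univ s)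
  have hUc : Continuous U := continuous_iff_continuousAt.2 fun s => (hUd s).continuousAt
  have hVc : Continuous V := continuous_iff_continuousAt.2 fun s => (hVd s).continuousAt
  have hfU : Continuous fun s => f (U s) := continuous_iff_continuousAt.2 fun s =>
    ContinuousAt.comp (hf.hasDerivAt (hU s)).continuousAt hUc.continuousAt
  have hV1 : ContDiff ℝ 1 V := by
    rw [contDiff_one_iff_deriv]
    refine ⟨fun s => (hVd s).differentiableAt, ?_⟩
    have : deriv V = fun s => -((N : ℝ) - 2) * V s - Real.exp (2 * s) * f (U s) :=
      funext fun s => (hVd s).deriv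
    rw [this]
    exact (continuous_const.mul hVc).sub
      ((Real.continuous_exp.comp (continuous_const.mul continuous_id)).mul hfU)
  have hU2 : ContDiff ℝ 2 U := by
    have h2 : ContDiff ℝ (1 + 1) U := by
      rw [contDiff_succ_iff_deriv]
      refine ⟨fun s => (hUd s).differentiableAt, by simp, ?_⟩
      have : deriv U = V := funext fun s => (hUd s).deriv
      rwa [this]
    norm_num at h2
    exact h2
  refine ⟨?_, fun x hx => ?_, fun x _ => (hU _).le, fun x y _ _ hxy => by simp only [hxy], ?_⟩
  · refine hU2.comp_contDiffOn fun x hx => ?_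
    have hx : x ≠ 0 := hx
    exact ((contDiffAt_norm ℝ hx).log (norm_ne_zero_iff.2 hx)).contDiffWithinAt
  · have hx0 : 0 < ‖x‖ := norm_pos_iff.2 hx
    rw [laplacian_comp_log_norm hUd hVd hx, mul_comm (2 : ℝ), Real.exp_mul, Real.exp_log hx0,
      Real.rpow_ofNat]
    field_simp
    ring
  · exact hsing.comp (Real.tendsto_log_nhdsGT_zero.comp tendsto_norm_nhdsNE_zero)

/-- Conversely, every singular solution comes from a profile. -/
theorem IsSingularSolution.exists_profile {f : ℝ → ℝ} {u : EuclideanSpace ℝ (Fin N) → ℝ}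
    (h : IsSingularSolution N f u) (hN : 0 < N) :
    ∃ U V, IsRadialProfile ((N : ℝ) - 2) f U V univ ∧ (∀ s, 0 ≤ U s) ∧
      Tendsto U atBot atTop ∧ ∀ x ≠ 0, u x = U (Real.log ‖x‖) := by
  set e : EuclideanSpace ℝ (Fin N) := EuclideanSpace.single ⟨0, hN⟩ 1 with he
  have hnorm : ∀ s : ℝ, ‖Real.exp s • e‖ = Real.exp s := by
    intro s
    rw [norm_smul, Real.norm_of_nonneg (Real.exp_pos s).le]
    simp [he]
  have hne : ∀ s : ℝ, Real.exp s • e ≠ 0 := fun s => by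
    rw [← norm_ne_zero_iff, hnorm]; exact (Real.exp_pos s).ne'
  set U : ℝ → ℝ := fun s => u (Real.exp s • e) with hU
  have hu : ∀ x ≠ 0, u x = U (Real.log ‖x‖) := by
    intro x hx
    refine h.radial x _ hx (hne _) ?_
    rw [hnorm, Real.exp_log (norm_pos_iff.2 hx)]
  have hU2 : ContDiff ℝ 2 U := by
    rw [contDiff_iff_contDiffAt]
    intro s
    refine ContDiffAt.comp s (g := u) (f := fun s : ℝ => Real.exp s • e)
      (h.contDiffOn.contDiffAt (isOpen_compl_singleton.mem_nhds (hne s))) ?_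
    exact (Real.contDiff_exp.smul contDiff_const).contDiffAt
  have hU1 : ContDiff ℝ 1 (deriv U) := by
    have h2 : ContDiff ℝ (1 + 1) U := by norm_num; exact hU2
    exact (contDiff_succ_iff_deriv.1 h2).2.2
  have hUd : ∀ s, HasDerivAt U (deriv U s) s := fun s =>
    ((hU2.differentiable (by norm_num)) s).hasDerivAt
  have hVd : ∀ s, HasDerivAt (deriv U) (deriv (deriv U) s) s := fun s =>
    ((hU1.differentiable (by norm_num)) s).hasDerivAt
  refine ⟨U, deriv U, ⟨fun s _ => hUd s, fun s _ => ?_⟩, fun s => h.nonneg _ (hne s), ?_, hu⟩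
  · have h1 := h.equation _ (hne s)
    have h2 : u =ᶠ[𝓝 (Real.exp s • e)] fun y => U (Real.log ‖y‖) := by
      filter_upwards [isOpen_ne.mem_nhds (hne s)] with y hy using hu y hy
    rw [InnerProductSpace.laplacian_congr_nhds h2 |>.eq_of_nhds, laplacian_comp_log_norm hUd hVd (hne s),
      hu _ (hne s),
      hnorm, Real.log_exp] at h1
    have h3 : Real.exp (2 * s) = Real.exp s ^ 2 := by
      rw [← Real.exp_nat_mul]; push_cast; rfl
    refine (hVd s).congr_deriv ?_
    rw [h3]
    have := Real.exp_pos s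
    field_simp at h1
    linarith
  · refine h.singular.comp (tendsto_nhdsWithin_iff.2 ⟨?_, Eventually.of_forall hne⟩)
    have := Real.tendsto_exp_atBot.smul_const e
    rwa [zero_smul] at this

end Radial

/-! ### Membership in the closure of `BUC` -/

section UniformlyLocal

variable {N : ℕ}

lemma ulNorm_le_eLpNorm (p : ℝ≥0∞) (w : EuclideanSpace ℝ (Fin N) → ℝ) :
    ulNorm p w ≤ eLpNorm w p volume :=
  iSup_le fun _ => eLpNorm_mono_measure _ Measure.restrict_le_self

/-- A function that is approximated in `L¹(ℝᴺ)` by bounded uniformly continuous functions belongs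
to the closure of these in the uniformly local space. -/
lemma memULClosureBUC_one_of_forall_integrable {u : EuclideanSpace ℝ (Fin N) → ℝ}
    (h : ∀ ε : ℝ≥0∞, 0 < ε → ∃ v : EuclideanSpace ℝ (Fin N) →ᵇ ℝ, UniformContinuous v ∧
      Integrable (fun x => u x - v x) volume ∧
      eLpNorm (fun x => u x - v x) 1 volume < ε) : MemULClosureBUC 1 u := by
  refine ⟨?_, fun ε hε => ?_⟩
  · obtain ⟨v, _, hint, hlt⟩ := h 1 one_pos
    have hsplit : u = (fun x => u x - v x) + v := by
      funext x
      simp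
    have hvmeas : AEStronglyMeasurable v volume := v.continuous.aestronglyMeasurable
    refine ⟨fun K hK => ?_, ?_⟩
    · rw [hsplit]
      refine ((memLp_one_iff_integrable.2 hint).restrict K).add ?_
      have : IsFiniteMeasure (volume.restrict K) :=
        isFiniteMeasure_restrict.2 hK.measure_lt_top.ne
      exact MemLp.of_bound hvmeas.restrict ‖v‖ (ae_of_all _ fun x => v.norm_coe_le_norm x)
    · refine lt_of_le_of_lt (iSup_le fun z => ?_)
        (show (1 : ℝ≥0∞) + volume (Metric.ball (0 : EuclideanSpace ℝ (Fin N)) 1) *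
          ENNReal.ofReal ‖v‖ < ∞ from ENNReal.add_lt_top.2 ⟨ENNReal.one_lt_top,
            ENNReal.mul_lt_top Metric.isBounded_ball.measure_lt_top ENNReal.ofReal_lt_top⟩)
      rw [hsplit]
      refine (eLpNorm_add_le hint.aestronglyMeasurable.restrict hvmeas.restrict le_rfl).trans
        (add_le_add ?_ ?_)
      · exact (eLpNorm_mono_measure _ Measure.restrict_le_self).trans hlt.le
      · refine (eLpNorm_le_of_ae_bound (C := ‖v‖)
          (ae_of_all _ fun x => v.norm_coe_le_norm x)).trans ?_
        simp [Measure.addHaar_ball_center]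
  · obtain ⟨v, hv, _, hlt⟩ := h ε hε
    exact ⟨v, hv, (ulNorm_le_eLpNorm 1 _).trans_lt hlt⟩

/-- If the radial function `U(log ‖x‖)` is nonincreasing in `‖x‖`, grows at most
logarithmically at the origin and has bounded slope away from it, then it belongs to the closure
of `BUC`. Truncating at the radius `ε` gives the approximations. -/
theorem memULClosureBUC_comp_log_norm (hN : 2 ≤ N) {U V : ℝ → ℝ} (hU : ∀ s, HasDerivAt U (V s) s)
    (hpos : ∀ s, 0 ≤ U s) (hanti : Antitone U) (hV : ∀ a, ∃ L, ∀ s, a ≤ s → |V s| ≤ L)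
    {A B : ℝ} (hB : 0 ≤ B) (hgrowth : ∀ s ≤ 0, U s ≤ A - B * s) :
    MemULClosureBUC 1 (fun x : EuclideanSpace ℝ (Fin N) => U (Real.log ‖x‖)) := by
  have : NeZero N := ⟨by omega⟩
  have : Nontrivial (EuclideanSpace ℝ (Fin N)) := inferInstance
  have hUc : Continuous U := continuous_iff_continuousAt.2 fun s => (hU s).continuousAt
  set u : EuclideanSpace ℝ (Fin N) → ℝ := fun x => U (Real.log ‖x‖) with hu
  have hmeas : Measurable u := hUc.measurable.comp (Real.measurable_log.comp measurable_norm)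
  have hint : IntegrableOn u (Metric.ball 0 1) volume := by
    refine (integrableOn_fun_norm_addHaar volume (f := fun r => U (Real.log r)) (r := 1)).2 ?_
    have hm : Measurable fun y : ℝ => y ^ (Module.finrank ℝ (EuclideanSpace ℝ (Fin N)) - 1) •
        U (Real.log y) :=
      (measurable_id.pow_const _).smul (hUc.measurable.comp Real.measurable_log)
    refine Measure.integrableOn_of_bounded (M := A + B) (by simp) hm.aestronglyMeasurable ?_
    refine (ae_restrict_iff' measurableSet_Ioo).2 (ae_of_all _ fun y hy => ?_)
    have hlog : Real.log y ≤ 0 := Real.log_nonpos hy.1.le hy.2.le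
    have h1 := hgrowth _ hlog
    have h2 : y * (-Real.log y) ≤ 1 := by
      have h3 := Real.add_one_le_exp (-Real.log y)
      rw [Real.exp_neg, Real.exp_log hy.1] at h3
      have h4 := mul_le_mul_of_nonneg_left h3 hy.1.le
      rw [mul_inv_cancel₀ hy.1.ne'] at h4
      nlinarith [hy.1]
    have hA : 0 ≤ A := by
      have := (hpos 0).trans (hgrowth 0 le_rfl)
      linarith
    have h5 : y ^ (N - 1) ≤ y := by
      calc y ^ (N - 1) ≤ y ^ 1 := pow_le_pow_of_le_one hy.1.le hy.2.le (by omega)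
        _ = y := pow_one y
    rw [finrank_euclideanSpace_fin, smul_eq_mul, Real.norm_of_nonneg
      (mul_nonneg (pow_nonneg hy.1.le _) (hpos _))]
    calc y ^ (N - 1) * U (Real.log y) ≤ y * (A - B * Real.log y) :=
          mul_le_mul h5 h1 (hpos _) hy.1.le
      _ = A * y + B * (y * (-Real.log y)) := by ring
      _ ≤ A * 1 + B * 1 := add_le_add (mul_le_mul_of_nonneg_left hy.2.le hA)
          (mul_le_mul_of_nonneg_left h2 hB)
      _ = A + B := by ring
  refine memULClosureBUC_one_of_forall_integrable fun ε hε => ?_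
  -- a radius on which the integral of `u` is small
  obtain ⟨r, hr0, hr1, hrlt⟩ : ∃ r : ℝ, 0 < r ∧ r ≤ 1 ∧
      ∫⁻ x in Metric.ball (0 : EuclideanSpace ℝ (Fin N)) r, ‖u x‖ₑ < ε := by
    obtain ⟨δ, hδ, hδ'⟩ := exists_pos_setLIntegral_lt_of_measure_lt
      (μ := volume.restrict (Metric.ball (0 : EuclideanSpace ℝ (Fin N)) 1))
      (f := fun x => ‖u x‖ₑ) hint.2.ne hε.ne'
    have hlim : Tendsto (fun r : ℝ => volume (Metric.ball (0 : EuclideanSpace ℝ (Fin N)) r))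
        (𝓝[>] 0) (𝓝 0) := by
      have h1 : Tendsto (fun r : ℝ => ENNReal.ofReal (r ^ N) *
          volume (Metric.ball (0 : EuclideanSpace ℝ (Fin N)) 1)) (𝓝[>] 0)
          (𝓝 (ENNReal.ofReal (0 ^ N) * volume (Metric.ball (0 : EuclideanSpace ℝ (Fin N)) 1))) := by
        refine ENNReal.Tendsto.mul_const ?_ (Or.inr Metric.isBounded_ball.measure_lt_top.ne)
        refine ENNReal.tendsto_ofReal ?_
        exact ((continuous_pow N).tendsto 0).mono_left nhdsWithin_le_nhds
      rw [zero_pow (by omega), ENNReal.ofReal_zero, zero_mul] at h1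
      refine h1.congr' ?_
      filter_upwards [self_mem_nhdsWithin] with r hr
      rw [Measure.addHaar_ball volume _ (le_of_lt hr), finrank_euclideanSpace_fin]
    obtain ⟨r, hr1, hr2⟩ := ((hlim.eventually_lt_const hδ).and
      (Ioc_mem_nhdsGT (show (0 : ℝ) < 1 from one_pos))).exists
    refine ⟨r, hr2.1, hr2.2, ?_⟩
    have hsub : Metric.ball (0 : EuclideanSpace ℝ (Fin N)) r ⊆ Metric.ball 0 1 :=
      Metric.ball_subset_ball hr2.2
    have h2 := hδ' (Metric.ball 0 r) (by
      rw [Measure.restrict_apply Metric.isOpen_ball.measurableSet]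
      exact (measure_mono inter_subset_left).trans_lt hr1)
    rwa [Measure.restrict_restrict Metric.isOpen_ball.measurableSet,
      inter_eq_self_of_subset_left hsub] at h2
  obtain ⟨L, hL⟩ := hV (Real.log r)
  have hL0 : 0 ≤ L := (abs_nonneg _).trans (hL _ le_rfl)
  set g : EuclideanSpace ℝ (Fin N) → ℝ := fun x => U (Real.log (max ‖x‖ r)) with hg
  have hlip : LipschitzWith (L / r).toNNReal g := by
    refine LipschitzWith.of_dist_le_mul fun x y => ?_
    rw [Real.coe_toNNReal _ (by positivity)]
    have h1 := (convex_Ici r).norm_image_sub_le_of_norm_hasDerivWithin_le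
      (f := fun t => U (Real.log t)) (f' := fun t => V (Real.log t) * t⁻¹) (C := L / r)
      (fun t ht => ((hU _).comp t
        (Real.hasDerivAt_log (hr0.trans_le ht).ne')).hasDerivWithinAt)
      (fun t ht => by
        have ht0 : 0 < t := hr0.trans_le ht
        rw [Real.norm_eq_abs, abs_mul, abs_of_pos (inv_pos.2 ht0), div_eq_mul_inv]
        exact mul_le_mul (hL _ (Real.log_le_log hr0 ht)) (inv_anti₀ hr0 ht)
          (inv_pos.2 ht0).le hL0)
      (le_max_right ‖y‖ r) (le_max_right ‖x‖ r)
    rw [Real.dist_eq]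
    refine h1.trans (mul_le_mul_of_nonneg_left ?_ (by positivity))
    calc ‖max ‖x‖ r - max ‖y‖ r‖ ≤ |‖x‖ - ‖y‖| := abs_max_sub_max_le_abs _ _ _
      _ ≤ dist x y := by rw [dist_eq_norm]; exact abs_norm_sub_norm_le x y
  have hgle : ∀ x, g x ≤ U (Real.log r) := fun x =>
    hanti (Real.log_le_log hr0 (le_max_right _ _))
  set v : EuclideanSpace ℝ (Fin N) →ᵇ ℝ :=
    BoundedContinuousFunction.ofNormedAddCommGroup g hlip.continuous (U (Real.log r))
      (fun x => by rw [Real.norm_of_nonneg (hpos _)]; exact hgle x) with hv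
  have hbound : ∀ᵐ x : EuclideanSpace ℝ (Fin N) ∂volume,
      ‖u x - v x‖ₑ ≤ (Metric.ball 0 r).indicator (fun x => ‖u x‖ₑ) x := by
    filter_upwards [compl_mem_ae_iff.2 (measure_singleton (0 : EuclideanSpace ℝ (Fin N)))]
      with x hx
    have hx : x ≠ 0 := hx
    have hx0 : 0 < ‖x‖ := norm_pos_iff.2 hx
    have hvx : v x = g x := rfl
    rw [hvx]
    rcases lt_or_ge ‖x‖ r with hlt | hge
    · rw [indicator_of_mem (by simpa using hlt)]
      refine enorm_le_iff_norm_le.2 ?_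
      have h1 : g x ≤ u x := hanti (Real.log_le_log hx0 (le_max_left _ _))
      rw [Real.norm_of_nonneg (by linarith), Real.norm_of_nonneg (hpos _)]
      linarith [show 0 ≤ g x from hpos _]
    · have h1 : g x = u x := by simp only [hg, hu, max_eq_left hge]
      simp [h1]
  have hnorm : eLpNorm (fun x => u x - v x) 1 volume < ε := by
    rw [eLpNorm_one_eq_lintegral_enorm]
    refine (lintegral_mono_ae hbound).trans_lt ?_
    rwa [lintegral_indicator Metric.isOpen_ball.measurableSet]
  refine ⟨v, hlip.uniformContinuous, ?_, hnorm⟩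
  refine ⟨(hmeas.sub v.continuous.measurable).aestronglyMeasurable, ?_⟩
  rw [HasFiniteIntegral]
  have hint' : ∫⁻ x in Metric.ball (0 : EuclideanSpace ℝ (Fin N)) r, ‖u x‖ₑ < ∞ :=
    (hint.mono_set (Metric.ball_subset_ball hr1)).2
  refine (lintegral_mono_ae hbound).trans_lt ?_
  rwa [lintegral_indicator Metric.isOpen_ball.measurableSet]

end UniformlyLocal

/-! ### The singular solution -/

theorem proposition1p1 (N : ℕ) (hN : 3 ≤ N) (f : ℝ → ℝ)
    (hf : IsAdmissibleNonlinearity N f) :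
    -- the function `F` is well defined on `(0, ∞)` and maps it bijectively onto `(0, ∞)`
    (∀ a : ℝ, 0 < a → IntegrableOn (fun s => 1 / f s) (Ioi a) volume) ∧
    BijOn (tailIntegral f) (Ioi 0) (Ioi 0) ∧
    ∃ u : EuclideanSpace ℝ (Fin N) → ℝ,
      IsSingularSolution N f u ∧
      (∀ v : EuclideanSpace ℝ (Fin N) → ℝ, IsSingularSolution N f v → EqOn v u {0}ᶜ) ∧
      MemULClosureBUC 1 u ∧
      ∃ η : EuclideanSpace ℝ (Fin N) → ℝ,
        Tendsto η (𝓝[≠] 0) (𝓝 0) ∧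
        ∀ᶠ x in 𝓝[≠] (0 : EuclideanSpace ℝ (Fin N)),
          u x = tailIntegralInv f (‖x‖ ^ 2 / (2 * (N : ℝ) - 4) * (1 + η x)) := by
  refine ⟨fun a ha => hf.integrableOn_one_div ha, hf.bijOn_tailIntegral, ?_⟩
  have hN3 : (3 : ℝ) ≤ N := by exact_mod_cast hN
  set n : ℝ := (N : ℝ) - 2 with hn_def
  have hn : 1 ≤ n := by linarith
  have hn0 : 0 < n := by linarith
  obtain ⟨U, V, h, hpos, hsing⟩ :=
    hf.exists_singular_profile_univ (n := n) (by rw [hn_def]; ring) hn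
  have hIic := fun S => h.mono (subset_univ (Iic S))
  have hUd : ∀ s, HasDerivAt U (V s) s := fun s => h.hasDerivAt s (mem_univ s)
  have hVneg : ∀ s, V s < 0 := fun s =>
    (hIic s).deriv_neg hf (fun t _ => (hpos t).le) hsing s le_rfl
  have hslope : ∀ s, -V s ≤ n * U s := fun s =>
    (hIic s).neg_deriv_le hf (by rw [hn_def]; ring) hn (fun t _ => hpos t) hsing s le_rfl
  have hanti : Antitone U := antitone_of_hasDerivAt_nonpos hUd (fun s => (hVneg s).le)
  have hlog : Tendsto (fun x : EuclideanSpace ℝ (Fin N) => Real.log ‖x‖) (𝓝[≠] 0) atBot :=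
    Real.tendsto_log_nhdsGT_zero.comp tendsto_norm_nhdsNE_zero
  refine ⟨fun x => U (Real.log ‖x‖), h.isSingularSolution hf hpos hsing, ?_, ?_, ?_⟩
  · intro v hv x hx
    obtain ⟨U₂, V₂, h₂, hpos₂, hsing₂, hv₂⟩ := hv.exists_profile (by omega)
    rw [hv₂ x hx, h₂.eq_of_singular h hf hn hpos₂ (fun s => (hpos s).le) hsing₂ hsing]
  · obtain ⟨T, C, _, hC, hT⟩ := (hIic 0).exists_bounds hf hn hsing
    refine memULClosureBUC_comp_log_norm (by omega) hUd (fun s => (hpos s).le) hanti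
      (fun a => ⟨n * U a, fun s hs => ?_⟩) (A := U T + C * |T|) hC (fun s hs => ?_)
    · rw [abs_of_neg (hVneg s)]
      exact (hslope s).trans (mul_le_mul_of_nonneg_left (hanti hs) hn0.le)
    · have h1 : C * T ≤ C * |T| := mul_le_mul_of_nonneg_left (le_abs_self T) hC
      rcases le_or_gt s T with hsT | hsT
      · have h2 := (hT s hsT).2.2
        linarith
      · have h2 := hanti hsT.le
        have h3 : 0 ≤ C * |T| := by positivity
        have h4 : C * s ≤ 0 := mul_nonpos_of_nonneg_of_nonpos hC hs
        linarith
  · refine ⟨fun x => Real.exp (-emdenShift n f U (Real.log ‖x‖)) - 1, ?_, ?_⟩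
    · have h1 : Tendsto (fun s => Real.exp (emdenShift n f U s)) atBot (𝓝 1) := by
        rw [Metric.tendsto_nhds]
        intro ε hε
        filter_upwards [(hIic 0).eventually_emdenDist_lt hf hn hsing
          (show 0 < (ε / 2) ^ 2 by positivity)] with s hs
        rw [Real.dist_eq]
        have := (abs_le_of_emdenDist_le (by positivity) hs.le).1
        linarith
      have h2 : Tendsto (fun s => Real.exp (-emdenShift n f U s) - 1) atBot (𝓝 0) := by
        have := (h1.inv₀ one_ne_zero).sub_const 1
        simpa [Real.exp_neg] using this
      exact h2.comp hlog
    · filter_upwards [self_mem_nhdsWithin] with x hx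
      have hx : x ≠ 0 := hx
      have hx0 : 0 < ‖x‖ := norm_pos_iff.2 hx
      have hF := hf.tailIntegral_pos (hpos (Real.log ‖x‖))
      have h1 : ‖x‖ ^ 2 / (2 * (N : ℝ) - 4) *
          (1 + (Real.exp (-emdenShift n f U (Real.log ‖x‖)) - 1)) =
          tailIntegral f (U (Real.log ‖x‖)) := by
        rw [Real.exp_neg, IsRadialProfile.exp_emdenShift hf hn0 (hpos _), mul_comm (2 : ℝ)
          (Real.log ‖x‖), Real.exp_mul, Real.exp_log hx0, Real.rpow_ofNat,
          show 2 * (N : ℝ) - 4 = 2 * n by rw [hn_def]; ring]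
        field_simp
        ring
      rw [h1]
      exact (hf.strictAntiOn_tailIntegral.injOn.leftInvOn_invFunOn (hpos (Real.log ‖x‖))).symm
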